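/- **Setting.** Let $H$ be a finite-dimensional $C^*$ Hopf algebra and $\mathcal C=\mathsf{Rep}(H)$ the monoidal category of its finite-dimensional left modules. A finite semisimple $\mathcal C$-module category is a finite semisimple $\mathbb C$-linear abelian category with a left action $\otimes$ of $\mathcal C$ that is bilinear on morphisms; $\mathsf{Fun}_{\mathcal C}(\mathcal M,\mathcal N)$ is the category of $\mathbb C$-linear $\mathcal C$-module functors and module natural transformations. An object $M\in\mathcal M$ is a generator if for every nonzero $N'\in\mathcal M$ there is $X\in\mathcal C$ with $\operatorname{Hom}(X\otimes M,N')\neq 0$. A finite-dimensional left $H$-module algebra $\mathfrak M$ is the same as an algebra in $\mathcal C$; given an action $\gamma:\mathfrak M\otimes M\to M$ of it on $M\in\mathcal M$, we say that $\mathfrak M$ is the internal End of $M$ if $\operatorname{Hom}(X,\mathfrak M)\to\operatorname{Hom}(X\otimes M,M)$, $f\mapsto\gamma\circ(f\otimes\mathrm{id}_M)$, is bijective for every $X\in\mathcal C$. Write $\mathcal C_{\mathfrak M}$ for the $\mathcal C$-module category of right $\mathfrak M$-modules in $\mathcal C$, and ${}_{\mathfrak M}\mathcal C_{\mathfrak N}$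 for the category of $\mathfrak M|\mathfrak N$-bimodules in $\mathcal C$ (left $\mathfrak M$, right $\mathfrak N$). A gapped boundary is a finite semisimple $\mathcal C$-module category $\mathcal M$; it is determined by $\mathfrak M$ if $\mathfrak M$ is the internal End of a generator $M\in\mathcal M$. Its boundary excitations are the objects of $\mathsf{Fun}_{\mathcal C}(\mathcal M,\mathcal M)$, and the defects from the boundary $\mathcal M$ to a boundary $\mathcal N$ are the objects of $\mathsf{Fun}_{\mathcal C}(\mathcal M,\mathcal N)$. **Proposition.** Let $\mathcal M$ be a boundary determined by $\mathfrak M$ (with generator $M$) and $\mathcal N$ a boundary determined by $\mathfrak N$ (with generator $N$). (0) Let $\mathfrak A=\mathfrak M^{\rm op}\# H^{\rm cop}$, that is, $\mathfrak M\otimes H$ with product $(a\# h)(b\# g)=\sum (h_{(2)}\triangleright b)\,a\,\#\,h_{(1)}g$ (product of $\mathfrak M$ and comultiplication of $H$ on the right-hand side) and left $H$-coaction $a\# h\mapsto\sum h_{(1)}\otimes(a\# h_{(2)})$. This is a left $H$-comodule algebra, and there is an equivalence of $\mathcal C$-module categories $\mathcal C_{\mathfrak M}\simeq{}_{\mathfrak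 A}\mathsf{Mod}$ (finite-dimensional modules) that keeps the underlying spaces and has $(a\# h)\triangleright m=(h\triangleright m)\triangleleft a$. Moreover there are equivalences of $\mathcal C$-module categories $P:\mathcal C_{\mathfrak M}\simeq\mathcal M$ and $Q:\mathcal C_{\mathfrak N}\simeq\mathcal N$ with $P(\mathfrak M)\cong M$ as left $\mathfrak M$-modules and $Q(\mathfrak N)\cong N$ as left $\mathfrak N$-modules. (1) The boundary excitations of $\mathcal M$ are classified by $\mathfrak M|\mathfrak M$-bimodules in $\mathsf{Rep}(H)$: there is a $\mathbb C$-linear equivalence $\Phi:\mathsf{Fun}_{\mathcal C}(\mathcal M,\mathcal M)\simeq{}_{\mathfrak M}\mathcal C_{\mathfrak M}$, given by $F\mapsto F(M)$; that is, $P(\Phi(F))\cong F(M)$ naturally in $F$ and compatibly with the left $\mathfrak M$-actions. (2) The defects from the $\mathfrak M$-boundary $\mathcal M$ to the $\mathfrak N$-boundary $\mathcal N$ are classified by $\mathfrak N|\mathfrak M$-bimodules in $\mathsf{Rep}(H)$. Precisely, the evaluations $F\mapsto F(M)$ and $G\mapsto G(N)$ give, in the same sense (through $Q$ and $P$ respectively),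 $\mathbb C$-linear equivalences $$\mathsf{Fun}_{\mathcal C}(\mathcal M,\mathcal N)\simeq{}_{\mathfrak M}\mathcal C_{\mathfrak N},\qquad \Phi':\mathsf{Fun}_{\mathcal C}(\mathcal N,\mathcal M)\simeq{}_{\mathfrak N}\mathcal C_{\mathfrak M},$$ and there is an equivalence $\Psi:\mathsf{Fun}_{\mathcal C}(\mathcal M,\mathcal N)^{\rm op}\simeq{}_{\mathfrak N}\mathcal C_{\mathfrak M}$ such that every $F$ has a right adjoint $G\in\mathsf{Fun}_{\mathcal C}(\mathcal N,\mathcal M)$ (as a $\mathcal C$-module functor) with $\Psi(F)\cong\Phi'(G)$. -/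

import Mathlib

open CategoryTheory MonoidalCategory MonoidalLeftAction
open scoped TensorProduct MonObj

set_option linter.unusedVariables false
set_option linter.unusedSectionVars false

namespace QuantumDouble

/-! ### Finite-dimensional `C*` Hopf algebras and their representations -/

/-- A finite-dimensional `C*` Hopf algebra: a finite-dimensional complex Hopf algebra with a
`*`-structure for which the comultiplication is a `*`-homomorphism, and which has a faithful
`*`-representation by operators on some Hilbert space. -/
class CStarHopfAlgebra (H : Type) [Ring H] [HopfAlgebra ℂ H] [StarRing H] [StarModule ℂ H] :
    Prop where
  finite : Module.Finite ℂ H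
  comul_star : ∀ (x : H) (s : Finset (H × H)),
    Coalgebra.comul (R := ℂ) x = ∑ p ∈ s, p.1 ⊗ₜ[ℂ] p.2 →
      Coalgebra.comul (R := ℂ) (star x) = ∑ p ∈ s, star p.1 ⊗ₜ[ℂ] star p.2
  exists_faithful : ∃ (E : Type) (_ : NormedAddCommGroup E) (_ : InnerProductSpace ℂ E)
    (_ : CompleteSpace E) (π : H →⋆ₐ[ℂ] (E →L[ℂ] E)), Function.Injective π

/-- A finite-dimensional left module over the complex algebra `A`. -/
structure FdMod (A : Type) [Ring A] [Algebra ℂ A] where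
  V : Type
  [addCommGroup : AddCommGroup V]
  [module : Module ℂ V]
  [finite : Module.Finite ℂ V]
  ρ : A →ₐ[ℂ] Module.End ℂ V

attribute [instance] FdMod.addCommGroup FdMod.module FdMod.finite

namespace FdMod

section Category

variable {A : Type} [Ring A] [Algebra ℂ A]

/-- `A`-linear maps. -/
@[ext]
structure Hom (X Y : FdMod A) where
  hom : X.V →ₗ[ℂ] Y.V
  comm : ∀ a : A, hom ∘ₗ X.ρ a = Y.ρ a ∘ₗ hom

instance : Category (FdMod A) where
  Hom X Y := Hom X Y
  id X := ⟨LinearMap.id, fun _ => rfl⟩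
  comp f g := ⟨g.hom ∘ₗ f.hom, fun a => by
    rw [LinearMap.comp_assoc, f.comm, ← LinearMap.comp_assoc, g.comm, LinearMap.comp_assoc]⟩

@[ext]
theorem hom_ext {X Y : FdMod A} {f g : X ⟶ Y} (h : f.hom = g.hom) : f = g := Hom.ext h

@[simp] theorem id_hom (X : FdMod A) : Hom.hom (𝟙 X) = LinearMap.id := rfl

@[simp] theorem comp_hom {X Y Z : FdMod A} (f : X ⟶ Y) (g : Y ⟶ Z) :
    (f ≫ g).hom = g.hom ∘ₗ f.hom := rfl

theorem comm_apply {X Y : FdMod A} (f : X ⟶ Y) (a : A) (v : X.V) :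
    f.hom (X.ρ a v) = Y.ρ a (f.hom v) := LinearMap.congr_fun (f.comm a) v

instance (X Y : FdMod A) : Zero (X ⟶ Y) := ⟨⟨0, fun _ => by simp⟩⟩

instance (X Y : FdMod A) : Add (X ⟶ Y) :=
  ⟨fun f g => ⟨f.hom + g.hom, fun a => by
    rw [LinearMap.add_comp, LinearMap.comp_add, f.comm, g.comm]⟩⟩

instance (X Y : FdMod A) : Neg (X ⟶ Y) :=
  ⟨fun f => ⟨-f.hom, fun a => by rw [LinearMap.neg_comp, LinearMap.comp_neg, f.comm]⟩⟩

instance (X Y : FdMod A) : AddCommGroup (X ⟶ Y) where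
  add_assoc f g h := hom_ext (add_assoc f.hom g.hom h.hom)
  zero_add f := hom_ext (zero_add f.hom)
  add_zero f := hom_ext (add_zero f.hom)
  add_comm f g := hom_ext (add_comm f.hom g.hom)
  neg_add_cancel f := hom_ext (neg_add_cancel f.hom)
  nsmul := nsmulRec
  zsmul := zsmulRec

@[simp] theorem add_hom {X Y : FdMod A} (f g : X ⟶ Y) : (f + g).hom = f.hom + g.hom := rfl

@[simp] theorem zero_hom (X Y : FdMod A) : Hom.hom (0 : X ⟶ Y) = 0 := rfl

instance (X Y : FdMod A) : Module ℂ (X ⟶ Y) where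
  smul c f := ⟨c • f.hom, fun a => by
    rw [LinearMap.smul_comp, LinearMap.comp_smul, f.comm]⟩
  one_smul f := hom_ext (one_smul ℂ f.hom)
  mul_smul c d f := hom_ext (mul_smul c d f.hom)
  smul_zero c := hom_ext (smul_zero c)
  smul_add c f g := hom_ext (smul_add c f.hom g.hom)
  add_smul c d f := hom_ext (add_smul c d f.hom)
  zero_smul f := hom_ext (zero_smul ℂ f.hom)

@[simp] theorem smul_hom {X Y : FdMod A} (c : ℂ) (f : X ⟶ Y) : (c • f).hom = c • f.hom := rfl

instance : Preadditive (FdMod A) where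
  add_comp _ _ _ f f' g := hom_ext (LinearMap.comp_add f.hom f'.hom g.hom)
  comp_add _ _ _ f g g' := hom_ext (LinearMap.add_comp f.hom g'.hom g.hom)

instance : Linear ℂ (FdMod A) where
  smul_comp _ _ _ c f g := hom_ext (LinearMap.comp_smul g.hom c f.hom)
  comp_smul _ _ _ f c g := hom_ext (LinearMap.smul_comp c g.hom f.hom)

/-- An isomorphism of modules from an equivariant linear equivalence. -/
def mkIso {X Y : FdMod A} (e : X.V ≃ₗ[ℂ] Y.V)
    (h : ∀ a, e.toLinearMap ∘ₗ X.ρ a = Y.ρ a ∘ₗ e.toLinearMap) : X ≅ Y where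
  hom := ⟨e.toLinearMap, h⟩
  inv := ⟨e.symm.toLinearMap, fun a => by
    ext v
    apply e.injective
    have := LinearMap.congr_fun (h a) (e.symm v)
    simp at this
    simp [this]⟩
  hom_inv_id := by ext; simp
  inv_hom_id := by ext; simp

@[simp] theorem mkIso_hom_hom {X Y : FdMod A} (e : X.V ≃ₗ[ℂ] Y.V) (h) :
    (mkIso e h).hom.hom = e.toLinearMap := rfl

@[simp] theorem mkIso_inv_hom {X Y : FdMod A} (e : X.V ≃ₗ[ℂ] Y.V) (h) :
    (mkIso e h).inv.hom = e.symm.toLinearMap := rfl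

end Category

end FdMod

/-! ### Comodule algebras and the tensor product of representations -/

/-- A left `H`-comodule algebra: an algebra `A` with a coassociative and counital left coaction
`A → H ⊗ A` that is an algebra homomorphism. -/
class LeftComoduleAlgebra (H A : Type) [Ring H] [Bialgebra ℂ H] [Ring A] [Algebra ℂ A] where
  coact : A →ₐ[ℂ] H ⊗[ℂ] A
  coassoc : ∀ a : A,
    TensorProduct.assoc ℂ H H A ((Coalgebra.comul (R := ℂ) (A := H)).rTensor A (coact a)) =
      coact.toLinearMap.lTensor H (coact a)
  counit_coact : ∀ a : A,
    (Coalgebra.counit (R := ℂ) (A := H)).rTensor A (coact a) = 1 ⊗ₜ[ℂ] a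

/-- A bialgebra is a left comodule algebra over itself through its comultiplication. -/
@[reducible] noncomputable def selfComodule (H : Type) [Ring H] [Bialgebra ℂ H] :
    LeftComoduleAlgebra H H where
  coact := Bialgebra.comulAlgHom ℂ H
  coassoc a := Coalgebra.coassoc_apply a
  counit_coact a := Coalgebra.rTensor_counit_comul a

namespace FdMod

section Tensor

variable {H A : Type} [Ring H] [Bialgebra ℂ H] [Ring A] [Algebra ℂ A]

/-- The action of `B ⊗ A` on `V ⊗ W` by `(b ⊗ a)(v ⊗ w) = b v ⊗ a w`. -/
noncomputable def box {B A V W : Type} [Ring B] [Algebra ℂ B] [Ring A] [Algebra ℂ A]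
    [AddCommGroup V] [Module ℂ V] [AddCommGroup W] [Module ℂ W]
    (f : B →ₐ[ℂ] Module.End ℂ V) (g : A →ₐ[ℂ] Module.End ℂ W) :
    B ⊗[ℂ] A →ₐ[ℂ] Module.End ℂ (V ⊗[ℂ] W) :=
  (Module.endTensorEndAlgHom (R := ℂ) (S := ℂ) (A := ℂ)).comp (Algebra.TensorProduct.map f g)

@[simp] theorem box_tmul {B A V W : Type} [Ring B] [Algebra ℂ B] [Ring A] [Algebra ℂ A]
    [AddCommGroup V] [Module ℂ V] [AddCommGroup W] [Module ℂ W]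
    (f : B →ₐ[ℂ] Module.End ℂ V) (g : A →ₐ[ℂ] Module.End ℂ W) (b : B) (a : A) :
    box f g (b ⊗ₜ a) = TensorProduct.map (f b) (g a) := rfl

/-- The action of `H ⊗ A` on `X ⊗ M`, for an `H`-module `X` and an `A`-module `M`. -/
noncomputable abbrev boxRho (X : FdMod H) (M : FdMod A) :
    H ⊗[ℂ] A →ₐ[ℂ] Module.End ℂ (X.V ⊗[ℂ] M.V) := box X.ρ M.ρ

theorem map_boxRho {X Y : FdMod H} {M N : FdMod A} (f : X ⟶ Y) (g : M ⟶ N) (t : H ⊗[ℂ] A) :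
    TensorProduct.map f.hom g.hom ∘ₗ boxRho X M t =
      boxRho Y N t ∘ₗ TensorProduct.map f.hom g.hom := by
  induction t with
  | zero => simp
  | add s t hs ht => rw [map_add, map_add, LinearMap.comp_add, LinearMap.add_comp, hs, ht]
  | tmul h a =>
    rw [box_tmul, box_tmul, ← TensorProduct.map_comp, ← TensorProduct.map_comp,
      f.comm, g.comm]

variable [LeftComoduleAlgebra H A]

/-- The `A`-module `X ⊗ M`, for an `H`-module `X` and an `A`-module `M`: the algebra `A` acts
through its coaction `A → H ⊗ A`. -/
noncomputable def tensor (X : FdMod H) (M : FdMod A) : FdMod A where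
  V := X.V ⊗[ℂ] M.V
  ρ := (boxRho X M).comp (LeftComoduleAlgebra.coact (H := H) (A := A))

theorem tensor_rho (X : FdMod H) (M : FdMod A) (a : A) :
    (tensor X M).ρ a = boxRho X M (LeftComoduleAlgebra.coact a) := rfl

/-- The tensor product of two morphisms. -/
noncomputable def tensorMap {X Y : FdMod H} {M N : FdMod A} (f : X ⟶ Y) (g : M ⟶ N) :
    tensor X M ⟶ tensor Y N :=
  ⟨TensorProduct.map f.hom g.hom, fun _ => map_boxRho f g _⟩

@[simp] theorem tensorMap_hom {X Y : FdMod H} {M N : FdMod A} (f : X ⟶ Y) (g : M ⟶ N) :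
    (tensorMap f g).hom = TensorProduct.map f.hom g.hom := rfl

end Tensor

section Assoc

variable {H A : Type} [Ring H] [Bialgebra ℂ H] [Ring A] [Algebra ℂ A] [LeftComoduleAlgebra H A]

/-- The tensor product of two representations of a bialgebra. -/
noncomputable abbrev tensorH (X Y : FdMod H) : FdMod H :=
  letI := selfComodule H
  tensor X Y

theorem assoc_box (X Y : FdMod H) (M : FdMod A) (t : (H ⊗[ℂ] H) ⊗[ℂ] A) :
    (TensorProduct.assoc ℂ X.V Y.V M.V).toLinearMap ∘ₗ box (boxRho X Y) M.ρ t =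
    box X.ρ (boxRho Y M) (TensorProduct.assoc ℂ H H A t) ∘ₗ
      (TensorProduct.assoc ℂ X.V Y.V M.V).toLinearMap := by
  induction t with
  | zero => simp only [map_zero, LinearMap.comp_zero, LinearMap.zero_comp]
  | add s t hs ht => simp only [map_add, LinearMap.comp_add, LinearMap.add_comp, hs, ht]
  | tmul u a =>
    induction u with
    | zero =>
      simp only [TensorProduct.zero_tmul, map_zero, LinearMap.comp_zero, LinearMap.zero_comp]
    | add s t hs ht =>
      simp only [TensorProduct.add_tmul, map_add, LinearMap.comp_add, LinearMap.add_comp, hs, ht]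
    | tmul g h =>
      apply TensorProduct.ext_threefold
      intro x y m
      simp

/-- The associativity isomorphism `(X ⊗ Y) ⊗ M ≅ X ⊗ (Y ⊗ M)`. -/
noncomputable def assocIso (X Y : FdMod H) (M : FdMod A) :
    tensor (tensorH X Y) M ≅ tensor X (tensor Y M) :=
  mkIso (TensorProduct.assoc ℂ X.V Y.V M.V) fun a => by
    have h := assoc_box X Y M
      ((Coalgebra.comul (R := ℂ) (A := H)).rTensor A (LeftComoduleAlgebra.coact a))
    rw [LeftComoduleAlgebra.coassoc] at h
    have h1 : ∀ t : H ⊗[ℂ] A, boxRho (tensorH X Y) M t = box (boxRho X Y) M.ρ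
        ((Coalgebra.comul (R := ℂ) (A := H)).rTensor A t) := by
      intro t
      induction t with
      | zero => simp only [map_zero]; rfl
      | add s t hs ht => rw [map_add, hs, ht, map_add, map_add]; rfl
      | tmul g b => rfl
    have h2 : ∀ t : H ⊗[ℂ] A, boxRho X (tensor Y M) t = box X.ρ (boxRho Y M)
        ((LeftComoduleAlgebra.coact (H := H) (A := A)).toLinearMap.lTensor H t) := by
      intro t
      induction t with
      | zero => simp only [map_zero]; rfl
      | add s t hs ht => rw [map_add, hs, ht, map_add, map_add]; rfl
      | tmul g b => rfl
    rw [tensor_rho, tensor_rho, h1, h2]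
    exact h

/-- The counit as a representation on `ℂ`. -/
noncomputable def unitRho (H : Type) [Ring H] [Bialgebra ℂ H] : H →ₐ[ℂ] Module.End ℂ ℂ :=
  (Algebra.ofId ℂ (Module.End ℂ ℂ)).comp (Bialgebra.counitAlgHom ℂ H)

theorem unitRho_apply {H : Type} [Ring H] [Bialgebra ℂ H] (h : H) (c : ℂ) :
    unitRho H h c = Coalgebra.counit (R := ℂ) h * c := rfl

/-- The trivial representation, given by the counit. -/
noncomputable def unit (H : Type) [Ring H] [Bialgebra ℂ H] : FdMod H where
  V := ℂ
  ρ := unitRho H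

/-- The left unit isomorphism `ℂ ⊗ M ≅ M`. -/
noncomputable def lUnitIso (M : FdMod A) : tensor (unit H) M ≅ M :=
  mkIso (TensorProduct.lid ℂ M.V) fun a => by
    have key : ∀ t : H ⊗[ℂ] A,
        (TensorProduct.lid ℂ M.V).toLinearMap ∘ₗ box (unitRho H) M.ρ t =
          M.ρ (TensorProduct.lid ℂ A ((Coalgebra.counit (R := ℂ) (A := H)).rTensor A t)) ∘ₗ
            (TensorProduct.lid ℂ M.V).toLinearMap := by
      intro t
      induction t with
      | zero => simp only [map_zero, LinearMap.comp_zero, LinearMap.zero_comp]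
      | add s t hs ht => simp only [map_add, LinearMap.comp_add, LinearMap.add_comp, hs, ht]
      | tmul g b =>
        apply TensorProduct.ext'
        intro c m
        simp [unitRho_apply, mul_smul]
    have e : TensorProduct.lid ℂ A ((Coalgebra.counit (R := ℂ) (A := H)).rTensor A
        (LeftComoduleAlgebra.coact (H := H) a)) = a := by
      rw [LeftComoduleAlgebra.counit_coact]
      simp
    exact (key _).trans
      (congrArg (fun b => M.ρ b ∘ₗ (TensorProduct.lid ℂ M.V).toLinearMap) e)

end Assoc

section Monoidal

variable {H : Type} [Ring H] [Bialgebra ℂ H]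

/-- The right unit isomorphism `X ⊗ ℂ ≅ X`. -/
noncomputable def rUnitIso (X : FdMod H) : tensorH X (unit H) ≅ X :=
  mkIso (TensorProduct.rid ℂ X.V) fun a => by
    have key : ∀ t : H ⊗[ℂ] H,
        (TensorProduct.rid ℂ X.V).toLinearMap ∘ₗ box X.ρ (unitRho H) t =
          X.ρ (TensorProduct.rid ℂ H ((Coalgebra.counit (R := ℂ) (A := H)).lTensor H t)) ∘ₗ
            (TensorProduct.rid ℂ X.V).toLinearMap := by
      intro t
      induction t with
      | zero => simp only [map_zero, LinearMap.comp_zero, LinearMap.zero_comp]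
      | add s t hs ht => simp only [map_add, LinearMap.comp_add, LinearMap.add_comp, hs, ht]
      | tmul g b =>
        apply TensorProduct.ext'
        intro m c
        simp [unitRho_apply, mul_smul]
    have e : TensorProduct.rid ℂ H ((Coalgebra.counit (R := ℂ) (A := H)).lTensor H
        (Coalgebra.comul (R := ℂ) a)) = a := by
      rw [Coalgebra.lTensor_counit_comul]
      simp
    exact (key _).trans
      (congrArg (fun b => X.ρ b ∘ₗ (TensorProduct.rid ℂ X.V).toLinearMap) e)

noncomputable instance : MonoidalCategoryStruct (FdMod H) where
  tensorObj := tensorH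
  tensorHom f g := letI := selfComodule H; tensorMap f g
  whiskerLeft X _ _ f := letI := selfComodule H; tensorMap (𝟙 X) f
  whiskerRight f Y := letI := selfComodule H; tensorMap f (𝟙 Y)
  tensorUnit := unit H
  associator X Y Z := letI := selfComodule H; assocIso X Y Z
  leftUnitor X := letI := selfComodule H; lUnitIso X
  rightUnitor := rUnitIso

noncomputable instance : MonoidalCategory (FdMod H) where
  id_tensorHom_id X Y := by
    apply hom_ext
    exact TensorProduct.map_id
  tensorHom_def f g := by
    apply hom_ext
    exact TensorProduct.ext' fun _ _ => rfl
  tensorHom_comp_tensorHom f g f' g' := by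
    apply hom_ext
    exact TensorProduct.ext' fun _ _ => rfl
  whiskerLeft_id X Y := by
    apply hom_ext
    exact TensorProduct.map_id
  id_whiskerRight X Y := by
    apply hom_ext
    exact TensorProduct.map_id
  associator_naturality f g h := by
    apply hom_ext
    exact TensorProduct.ext_threefold fun _ _ _ => rfl
  leftUnitor_naturality f := by
    apply hom_ext
    exact TensorProduct.ext' fun c m => (f.hom.map_smul c m).symm
  rightUnitor_naturality f := by
    apply hom_ext
    exact TensorProduct.ext' fun m c => (f.hom.map_smul c m).symm
  pentagon W X Y Z := by
    apply hom_ext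
    exact TensorProduct.ext_fourfold fun _ _ _ _ => rfl
  triangle X Y := by
    apply hom_ext
    exact TensorProduct.ext_threefold fun x (c : ℂ) y =>
      (TensorProduct.smul_tmul c x y).symm

instance : MonoidalPreadditive (FdMod H) where
  whiskerLeft_zero := hom_ext (TensorProduct.ext' fun _ _ => TensorProduct.tmul_zero _ _)
  zero_whiskerRight := hom_ext (TensorProduct.ext' fun _ _ => TensorProduct.zero_tmul _ _)
  whiskerLeft_add f g :=
    hom_ext (TensorProduct.ext' fun _ _ => TensorProduct.tmul_add _ _ _)
  add_whiskerRight f g :=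
    hom_ext (TensorProduct.ext' fun _ _ => TensorProduct.add_tmul _ _ _)

instance : MonoidalLinear ℂ (FdMod H) where
  whiskerLeft_smul X _ _ c f :=
    hom_ext (TensorProduct.ext' fun _ _ => TensorProduct.tmul_smul _ _ _)
  smul_whiskerRight c _ _ f Z :=
    hom_ext (TensorProduct.ext' fun _ _ => TensorProduct.smul_tmul' _ _ _)

end Monoidal

/-- The category `A`-mod over a left `H`-comodule algebra `A` is a `Rep(H)`-module category, with
`X ⊗ M` carrying the action of `A` through its coaction. -/
noncomputable instance {H A : Type} [Ring H] [Bialgebra ℂ H] [Ring A] [Algebra ℂ A]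
    [LeftComoduleAlgebra H A] : MonoidalLeftAction (FdMod H) (FdMod A) where
  actionObj := tensor
  actionHom := tensorMap
  actionHomLeft f M := tensorMap f (𝟙 M)
  actionHomRight X _ _ f := tensorMap (𝟙 X) f
  actionAssocIso := assocIso
  actionUnitIso := lUnitIso
  actionHom_def _ _ := hom_ext (TensorProduct.ext' fun _ _ => rfl)
  actionHomRight_id _ _ := hom_ext TensorProduct.map_id
  id_actionHomLeft X M := hom_ext TensorProduct.map_id
  actionHom_comp f f' g g' := hom_ext (TensorProduct.ext' fun _ _ => rfl)
  actionAssocIso_hom_naturality f g h := hom_ext (TensorProduct.ext_threefold fun _ _ _ => rfl)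
  actionUnitIso_hom_naturality f :=
    hom_ext (TensorProduct.ext' fun c m => f.hom.map_smul c m)
  whiskerLeft_actionHomLeft X _ _ f M := hom_ext (TensorProduct.ext_threefold fun _ _ _ => rfl)
  whiskerRight_actionHomLeft X f M := hom_ext (TensorProduct.ext_threefold fun _ _ _ => rfl)
  associator_actionHom X Y Z M := hom_ext (TensorProduct.ext_fourfold fun _ _ _ _ => rfl)
  leftUnitor_actionHom X M := hom_ext (TensorProduct.ext_threefold fun (c : ℂ) x m =>
    (TensorProduct.smul_tmul' c x m).symm)
  rightUnitor_actionHom X M := hom_ext (TensorProduct.ext_threefold fun x (c : ℂ) m =>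
    TensorProduct.smul_tmul c x m)

end FdMod

/-! ### Module algebras and the smash product `𝔐ᵒᵖ # Hᶜᵒᵖ` -/

/-- A left `H`-module algebra: `h ▷ (x y) = ∑ (h₁ ▷ x) (h₂ ▷ y)` and `h ▷ 1 = ε(h) 1`. -/
class HModuleAlgebra (H M : Type) [Ring H] [Bialgebra ℂ H] [Ring M] [Algebra ℂ M] where
  act : H →ₐ[ℂ] Module.End ℂ M
  act_mul : ∀ h : H, act h ∘ₗ LinearMap.mul' ℂ M =
    LinearMap.mul' ℂ M ∘ₗ FdMod.box act act (Coalgebra.comul (R := ℂ) h)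
  act_one : ∀ h : H, act h 1 = Coalgebra.counit (R := ℂ) h • (1 : M)

namespace HModuleAlgebra

/-- A finite-dimensional `H`-module algebra, as an algebra object in `Rep(H)`. -/
noncomputable def mon (H M : Type) [Ring H] [Bialgebra ℂ H] [Ring M] [Algebra ℂ M]
    [Module.Finite ℂ M] [HModuleAlgebra H M] : Mon (FdMod H) where
  X := { V := M, ρ := act }
  mon :=
    { one := ⟨LinearMap.toSpanSingleton ℂ M 1, fun h => by
        ext
        change (Coalgebra.counit (R := ℂ) h * 1) • (1 : M) = act h ((1 : ℂ) • (1 : M))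
        rw [one_smul, act_one, mul_one]⟩
      mul := ⟨LinearMap.mul' ℂ M, fun h => (act_mul h).symm⟩
      one_mul := FdMod.hom_ext (TensorProduct.ext' fun (c : ℂ) (m : M) =>
        show (c • (1 : M)) * m = c • m by simp)
      mul_one := FdMod.hom_ext (TensorProduct.ext' fun (m : M) (c : ℂ) =>
        show m * (c • (1 : M)) = c • m by simp)
      mul_assoc := FdMod.hom_ext (TensorProduct.ext_threefold fun (x y z : M) =>
        show (x * y) * z = x * (y * z) from mul_assoc x y z) }

end HModuleAlgebra

/-- The underlying space `𝔐 ⊗ H` of the smash product `𝔐ᵒᵖ # Hᶜᵒᵖ`. -/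
def Smash (H M : Type) [Ring H] [Algebra ℂ H] [Ring M] [Algebra ℂ M] : Type := M ⊗[ℂ] H

namespace Smash

variable {H M : Type} [Ring H] [Bialgebra ℂ H] [Ring M] [Algebra ℂ M]

noncomputable instance : AddCommGroup (Smash H M) := inferInstanceAs (AddCommGroup (M ⊗[ℂ] H))
noncomputable instance : Module ℂ (Smash H M) := inferInstanceAs (Module ℂ (M ⊗[ℂ] H))

/-- The element `a # h`. -/
noncomputable def mk (a : M) (h : H) : Smash H M := a ⊗ₜ[ℂ] h

@[elab_as_elim]
theorem ind {P : Smash H M → Prop} (x : Smash H M) (h0 : P 0) (hm : ∀ a h, P (mk a h))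
    (ha : ∀ x y, P x → P y → P (x + y)) : P x :=
  TensorProduct.induction_on x h0 hm ha

/-- `mk` as a linear map. -/
noncomputable def mkL : M ⊗[ℂ] H →ₗ[ℂ] Smash H M := LinearMap.id

variable [HModuleAlgebra H M]

open HModuleAlgebra (act)

/-- The operators `b # g ↦ ∑ (h₂ ▷ b) # h₁ g`. -/
noncomputable def theta : H →ₐ[ℂ] Module.End ℂ (M ⊗[ℂ] H) :=
  (FdMod.box (act (H := H) (M := M)) (Algebra.lmul ℂ H)).comp
    ((Algebra.TensorProduct.comm ℂ H H).toAlgHom.comp (Bialgebra.comulAlgHom ℂ H))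

/-- Left multiplication by `∑ a # h`. -/
noncomputable def lmulMap : M ⊗[ℂ] H →ₗ[ℂ] Module.End ℂ (M ⊗[ℂ] H) :=
  TensorProduct.lift
    (((LinearMap.mul ℂ (Module.End ℂ (M ⊗[ℂ] H))).comp
        ((TensorProduct.mapBilinear (.id ℂ) M H M H).flip LinearMap.id ∘ₗ
          (LinearMap.mul ℂ M).flip)).compl₂ (theta (H := H) (M := M)).toLinearMap)

theorem lmulMap_tmul (a : M) (h : H) : lmulMap (a ⊗ₜ[ℂ] h) =
    TensorProduct.map (LinearMap.mulRight ℂ a) LinearMap.id * theta h := rfl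

theorem theta_mulRight (h : H) (b : M) :
    theta h * TensorProduct.map (LinearMap.mulRight ℂ b) LinearMap.id =
      lmulMap (TensorProduct.map ((act (H := H) (M := M)).toLinearMap.flip b) LinearMap.id
        (TensorProduct.comm ℂ H H (Coalgebra.comul (R := ℂ) h))) := by
  apply TensorProduct.ext'
  intro b' g
  -- `x ⊗ (y ⊗ z) ↦ (y ▷ b') (z ▷ b) ⊗ x g`
  let G : H ⊗[ℂ] (H ⊗[ℂ] H) →ₗ[ℂ] M ⊗[ℂ] H :=
    TensorProduct.map (LinearMap.mul' ℂ M ∘ₗ TensorProduct.map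
        ((act (H := H) (M := M)).toLinearMap.flip b') ((act (H := H) (M := M)).toLinearMap.flip b))
      (LinearMap.mulRight ℂ g) ∘ₗ (TensorProduct.comm ℂ H (H ⊗[ℂ] H)).toLinearMap
  have hL : ∀ t : H ⊗[ℂ] H,
      FdMod.box (act (H := H) (M := M)) (Algebra.lmul ℂ H) (TensorProduct.comm ℂ H H t)
        ((b' * b) ⊗ₜ g) = G ((Coalgebra.comul (R := ℂ) (A := H)).lTensor H t) := by
    intro t
    induction t with
    | zero => simp
    | add s t hs ht => simp only [map_add, LinearMap.add_apply, hs, ht]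
    | tmul x y =>
      have e : ∀ s : H ⊗[ℂ] H, LinearMap.mul' ℂ M
          (FdMod.box (act (H := H) (M := M)) act s (b' ⊗ₜ b)) =
          (LinearMap.mul' ℂ M ∘ₗ TensorProduct.map ((act (H := H) (M := M)).toLinearMap.flip b')
            ((act (H := H) (M := M)).toLinearMap.flip b)) s := by
        intro s
        induction s with
        | zero => simp
        | add s t hs ht => simp only [map_add, LinearMap.add_apply, hs, ht]
        | tmul x y => simp
      have e2 := LinearMap.congr_fun (HModuleAlgebra.act_mul (M := M) y) (b' ⊗ₜ b)
      simp only [LinearMap.comp_apply, LinearMap.mul'_apply] at e2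
      simp [G, e2, e]
  have hR : ∀ t : H ⊗[ℂ] H,
      lmulMap (TensorProduct.map ((act (H := H) (M := M)).toLinearMap.flip b) LinearMap.id
        (TensorProduct.comm ℂ H H t)) (b' ⊗ₜ g) =
      G (TensorProduct.assoc ℂ H H H ((Coalgebra.comul (R := ℂ) (A := H)).rTensor H t)) := by
    intro t
    induction t with
    | zero => simp
    | add s t hs ht => simp only [map_add, LinearMap.add_apply, hs, ht]
    | tmul x y =>
      have e : ∀ s : H ⊗[ℂ] H, TensorProduct.map (LinearMap.mulRight ℂ (act y b)) LinearMap.id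
          (FdMod.box (act (H := H) (M := M)) (Algebra.lmul ℂ H) (TensorProduct.comm ℂ H H s)
            (b' ⊗ₜ g)) = G (TensorProduct.assoc ℂ H H H (s ⊗ₜ y)) := by
        intro s
        induction s with
        | zero => simp
        | add s t hs ht =>
          simp only [map_add, LinearMap.add_apply, hs, ht, TensorProduct.add_tmul]
        | tmul x z => simp [G]
      exact e _
  have h1 := hL (Coalgebra.comul (R := ℂ) h)
  have h2 := hR (Coalgebra.comul (R := ℂ) h)
  rw [Coalgebra.coassoc_apply] at h2
  exact h1.trans h2.symm

noncomputable instance : Mul (Smash H M) := ⟨fun x y => lmulMap (H := H) (M := M) x y⟩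
noncomputable instance : One (Smash H M) := ⟨mk 1 1⟩

theorem mul_def (x y : Smash H M) : x * y = lmulMap (H := H) (M := M) x y := rfl

/-- The product `(a # h)(b # g) = ∑ (h₂ ▷ b) a # h₁ g` of `𝔐ᵒᵖ # Hᶜᵒᵖ`, with the product of `𝔐` and
the comultiplication of `H` on the right-hand side. -/
theorem mk_mul_mk (a b : M) (h g : H) (s : Finset (H × H))
    (hs : Coalgebra.comul (R := ℂ) h = ∑ p ∈ s, p.1 ⊗ₜ[ℂ] p.2) :
    (mk a h * mk b g : Smash H M) = ∑ p ∈ s, mk (act p.2 b * a) (p.1 * g) := by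
  have : theta h (b ⊗ₜ[ℂ] g) = ∑ p ∈ s, (act (M := M) p.2 b) ⊗ₜ[ℂ] (p.1 * g) := by
    change FdMod.box (act (H := H) (M := M)) (Algebra.lmul ℂ H)
      (TensorProduct.comm ℂ H H (Coalgebra.comul (R := ℂ) h)) (b ⊗ₜ[ℂ] g) = _
    rw [hs]
    simp
  change TensorProduct.map (LinearMap.mulRight ℂ a) LinearMap.id (theta h (b ⊗ₜ[ℂ] g)) = _
  rw [this, map_sum]
  rfl

theorem lmulMap_mul (x y : M ⊗[ℂ] H) :
    lmulMap (lmulMap x y) = lmulMap x * lmulMap y := by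
  induction x with
  | zero => simp
  | add s t hs ht => simp only [map_add, LinearMap.add_apply, hs, ht, add_mul]
  | tmul a h =>
    induction y with
    | zero => simp
    | add s t hs ht => simp only [map_add, hs, ht, mul_add]
    | tmul b g =>
      have e : ∀ t : H ⊗[ℂ] H,
          lmulMap (TensorProduct.map (LinearMap.mulRight ℂ a) LinearMap.id
            (FdMod.box (act (H := H) (M := M)) (Algebra.lmul ℂ H) (TensorProduct.comm ℂ H H t)
              (b ⊗ₜ g))) =
          TensorProduct.map (LinearMap.mulRight ℂ a) LinearMap.id *
            lmulMap (TensorProduct.map ((act (H := H) (M := M)).toLinearMap.flip b) LinearMap.id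
              (TensorProduct.comm ℂ H H t)) * theta g := by
        intro t
        induction t with
        | zero => simp
        | add s t hs ht => simp only [map_add, LinearMap.add_apply, hs, ht, add_mul, mul_add]
        | tmul x y =>
          simp only [TensorProduct.comm_tmul, FdMod.box_tmul, TensorProduct.map_tmul,
            lmulMap_tmul, LinearMap.id_apply, LinearMap.mulRight_apply, LinearMap.flip_apply]
          have e1 : LinearMap.mulRight ℂ (act y b * a) =
              LinearMap.mulRight ℂ a ∘ₗ LinearMap.mulRight ℂ (act y b) := by
            ext; simp [mul_assoc]
          rw [e1]
          change TensorProduct.map _ _ * theta (x * g) = _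
          rw [map_mul, ← LinearMap.id_comp (LinearMap.id (R := ℂ) (M := H)),
            TensorProduct.map_comp]
          simp only [LinearMap.id_comp]
          rfl
      rw [lmulMap_tmul a h, lmulMap_tmul b g, mul_assoc, ← mul_assoc (theta h),
        theta_mulRight, ← mul_assoc]
      exact e _

noncomputable instance : Ring (Smash H M) where
  __ := (inferInstance : AddCommGroup (Smash H M))
  left_distrib x y z := map_add (lmulMap (H := H) (M := M) x) y z
  right_distrib x y z := by
    simp only [mul_def]
    exact LinearMap.congr_fun (map_add (lmulMap (H := H) (M := M)) x y) z
  zero_mul x := LinearMap.congr_fun (map_zero (lmulMap (H := H) (M := M))) x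
  mul_zero x := map_zero (lmulMap (H := H) (M := M) x)
  mul_assoc x y z := LinearMap.congr_fun (lmulMap_mul (H := H) (M := M) x y) z
  one_mul x := by
    have e : TensorProduct.map (LinearMap.mulRight ℂ (1 : M)) LinearMap.id *
        theta (1 : H) = 1 := by
      rw [map_one, LinearMap.mulRight_one, TensorProduct.map_id]
      rfl
    exact LinearMap.congr_fun e x
  mul_one x := by
    refine ind x ?_ ?_ ?_
    · exact LinearMap.congr_fun (map_zero (lmulMap (H := H) (M := M))) _
    · intro a h
      have e : ∀ t : H ⊗[ℂ] H, FdMod.box (act (H := H) (M := M)) (Algebra.lmul ℂ H)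
          (TensorProduct.comm ℂ H H t) (1 ⊗ₜ 1) =
          1 ⊗ₜ[ℂ] TensorProduct.rid ℂ H ((Coalgebra.counit (R := ℂ) (A := H)).lTensor H t) := by
        intro t
        induction t with
        | zero => simp
        | add s t hs ht =>
          simp only [map_add, LinearMap.add_apply, hs, ht, TensorProduct.tmul_add]
        | tmul x y => simp [HModuleAlgebra.act_one, TensorProduct.smul_tmul']
      have e2 : theta h ((1 : M) ⊗ₜ[ℂ] (1 : H)) = 1 ⊗ₜ h := by
        have e3 := e (Coalgebra.comul (R := ℂ) h)
        rw [Coalgebra.lTensor_counit_comul] at e3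
        refine Eq.trans e3 ?_
        simp
      change TensorProduct.map (LinearMap.mulRight ℂ a) LinearMap.id
        (theta h ((1 : M) ⊗ₜ[ℂ] (1 : H))) = _
      rw [e2]
      change (1 * a) ⊗ₜ[ℂ] h = _
      rw [one_mul]
      rfl
    · intro x y hx hy
      have := LinearMap.congr_fun (map_add (lmulMap (H := H) (M := M)) x y) (mk 1 1)
      exact this.trans (congrArg₂ (· + ·) hx hy)

noncomputable instance : Algebra ℂ (Smash H M) :=
  Algebra.ofModule
    (fun c x y => LinearMap.congr_fun (map_smul (lmulMap (H := H) (M := M)) c x) y)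
    (fun c x y => map_smul (lmulMap (H := H) (M := M) x) c y)

/-- The linear map `a # h ↦ ∑ h₁ ⊗ (a # h₂)`. -/
noncomputable def coactL : M ⊗[ℂ] H →ₗ[ℂ] H ⊗[ℂ] (M ⊗[ℂ] H) :=
  (TensorProduct.leftComm ℂ M H H).toLinearMap ∘ₗ (Coalgebra.comul (R := ℂ) (A := H)).lTensor M

theorem coactL_tmul (a : M) (h : H) : coactL (a ⊗ₜ[ℂ] h) =
    TensorProduct.leftComm ℂ M H H (a ⊗ₜ Coalgebra.comul (R := ℂ) h) := rfl

/-- The linear map `a ⊗ (x ⊗ y) ↦ x ⊗ (a # y)`. -/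
noncomputable def leftCommS : M ⊗[ℂ] (H ⊗[ℂ] H) →ₗ[ℂ] H ⊗[ℂ] Smash H M :=
  (TensorProduct.leftComm ℂ M H H).toLinearMap

/-- The linear map `a # h ↦ ∑ h₁ ⊗ (a # h₂)`, with values in the algebra `H ⊗ (𝔐ᵒᵖ # Hᶜᵒᵖ)`. -/
noncomputable def coactS : Smash H M →ₗ[ℂ] H ⊗[ℂ] Smash H M := coactL (H := H) (M := M)

theorem coactS_mul_mk (a b : M) (h g : H) :
    coactS (mk a h * mk b g : Smash H M) = coactS (mk a h) * coactS (mk b g) := by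
  -- `(x ⊗ y) ⊗ z ↦ ∑ x t₁ ⊗ ((z ▷ b) a # y t₂)`
  let P : H ⊗[ℂ] H → ((H ⊗[ℂ] H) ⊗[ℂ] H →ₗ[ℂ] H ⊗[ℂ] (M ⊗[ℂ] H)) := fun t =>
    (TensorProduct.leftComm ℂ M H H).toLinearMap ∘ₗ
      TensorProduct.map (LinearMap.mulRight ℂ a ∘ₗ (act (H := H) (M := M)).toLinearMap.flip b)
        (LinearMap.mulRight ℂ t) ∘ₗ (TensorProduct.comm ℂ (H ⊗[ℂ] H) H).toLinearMap
  have hP : ∀ (t : H ⊗[ℂ] H) (u : H ⊗[ℂ] H) (z : H), P t (u ⊗ₜ z) =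
      TensorProduct.leftComm ℂ M H H ((act z b * a) ⊗ₜ (u * t)) := fun t u z => rfl
  have hPadd : ∀ (s t : H ⊗[ℂ] H) (v : (H ⊗[ℂ] H) ⊗[ℂ] H), P (s + t) v = P s v + P t v := by
    intro s t v
    induction v with
    | zero => simp
    | add v w hv hw => rw [map_add, map_add, map_add, hv, hw]; abel
    | tmul u z => simp only [hP, mul_add, TensorProduct.tmul_add, map_add]
  have hPzero : ∀ (v : (H ⊗[ℂ] H) ⊗[ℂ] H), P 0 v = 0 := by
    intro v
    induction v with
    | zero => simp
    | add v w hv hw => rw [map_add, hv, hw, add_zero]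
    | tmul u z => simp only [hP, mul_zero, TensorProduct.tmul_zero, map_zero]
  have hL : ∀ s : H ⊗[ℂ] H, coactL (TensorProduct.map (LinearMap.mulRight ℂ a) LinearMap.id
        (FdMod.box (act (H := H) (M := M)) (Algebra.lmul ℂ H) (TensorProduct.comm ℂ H H s)
          (b ⊗ₜ g))) =
      P (Coalgebra.comul (R := ℂ) g) ((Coalgebra.comul (R := ℂ) (A := H)).rTensor H s) := by
    intro s
    induction s with
    | zero => simp
    | add s t hs ht => simp only [map_add, LinearMap.add_apply, hs, ht]
    | tmul x y =>
      simp only [TensorProduct.comm_tmul, FdMod.box_tmul, TensorProduct.map_tmul,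
        LinearMap.id_apply, LinearMap.mulRight_apply, LinearMap.rTensor_tmul, hP]
      rw [coactL_tmul]
      simp [Bialgebra.comul_mul]
  have hmul : ∀ (x : H) (w : H) (t : H ⊗[ℂ] H),
      ((x ⊗ₜ[ℂ] mk a w : H ⊗[ℂ] Smash H M) *
        leftCommS (b ⊗ₜ t)) =
      P t ((TensorProduct.assoc ℂ H H H).symm (x ⊗ₜ Coalgebra.comul (R := ℂ) w)) := by
    intro x w t
    induction t with
    | zero =>
      rw [hPzero, TensorProduct.tmul_zero, map_zero, mul_zero]
      rfl
    | add s t hs ht =>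
      rw [hPadd, TensorProduct.tmul_add, map_add, mul_add, hs, ht]
      rfl
    | tmul t₁ t₂ =>
      have e : ∀ s : H ⊗[ℂ] H, (x * t₁) ⊗ₜ[ℂ] (TensorProduct.map (LinearMap.mulRight ℂ a)
          LinearMap.id (FdMod.box (act (H := H) (M := M)) (Algebra.lmul ℂ H)
            (TensorProduct.comm ℂ H H s) (b ⊗ₜ t₂))) =
          P (t₁ ⊗ₜ t₂) ((TensorProduct.assoc ℂ H H H).symm (x ⊗ₜ s)) := by
        intro s
        induction s with
        | zero => simp
        | add s t hs ht =>
          simp only [map_add, LinearMap.add_apply, TensorProduct.tmul_add, hs, ht]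
        | tmul y z => simp [hP]
      refine Eq.trans ?_ (e (Coalgebra.comul (R := ℂ) w))
      exact Algebra.TensorProduct.tmul_mul_tmul x t₁ (mk a w) (mk b t₂ : Smash H M)
  have hR : ∀ s : H ⊗[ℂ] H,
      leftCommS (a ⊗ₜ s) * leftCommS (b ⊗ₜ Coalgebra.comul (R := ℂ) g) =
      P (Coalgebra.comul (R := ℂ) g) ((TensorProduct.assoc ℂ H H H).symm
        ((Coalgebra.comul (R := ℂ) (A := H)).lTensor H s)) := by
    intro s
    induction s with
    | zero =>
      rw [TensorProduct.tmul_zero, map_zero, map_zero, map_zero, map_zero, zero_mul]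
      rfl
    | add s t hs ht =>
      rw [TensorProduct.tmul_add, map_add, map_add, map_add, map_add, add_mul, hs, ht]
      rfl
    | tmul x w => exact hmul x w _
  have h1 := hL (Coalgebra.comul (R := ℂ) h)
  have h2 := hR (Coalgebra.comul (R := ℂ) h)
  rw [← Coalgebra.coassoc_apply, LinearEquiv.symm_apply_apply] at h2
  exact h1.trans h2.symm

/-- `𝔐ᵒᵖ # Hᶜᵒᵖ` is a left `H`-comodule algebra with coaction `a # h ↦ ∑ h₁ ⊗ (a # h₂)`. -/
noncomputable instance : LeftComoduleAlgebra H (Smash H M) where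
  coact := AlgHom.ofLinearMap coactS
    (by
      change TensorProduct.leftComm ℂ M H H (1 ⊗ₜ Coalgebra.comul (R := ℂ) (1 : H)) = _
      rw [Bialgebra.comul_one]
      rfl)
    (fun x y => by
      refine ind x ?_ ?_ ?_
      · rw [zero_mul, map_zero, zero_mul]
      · intro a h
        refine ind y ?_ ?_ ?_
        · rw [mul_zero, map_zero, mul_zero]
        · exact fun b g => coactS_mul_mk a b h g
        · intro y z hy hz
          rw [mul_add, map_add, map_add, mul_add, hy, hz]
      · intro x z hx hz
        rw [add_mul, map_add, map_add, add_mul, hx, hz])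
  coassoc x := by
    refine ind x ?_ ?_ ?_
    · simp only [map_zero]
    · intro a h
      -- `x ⊗ (y ⊗ z) ↦ x ⊗ (y ⊗ (a # z))`
      let G : H ⊗[ℂ] (H ⊗[ℂ] H) →ₗ[ℂ] H ⊗[ℂ] (H ⊗[ℂ] Smash H M) :=
        LinearMap.lTensor H (LinearMap.lTensor H (mkL ∘ₗ TensorProduct.mk ℂ M H a))
      have hL : ∀ s : H ⊗[ℂ] H, TensorProduct.assoc ℂ H H (Smash H M)
          ((Coalgebra.comul (R := ℂ) (A := H)).rTensor (Smash H M)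
            (LinearMap.lTensor H (mkL ∘ₗ TensorProduct.mk ℂ M H a) s)) =
          G (TensorProduct.assoc ℂ H H H ((Coalgebra.comul (R := ℂ) (A := H)).rTensor H s)) := by
        intro s
        induction s with
        | zero => simp only [map_zero]
        | add s t hs ht => simp only [map_add, hs, ht]
        | tmul x y =>
          simp only [LinearMap.lTensor_tmul, LinearMap.rTensor_tmul]
          generalize Coalgebra.comul (R := ℂ) x = t
          induction t with
          | zero => simp only [map_zero, TensorProduct.zero_tmul]
          | add s t hs ht => simp only [map_add, TensorProduct.add_tmul, hs, ht]
          | tmul u v => rfl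
      have e : ∀ s : H ⊗[ℂ] H, (TensorProduct.leftComm ℂ M H H (a ⊗ₜ s)) =
          (LinearMap.lTensor H (TensorProduct.mk ℂ M H a) s) := by
        intro s
        induction s with
        | zero => simp
        | add s t hs ht => simp only [map_add, TensorProduct.tmul_add, hs, ht]
        | tmul x y => simp
      have hR : ∀ s : H ⊗[ℂ] H, LinearMap.lTensor H (coactS (H := H) (M := M))
            (LinearMap.lTensor H (mkL ∘ₗ TensorProduct.mk ℂ M H a) s) =
          G ((Coalgebra.comul (R := ℂ) (A := H)).lTensor H s) := by
        intro s
        induction s with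
        | zero => simp only [map_zero]
        | add s t hs ht => simp only [map_add, hs, ht]
        | tmul x y => exact congrArg (fun w => x ⊗ₜ[ℂ] w) (e _)
      have h1 := hL (Coalgebra.comul (R := ℂ) h)
      have h2 := hR (Coalgebra.comul (R := ℂ) h)
      rw [Coalgebra.coassoc_apply, ← h2] at h1
      have e' : coactS (mk a h : Smash H M) =
          LinearMap.lTensor H (mkL ∘ₗ TensorProduct.mk ℂ M H a) (Coalgebra.comul (R := ℂ) h) :=
        e _
      change TensorProduct.assoc ℂ H H (Smash H M)
        ((Coalgebra.comul (R := ℂ) (A := H)).rTensor (Smash H M) (coactS (mk a h))) =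
          LinearMap.lTensor H (coactS (H := H) (M := M)) (coactS (mk a h))
      rw [e']
      exact h1
    · intro x y hx hy
      simp only [map_add, hx, hy]
  counit_coact x := by
    refine ind x ?_ ?_ ?_
    · simp only [map_zero, TensorProduct.tmul_zero]
    · intro a h
      have e : ∀ s : H ⊗[ℂ] H, (Coalgebra.counit (R := ℂ) (A := H)).rTensor (M ⊗[ℂ] H)
          (TensorProduct.leftComm ℂ M H H (a ⊗ₜ s)) =
          LinearMap.lTensor ℂ (TensorProduct.mk ℂ M H a)
            ((Coalgebra.counit (R := ℂ) (A := H)).rTensor H s) := by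
        intro s
        induction s with
        | zero => simp
        | add s t hs ht => simp only [map_add, TensorProduct.tmul_add, hs, ht]
        | tmul x y => simp
      have h1 := e (Coalgebra.comul (R := ℂ) h)
      rw [Coalgebra.rTensor_counit_comul] at h1
      exact h1
    · intro x y hx hy
      simp only [map_add, TensorProduct.tmul_add, hx, hy]

end Smash

/-! ### Bimodules and right modules over an algebra object -/

section Bimodules

universe v u

variable {C : Type u} [Category.{v} C] [MonoidalCategory C] [Preadditive C] [Linear ℂ C]
  [MonoidalPreadditive C] [MonoidalLinear ℂ C]

theorem whiskerLeft_neg' (W : C) {X Y : C} (f : X ⟶ Y) : W ◁ (-f) = -(W ◁ f) := by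
  have := MonoidalLinear.whiskerLeft_smul (R := ℂ) W (-1 : ℂ) f
  simpa using this

theorem neg_whiskerRight' {X Y : C} (f : X ⟶ Y) (W : C) : (-f) ▷ W = -(f ▷ W) := by
  have := MonoidalLinear.smul_whiskerRight (R := ℂ) (-1 : ℂ) f W
  simpa using this

section Bimod

variable {A B : Mon C}

instance (X Y : Bimod A B) : Zero (X ⟶ Y) := ⟨{ hom := 0 }⟩

instance (X Y : Bimod A B) : Add (X ⟶ Y) :=
  ⟨fun f g =>
    { hom := f.hom + g.hom
      left_act_hom := by simp [Preadditive.comp_add, Preadditive.add_comp]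
      right_act_hom := by simp [Preadditive.comp_add, Preadditive.add_comp] }⟩

instance (X Y : Bimod A B) : Neg (X ⟶ Y) :=
  ⟨fun f =>
    { hom := -f.hom
      left_act_hom := by simp [whiskerLeft_neg']
      right_act_hom := by simp [neg_whiskerRight'] }⟩

instance (X Y : Bimod A B) : AddCommGroup (X ⟶ Y) where
  add_assoc f g h := Bimod.hom_ext _ _ (add_assoc f.hom g.hom h.hom)
  zero_add f := Bimod.hom_ext _ _ (zero_add f.hom)
  add_zero f := Bimod.hom_ext _ _ (add_zero f.hom)
  add_comm f g := Bimod.hom_ext _ _ (add_comm f.hom g.hom)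
  neg_add_cancel f := Bimod.hom_ext _ _ (neg_add_cancel f.hom)
  nsmul := nsmulRec
  zsmul := zsmulRec

instance (X Y : Bimod A B) : Module ℂ (X ⟶ Y) where
  smul c f :=
    { hom := c • f.hom
      left_act_hom := by simp [Linear.comp_smul, Linear.smul_comp]
      right_act_hom := by simp [Linear.comp_smul, Linear.smul_comp] }
  one_smul f := Bimod.hom_ext _ _ (one_smul ℂ f.hom)
  mul_smul c d f := Bimod.hom_ext _ _ (mul_smul c d f.hom)
  smul_zero c := Bimod.hom_ext _ _ (smul_zero c)
  smul_add c f g := Bimod.hom_ext _ _ (smul_add c f.hom g.hom)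
  add_smul c d f := Bimod.hom_ext _ _ (add_smul c d f.hom)
  zero_smul f := Bimod.hom_ext _ _ (zero_smul ℂ f.hom)

instance : Preadditive (Bimod A B) where
  add_comp _ _ _ f f' g := by
    apply Bimod.hom_ext
    exact Preadditive.add_comp _ _ _ f.hom f'.hom g.hom
  comp_add _ _ _ f g g' := by
    apply Bimod.hom_ext
    exact Preadditive.comp_add _ _ _ f.hom g.hom g'.hom

instance : Linear ℂ (Bimod A B) where
  smul_comp _ _ _ c f g := by
    apply Bimod.hom_ext
    exact Linear.smul_comp _ _ _ c f.hom g.hom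
  comp_smul _ _ _ f c g := by
    apply Bimod.hom_ext
    exact Linear.comp_smul _ _ _ f.hom c g.hom

end Bimod

/-- A right module over an algebra object `A` of a monoidal category `C`; these form `C_A`. -/
structure RMod (A : Mon C) where
  X : C
  act : X ⊗ A.X ⟶ X
  act_one : X ◁ η ≫ act = (ρ_ X).hom
  act_assoc : X ◁ μ ≫ act = (α_ X A.X A.X).inv ≫ act ▷ A.X ≫ act

namespace RMod

variable {A B : Mon C}

/-- Morphisms of right modules. -/
@[ext]
structure Hom (M N : RMod A) where
  hom : M.X ⟶ N.X
  act_hom : M.act ≫ hom = hom ▷ A.X ≫ N.act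

instance : Category (RMod A) where
  Hom M N := Hom M N
  id M := ⟨𝟙 M.X, by simp⟩
  comp f g := ⟨f.hom ≫ g.hom, by
    rw [← Category.assoc, f.act_hom, Category.assoc, g.act_hom, comp_whiskerRight,
      Category.assoc]⟩

theorem hom_ext {M N : RMod A} {f g : M ⟶ N} (h : f.hom = g.hom) : f = g := Hom.ext h

instance (X Y : RMod A) : Zero (X ⟶ Y) := ⟨⟨0, by simp⟩⟩

instance (X Y : RMod A) : Add (X ⟶ Y) :=
  ⟨fun f g => ⟨f.hom + g.hom, by
    simp [Preadditive.comp_add, Preadditive.add_comp, f.act_hom, g.act_hom]⟩⟩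

instance (X Y : RMod A) : Neg (X ⟶ Y) :=
  ⟨fun f => ⟨-f.hom, by simp [neg_whiskerRight', f.act_hom]⟩⟩

instance (X Y : RMod A) : AddCommGroup (X ⟶ Y) where
  add_assoc f g h := hom_ext (add_assoc f.hom g.hom h.hom)
  zero_add f := hom_ext (zero_add f.hom)
  add_zero f := hom_ext (add_zero f.hom)
  add_comm f g := hom_ext (add_comm f.hom g.hom)
  neg_add_cancel f := hom_ext (neg_add_cancel f.hom)
  nsmul := nsmulRec
  zsmul := zsmulRec

instance (X Y : RMod A) : Module ℂ (X ⟶ Y) where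
  smul c f := ⟨c • f.hom, by simp [Linear.comp_smul, Linear.smul_comp, f.act_hom]⟩
  one_smul f := hom_ext (one_smul ℂ f.hom)
  mul_smul c d f := hom_ext (mul_smul c d f.hom)
  smul_zero c := hom_ext (smul_zero c)
  smul_add c f g := hom_ext (smul_add c f.hom g.hom)
  add_smul c d f := hom_ext (add_smul c d f.hom)
  zero_smul f := hom_ext (zero_smul ℂ f.hom)

instance : Preadditive (RMod A) where
  add_comp _ _ _ f f' g := hom_ext (Preadditive.add_comp _ _ _ f.hom f'.hom g.hom)
  comp_add _ _ _ f g g' := hom_ext (Preadditive.comp_add _ _ _ f.hom g.hom g'.hom)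

instance : Linear ℂ (RMod A) where
  smul_comp _ _ _ c f g := hom_ext (Linear.smul_comp _ _ _ c f.hom g.hom)
  comp_smul _ _ _ f c g := hom_ext (Linear.comp_smul _ _ _ f.hom c g.hom)

/-- The right module `W ⊗ M`. -/
def tensor (W : C) (M : RMod A) : RMod A where
  X := W ⊗ M.X
  act := (α_ W M.X A.X).hom ≫ W ◁ M.act
  act_one := by
    rw [← Category.assoc, associator_naturality_right, Category.assoc,
      ← whiskerLeft_comp, M.act_one]
    simp
  act_assoc := by
    rw [← Category.assoc, associator_naturality_right, Category.assoc,
      ← whiskerLeft_comp, M.act_assoc]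
    simp

/-- The tensor product of a morphism of `C` and a morphism of right modules. -/
def tensorMap {W W' : C} {M M' : RMod A} (f : W ⟶ W') (g : M ⟶ M') : tensor W M ⟶ tensor W' M' :=
  ⟨f ⊗ₘ g.hom, by
    simp only [tensor, Category.assoc, MonoidalCategory.tensorHom_def, comp_whiskerRight]
    have h : M.act ≫ g.hom = _ := g.act_hom
    rw [whisker_exchange_assoc, ← whiskerLeft_comp, h]
    simp⟩

/-- An isomorphism of right modules from an isomorphism of `C`. -/
def mkIso {M N : RMod A} (e : M.X ≅ N.X) (h : M.act ≫ e.hom = e.hom ▷ A.X ≫ N.act) : M ≅ N where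
  hom := ⟨e.hom, h⟩
  inv := ⟨e.inv, by
    rw [← cancel_mono e.hom, Category.assoc, Category.assoc, e.inv_hom_id, h, ← Category.assoc,
      ← comp_whiskerRight]
    simp⟩
  hom_inv_id := hom_ext e.hom_inv_id
  inv_hom_id := hom_ext e.inv_hom_id

/-- `C_A` is a left `C`-module category. -/
instance : MonoidalLeftAction C (RMod A) where
  actionObj := tensor
  actionHom := tensorMap
  actionHomLeft f M := tensorMap f (𝟙 M)
  actionHomRight W _ _ g := tensorMap (𝟙 W) g
  actionAssocIso W W' M := mkIso (α_ W W' M.X) (by simp [tensor])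
  actionUnitIso M := mkIso (λ_ M.X) (by simp [tensor])
  actionHom_def f g := hom_ext (show f ⊗ₘ g.hom = (f ⊗ₘ 𝟙 _) ≫ (𝟙 _ ⊗ₘ g.hom) by
    simp [MonoidalCategory.tensorHom_def])
  actionHomRight_id W M := hom_ext (id_tensorHom_id W M.X)
  id_actionHomLeft W M := hom_ext (id_tensorHom_id W M.X)
  actionHom_comp f₁ f₂ g₁ g₂ := hom_ext (tensorHom_comp_tensorHom f₁ g₁.hom f₂ g₂.hom).symm
  actionAssocIso_hom_naturality f g h := hom_ext (associator_naturality f g h.hom)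
  actionUnitIso_hom_naturality f :=
    hom_ext (show _ = (𝟙 _ ⊗ₘ f.hom) ≫ _ by
      rw [id_tensorHom]; exact (leftUnitor_naturality f.hom).symm)
  whiskerLeft_actionHomLeft W _ _ f M := hom_ext (by
    change (W ◁ f) ⊗ₘ 𝟙 M.X = (α_ _ _ _).hom ≫ (𝟙 W ⊗ₘ (f ⊗ₘ 𝟙 M.X)) ≫ (α_ _ _ _).inv
    simp)
  whiskerRight_actionHomLeft W f M := hom_ext (by
    change (f ▷ W) ⊗ₘ 𝟙 M.X = (α_ _ _ _).hom ≫ (f ⊗ₘ 𝟙 (W ⊗ M.X)) ≫ (α_ _ _ _).inv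
    simp)
  associator_actionHom W₁ W₂ W₃ M := hom_ext (by
    change ((α_ W₁ W₂ W₃).hom ⊗ₘ 𝟙 M.X) ≫ (α_ _ _ _).hom ≫ (𝟙 W₁ ⊗ₘ (α_ W₂ W₃ M.X).hom) =
      (α_ _ _ _).hom ≫ (α_ _ _ _).hom
    simp)
  leftUnitor_actionHom W M := hom_ext (by
    change (λ_ W).hom ⊗ₘ 𝟙 M.X = (α_ _ _ _).hom ≫ (λ_ _).hom
    simp)
  rightUnitor_actionHom W M := hom_ext (by
    change (ρ_ W).hom ⊗ₘ 𝟙 M.X = (α_ _ _ _).hom ≫ (𝟙 W ⊗ₘ (λ_ M.X).hom)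
    simp)

/-- The right module underlying a bimodule. -/
def ofBimod (Y : Bimod A B) : RMod B where
  X := Y.X
  act := Y.actRight
  act_one := Y.actRight_one
  act_assoc := Y.right_assoc

/-- The right module morphism underlying a morphism of bimodules. -/
def ofBimodMap {Y Z : Bimod A B} (f : Y ⟶ Z) : ofBimod Y ⟶ ofBimod Z :=
  ⟨f.hom, f.right_act_hom⟩

/-- The left action on a bimodule, as a morphism of right modules. -/
def leftAct (Y : Bimod A B) : A.X ⊙ₗ ofBimod Y ⟶ ofBimod Y :=
  ⟨Y.actLeft, by
    change ((α_ A.X Y.X B.X).hom ≫ A.X ◁ Y.actRight) ≫ Y.actLeft = Y.actLeft ▷ B.X ≫ Y.actRight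
    rw [Y.middle_assoc, Category.assoc]⟩

end RMod

end Bimodules

/-! ### Module categories and module functors -/

section ModuleCategories

universe v u v₁ u₁ v₂ u₂

/-- The action of a `ℂ`-linear monoidal category on a `ℂ`-linear category is `ℂ`-bilinear on
morphisms. -/
class BilinearAction (C : Type u) [Category.{v} C] [MonoidalCategory C] [Preadditive C]
    [Linear ℂ C] (D : Type u₁) [Category.{v₁} D] [Preadditive D] [Linear ℂ D]
    [MonoidalLeftAction C D] : Prop where
  actionHomRight_add : ∀ (c : C) {d d' : D} (f g : d ⟶ d'), c ⊴ₗ (f + g) = c ⊴ₗ f + c ⊴ₗ g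
  actionHomRight_smul : ∀ (c : C) {d d' : D} (z : ℂ) (f : d ⟶ d'), c ⊴ₗ (z • f) = z • c ⊴ₗ f
  actionHomLeft_add : ∀ {c c' : C} (f g : c ⟶ c') (d : D), (f + g) ⊵ₗ d = f ⊵ₗ d + g ⊵ₗ d
  actionHomLeft_smul : ∀ {c c' : C} (z : ℂ) (f : c ⟶ c') (d : D), (z • f) ⊵ₗ d = z • f ⊵ₗ d

/-- A finite semisimple `ℂ`-linear abelian category. -/
class FiniteSemisimple (D : Type u₁) [Category.{v₁} D] [Abelian D] [Linear ℂ D] : Prop where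
  hom_finite : ∀ X Y : D, Module.Finite ℂ (X ⟶ Y)
  split : ∀ {X Y : D} (f : X ⟶ Y) [Mono f], IsSplitMono f
  simples_finite : ∃ (n : ℕ) (S : Fin n → D), ∀ X : D, Simple X → ∃ i, Nonempty (X ≅ S i)

section

variable (C : Type u) [Category.{v} C] [MonoidalCategory C]
  {D : Type u₁} [Category.{v₁} D] [MonoidalLeftAction C D]

/-- `M` generates the `C`-module category `D`: for every nonzero `N` there is an `X` in `C` with
`Hom(X ⊗ M, N) ≠ 0`. -/
def IsGenerator [Preadditive D] (M : D) : Prop :=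
  ∀ N : D, ¬ Limits.IsZero N → ∃ (X : C) (f : X ⊙ₗ M ⟶ N), f ≠ 0

variable {C}

/-- The algebra `A`, with its action `γ : A ⊗ M ⟶ M`, is the internal End of `M`: the maps
`Hom(X, A) → Hom(X ⊗ M, M)` induced by `γ` are bijective. -/
def IsInternalEnd (A : Mon C) (M : D) [ModObj A.X M] : Prop :=
  ∀ X : C, Function.Bijective fun f : X ⟶ A.X => f ⊵ₗ M ≫ (γ : A.X ⊙ₗ M ⟶ M)

end

open Functor.LaxLeftLinear (μₗ)

section ModFun

variable (C : Type u) [Category.{v} C] [MonoidalCategory C]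
  (D : Type u₁) [Category.{v₁} D] [Preadditive D] [Linear ℂ D] [MonoidalLeftAction C D]
  (E : Type u₂) [Category.{v₂} E] [Preadditive E] [Linear ℂ E] [MonoidalLeftAction C E]

/-- A `ℂ`-linear `C`-module functor `D ⥤ E`. -/
structure ModFun where
  F : D ⥤ E
  [additive : F.Additive]
  [linear : F.Linear ℂ]
  [leftLinear : F.LeftLinear C]

attribute [instance] ModFun.additive ModFun.linear ModFun.leftLinear

variable {C D E}

namespace ModFun

/-- A natural transformation of `C`-module functors. -/
@[ext]
structure Hom (F G : ModFun C D E) where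
  nat : F.F ⟶ G.F
  comm : ∀ (c : C) (d : D), μₗ F.F c d ≫ nat.app (c ⊙ₗ d) = c ⊴ₗ nat.app d ≫ μₗ G.F c d

/-- The category `Fun_C(D, E)`. -/
instance : Category (ModFun C D E) where
  Hom F G := Hom F G
  id F := ⟨𝟙 F.F, fun c d => by simp⟩
  comp f g := ⟨f.nat ≫ g.nat, fun c d => by
    rw [NatTrans.comp_app, NatTrans.comp_app, ← Category.assoc, f.comm, Category.assoc, g.comm,
      actionHomRight_comp, Category.assoc]⟩

theorem hom_ext {F G : ModFun C D E} {f g : F ⟶ G} (h : f.nat = g.nat) : f = g := Hom.ext h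

section Linear

variable [Preadditive C] [Linear ℂ C] [BilinearAction C E]

theorem actionHomRight_zero (c : C) (d d' : E) : c ⊴ₗ (0 : d ⟶ d') = 0 := by
  have := BilinearAction.actionHomRight_smul c (0 : ℂ) (0 : d ⟶ d')
  simpa using this

theorem actionHomRight_neg (c : C) {d d' : E} (f : d ⟶ d') : c ⊴ₗ (-f) = -(c ⊴ₗ f) := by
  have := BilinearAction.actionHomRight_smul c (-1 : ℂ) f
  simpa using this

instance (F G : ModFun C D E) : Zero (F ⟶ G) := ⟨⟨0, fun c d => by
  rw [NatTrans.app_zero, NatTrans.app_zero, actionHomRight_zero, Limits.comp_zero,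
    Limits.zero_comp]⟩⟩

instance (F G : ModFun C D E) : Add (F ⟶ G) := ⟨fun f g => ⟨f.nat + g.nat, fun c d => by
  rw [NatTrans.app_add, NatTrans.app_add, BilinearAction.actionHomRight_add,
    Preadditive.comp_add, Preadditive.add_comp, f.comm, g.comm]⟩⟩

instance (F G : ModFun C D E) : Neg (F ⟶ G) := ⟨fun f => ⟨-f.nat, fun c d => by
  rw [NatTrans.app_neg, NatTrans.app_neg, actionHomRight_neg,
    Preadditive.comp_neg, Preadditive.neg_comp, f.comm]⟩⟩

instance (F G : ModFun C D E) : AddCommGroup (F ⟶ G) where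
  add_assoc f g h := hom_ext (add_assoc f.nat g.nat h.nat)
  zero_add f := hom_ext (zero_add f.nat)
  add_zero f := hom_ext (add_zero f.nat)
  add_comm f g := hom_ext (add_comm f.nat g.nat)
  neg_add_cancel f := hom_ext (neg_add_cancel f.nat)
  nsmul := nsmulRec
  zsmul := zsmulRec

instance (F G : ModFun C D E) : Module ℂ (F ⟶ G) where
  smul z f := ⟨z • f.nat, fun c d => by
    rw [NatTrans.app_smul, NatTrans.app_smul, BilinearAction.actionHomRight_smul,
      Linear.comp_smul, Linear.smul_comp, f.comm]⟩
  one_smul f := hom_ext (one_smul ℂ f.nat)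
  mul_smul c d f := hom_ext (mul_smul c d f.nat)
  smul_zero c := hom_ext (smul_zero c)
  smul_add c f g := hom_ext (smul_add c f.nat g.nat)
  add_smul c d f := hom_ext (add_smul c d f.nat)
  zero_smul f := hom_ext (zero_smul ℂ f.nat)

instance : Preadditive (ModFun C D E) where
  add_comp _ _ _ f f' g := hom_ext (Preadditive.add_comp _ _ _ f.nat f'.nat g.nat)
  comp_add _ _ _ f g g' := hom_ext (Preadditive.comp_add _ _ _ f.nat g.nat g'.nat)

instance : Linear ℂ (ModFun C D E) where
  smul_comp _ _ _ c f g := hom_ext (Linear.smul_comp _ _ _ c f.nat g.nat)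
  comp_smul _ _ _ f c g := hom_ext (Linear.comp_smul _ _ _ f.nat c g.nat)

end Linear

/-- `G` is right adjoint to `F` as a `C`-module functor: there is an adjunction whose unit is a
transformation of `C`-module functors. -/
def IsRightAdjoint (F : ModFun C D E) (G : ModFun C E D) : Prop :=
  ∃ adj : F.F ⊣ G.F, ∀ (c : C) (d : D),
    adj.unit.app (c ⊙ₗ d) = c ⊴ₗ adj.unit.app d ≫ μₗ G.F c (F.F.obj d) ≫ G.F.map (μₗ F.F c d)

/-- The action of the algebra `A` on `F(M)`, for a module functor `F` and an `A`-module `M`. -/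
def objAct (F : ModFun C D E) (A : Mon C) (M : D) [ModObj A.X M] :
    A.X ⊙ₗ F.F.obj M ⟶ F.F.obj M :=
  μₗ F.F A.X M ≫ F.F.map γ

end ModFun

end ModFun

section Evaluation

variable {C : Type u} [Category.{v} C] [MonoidalCategory C] [Preadditive C] [Linear ℂ C]
  [MonoidalPreadditive C] [MonoidalLinear ℂ C]
  {D : Type u₁} [Category.{v₁} D] [Preadditive D] [Linear ℂ D] [MonoidalLeftAction C D]
  {E : Type u₂} [Category.{v₂} E] [Preadditive E] [Linear ℂ E] [MonoidalLeftAction C E]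

/-- The action of `A` on the object `Q(Y)` of `E`, for a module functor `Q : C_B ⥤ E` and an
`A`-`B`-bimodule `Y`. -/
def bimodAct {A B : Mon C} (Q : ModFun C (RMod B) E) (Y : Bimod A B) :
    A.X ⊙ₗ Q.F.obj (RMod.ofBimod Y) ⟶ Q.F.obj (RMod.ofBimod Y) :=
  μₗ Q.F A.X (RMod.ofBimod Y) ≫ Q.F.map (RMod.leftAct Y)

/-- The module functor `P : C_A ⥤ D` identifies the regular right module `A` with `M`,
compatibly with the left actions of `A`. -/
def SendsRegularTo {A : Mon C} (P : ModFun C (RMod A) D) (M : D) [ModObj A.X M] : Prop :=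
  ∃ θ : P.F.obj (RMod.ofBimod (Bimod.regular A)) ≅ M,
    A.X ⊴ₗ θ.hom ≫ γ = bimodAct P (Bimod.regular A) ≫ θ.hom

/-- The functor `Φ` from `Fun_C(D, E)` to `A`-`B`-bimodules is evaluation at the `A`-module `M`
when `E` is identified with `C_B` through `Q`: there are isomorphisms `Q(Φ(F)) ≅ F(M)`, natural in
`F` and compatible with the left actions of `A`. -/
def IsEvaluation {A B : Mon C} (M : D) [ModObj A.X M] (Q : ModFun C (RMod B) E)
    (Φ : ModFun C D E ⥤ Bimod A B) : Prop :=
  ∃ θ : ∀ F : ModFun C D E, Q.F.obj (RMod.ofBimod (Φ.obj F)) ≅ F.F.obj M,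
    (∀ (F G : ModFun C D E) (f : F ⟶ G),
      (θ F).hom ≫ f.nat.app M = Q.F.map (RMod.ofBimodMap (Φ.map f)) ≫ (θ G).hom) ∧
    ∀ F : ModFun C D E,
      A.X ⊴ₗ (θ F).hom ≫ F.objAct A M = bimodAct Q (Φ.obj F) ≫ (θ F).hom

end Evaluation

/-- The `Rep(H)`-module functor `E` from right `𝔐`-modules in `Rep(H)` to modules over
`𝔐ᵒᵖ # Hᶜᵒᵖ` keeps the underlying spaces, with action `(a # h) ▷ x = (h ▷ x) ◁ a` and the identity
maps as structure isomorphisms `W ⊗ E(X) ≅ E(W ⊗ X)`. -/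
def IsSmashAction {H 𝔐 : Type} [Ring H] [Bialgebra ℂ H] [Ring 𝔐] [Algebra ℂ 𝔐]
    [Module.Finite ℂ 𝔐] [HModuleAlgebra H 𝔐]
    (E : ModFun (FdMod H) (RMod (HModuleAlgebra.mon H 𝔐)) (FdMod (Smash H 𝔐))) : Prop :=
  ∃ φ : ∀ X : RMod (HModuleAlgebra.mon H 𝔐), X.X.V ≃ₗ[ℂ] (E.F.obj X).V,
    (∀ (X Y : RMod (HModuleAlgebra.mon H 𝔐)) (f : X ⟶ Y) (x : X.X.V),
      (E.F.map f).hom (φ X x) = φ Y (f.hom.hom x)) ∧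
    (∀ (X : RMod (HModuleAlgebra.mon H 𝔐)) (a : 𝔐) (h : H) (x : X.X.V),
      (E.F.obj X).ρ (Smash.mk a h) (φ X x) = φ X (X.act.hom (X.X.ρ h x ⊗ₜ[ℂ] a))) ∧
    ∀ (W : FdMod H) (X : RMod (HModuleAlgebra.mon H 𝔐)) (w : W.V) (x : X.X.V),
      (μₗ E.F W X).hom (w ⊗ₜ[ℂ] φ X x) = φ (W ⊙ₗ X) (w ⊗ₜ[ℂ] x)

end ModuleCategories

end QuantumDouble

open QuantumDouble

/-! Write C for Rep(H), A for the internal End of the generator M of D, and B for the internal End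
of the generator N of E.

The boundary D is recovered from A by a monadicity argument. The functor X ↦ X ⊗_A M from C_A to D
has the right adjoint n ↦ [M, n], the internal hom. The unit of this adjunction is invertible at the
regular module because A is the internal End of M (`RelTensor.isIso_unit_regular`). It is then
invertible at free modules because both functors are module functors, and at all modules because
each is presented by free ones and D is semisimple (`RMod.isIso_unit_of_free`). It follows that [M,
-] inverts the counit, so kernel and cokernel of the counit receive no nonzero morphism from any X ⊗
M; they vanish because M is a generator (`RelTensor.isEquivalence_functor`).

A module functor F out of D is determined by the A-module F(M). Each object n is the cokernel of the
two maps from ([M, n] ⊗ A) ⊗ M to [M, n] ⊗ M, this cokernel is split, and so every additive functor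
preserves it. Hence A-linear maps F(M) ⟶ G(M) extend uniquely to module transformations
(`ModFun.exists_app_eq`, `ModFun.ext_of_app`). Every A-module K in E occurs as F(M), for F = [M, -]
⊗_A K (`ModFun.exists_obj_iso`). Under E ≃ C_B the A-modules in E are the A-B-bimodules, which gives
the evaluation equivalences (`exists_evaluation_equivalence`).

The contravariant equivalence sends F to its right adjoint and then evaluates at N. It needs
two-sided adjoints. The right adjoint exists because F ≅ [M, -] ⊗_A F(M) (`ModFun.isLeftAdjoint`).
The left adjoint exists for every linear functor out of a semisimple category with an additive
generator and finite-dimensional Hom spaces into the image of the generator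
(`isRightAdjoint_of_additiveGenerator`). Adjoints of module functors are a priori only lax or oplax;
right and left duals in C make their structure morphisms invertible.

The hypotheses on H enter through C. The antipode gives right duals; x ↦ S(x*)* gives left duals.
The faithful `*`-representation forces H to be semisimple, whence the regular module is an additive
generator of C and [d, n] is realised as Hom(H ⊗ d, n). The comparison with modules over the smash
product is the identity on underlying spaces: an action of 𝔐ᵒᵖ # Hᶜᵒᵖ is an H-action together with a
right 𝔐-action that is H-linear. -/

namespace QuantumDouble

section

/-! ### Module functors: composition, duals and adjoints -/

section LinearFunctors

open Functor.LaxLeftLinear Functor.OplaxLeftLinear Functor.LeftLinear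

universe v u v₁ u₁ v₂ u₂ v₃ u₃

variable {C : Type u} [Category.{v} C] [MonoidalCategory C]
  {D : Type u₁} [Category.{v₁} D] [MonoidalLeftAction C D]
  {E : Type u₂} [Category.{v₂} E] [MonoidalLeftAction C E]
  {K : Type u₃} [Category.{v₃} K] [MonoidalLeftAction C K]

/-- A lax module functor with invertible structure morphisms is a module functor. -/
@[reducible] def leftLinearOfLax (G : D ⥤ E) [G.LaxLeftLinear C]
    (ν : ∀ (c : C) (d : D), G.obj (c ⊙ₗ d) ⟶ c ⊙ₗ G.obj d)
    (h₁ : ∀ c d, μₗ G c d ≫ ν c d = 𝟙 _) (h₂ : ∀ c d, ν c d ≫ μₗ G c d = 𝟙 _) :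
    G.LeftLinear C where
  δₗ := ν
  μₗ_comp_δₗ := h₁
  δₗ_comp_μₗ := h₂
  δₗ_naturality_left {c c'} f d := by
    have h := μₗ_naturality_left G f d
    calc _ = (ν c d ≫ μₗ G c d) ≫ G.map (f ⊵ₗ d) ≫ ν c' d := by rw [h₂, Category.id_comp]
      _ = ν c d ≫ (f ⊵ₗ G.obj d ≫ μₗ G c' d) ≫ ν c' d := by rw [h]; simp only [Category.assoc]
      _ = _ := by rw [Category.assoc, h₁, Category.comp_id]
  δₗ_naturality_right c {d d'} f := by
    have h := μₗ_naturality_right G c f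
    calc _ = (ν c d ≫ μₗ G c d) ≫ G.map (c ⊴ₗ f) ≫ ν c d' := by rw [h₂, Category.id_comp]
      _ = ν c d ≫ (c ⊴ₗ G.map f ≫ μₗ G c d') ≫ ν c d' := by rw [h]; simp only [Category.assoc]
      _ = _ := by rw [Category.assoc, h₁, Category.comp_id]
  δₗ_associativity c c' d := by
    have h := μₗ_associativity G c c' d
    calc _ = ν (c ⊗ c') d ≫ ((αₗ c c' (G.obj d)).hom ≫ c ⊴ₗ μₗ G c' d ≫
            μₗ G c (c' ⊙ₗ d)) ≫ ν c _ ≫ c ⊴ₗ ν c' d := by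
          simp only [Category.assoc]
          rw [← Category.assoc (μₗ G c _), h₁, Category.id_comp,
            ← actionHomRight_comp, h₁, actionHomRight_id, Category.comp_id]
      _ = _ := by
          rw [← h]; simp only [Category.assoc]
          rw [← Category.assoc, h₂, Category.id_comp]
  δₗ_unitality_inv d := by
    rw [← μₗ_unitality_inv (C := C) G d, Category.assoc, h₁, Category.comp_id]

/-- An oplax module functor with invertible structure morphisms is a module functor. -/
@[reducible] def leftLinearOfOplax (G : D ⥤ E) [G.OplaxLeftLinear C]
    (ν : ∀ (c : C) (d : D), c ⊙ₗ G.obj d ⟶ G.obj (c ⊙ₗ d))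
    (h₁ : ∀ c d, ν c d ≫ δₗ G c d = 𝟙 _) (h₂ : ∀ c d, δₗ G c d ≫ ν c d = 𝟙 _) :
    G.LeftLinear C where
  μₗ := ν
  μₗ_comp_δₗ := h₁
  δₗ_comp_μₗ := h₂
  μₗ_naturality_left {c c'} f d := by
    have h := δₗ_naturality_left G f d
    calc _ = ν c d ≫ (δₗ G c d ≫ f ⊵ₗ G.obj d) ≫ ν c' d := by
            rw [Category.assoc, ← Category.assoc, h₁, Category.id_comp]
      _ = ν c d ≫ (G.map (f ⊵ₗ d) ≫ δₗ G c' d) ≫ ν c' d := by rw [h]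
      _ = _ := by rw [Category.assoc, h₂, Category.comp_id]
  μₗ_naturality_right c {d d'} f := by
    have h := δₗ_naturality_right G c f
    calc _ = ν c d ≫ (δₗ G c d ≫ c ⊴ₗ G.map f) ≫ ν c d' := by
            rw [Category.assoc, ← Category.assoc, h₁, Category.id_comp]
      _ = ν c d ≫ (G.map (c ⊴ₗ f) ≫ δₗ G c d') ≫ ν c d' := by rw [h]
      _ = _ := by rw [Category.assoc, h₂, Category.comp_id]
  μₗ_associativity c c' d := by
    have h := δₗ_associativity G c c' d
    calc _ = ν (c ⊗ c') d ≫ (G.map (αₗ c c' d).hom ≫ δₗ G c (c' ⊙ₗ d) ≫ c ⊴ₗ δₗ G c' d) ≫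
            c ⊴ₗ ν c' d ≫ ν c _ := by
          simp only [Category.assoc]
          rw [← actionHomRight_comp_assoc, h₂, actionHomRight_id, Category.id_comp, h₂,
            Category.comp_id]
      _ = _ := by
          rw [← h]; simp only [Category.assoc]
          rw [← Category.assoc, h₁, Category.id_comp]
  μₗ_unitality d := by
    rw [← δₗ_unitality_hom (C := C) G d, ← Category.assoc, h₁, Category.id_comp]

variable (C) in
/-- The composition of two lax module functors is a lax module functor. -/
@[reducible] def laxLeftLinearComp (F : D ⥤ E) (G : E ⥤ K) [F.LaxLeftLinear C]
    [G.LaxLeftLinear C] : (F ⋙ G).LaxLeftLinear C where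
  μₗ c d := μₗ G c (F.obj d) ≫ G.map (μₗ F c d)
  μₗ_naturality_left f d := by
    rw [Functor.comp_map, Category.assoc, ← G.map_comp, ← μₗ_naturality_left, G.map_comp]
    exact μₗ_naturality_left_assoc G f (F.obj d) _
  μₗ_naturality_right c d d' f := by
    rw [Functor.comp_map, Functor.comp_map, Category.assoc, ← G.map_comp, ← μₗ_naturality_right,
      G.map_comp, μₗ_naturality_right_assoc]
  μₗ_associativity c c' d := by
    simp only [Functor.comp_map, Category.assoc, ← G.map_comp, μₗ_associativity]
    simp only [G.map_comp, μₗ_associativity_assoc, actionHomRight_comp, Category.assoc,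
      μₗ_naturality_right_assoc, Functor.comp_obj]
  μₗ_unitality d := by
    rw [Functor.comp_map, Category.assoc, ← G.map_comp, ← μₗ_unitality]
    exact μₗ_unitality G (F.obj d)

variable (C) in
/-- The composition of two module functors is a module functor. -/
@[reducible] def leftLinearComp (F : D ⥤ E) (G : E ⥤ K) [F.LeftLinear C] [G.LeftLinear C] :
    (F ⋙ G).LeftLinear C :=
  letI := laxLeftLinearComp C F G
  leftLinearOfLax (F ⋙ G) (fun c d => G.map (δₗ F c d) ≫ δₗ G c (F.obj d))
    (fun c d => by
      change (μₗ G c (F.obj d) ≫ G.map (μₗ F c d)) ≫ _ = _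
      rw [Category.assoc, ← G.map_comp_assoc, μₗ_comp_δₗ, G.map_id, Category.id_comp,
        μₗ_comp_δₗ]
      rfl)
    (fun c d => by
      change _ ≫ (μₗ G c (F.obj d) ≫ G.map (μₗ F c d)) = _
      rw [Category.assoc, δₗ_comp_μₗ_assoc, ← G.map_comp, δₗ_comp_μₗ, G.map_id]
      rfl)

/-- A triangle identity of the dual pair, acting on `x` and rewritten with the associators of the
action. -/
theorem duality_zigzag (c c' : C) [ExactPairing c c'] (x : D) :
    (λₗ (c ⊙ₗ x)).inv ≫ (η_ c c') ⊵ₗ (c ⊙ₗ x) ≫ (αₗ c c' (c ⊙ₗ x)).hom ≫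
      c ⊴ₗ ((αₗ c' c x).inv ≫ (ε_ c c') ⊵ₗ x ≫ (λₗ x).hom) = 𝟙 (c ⊙ₗ x) := by
  have h := congrArg (fun f => f ⊵ₗ x) (ExactPairing.evaluation_coevaluation c c')
  have h1 : (α_ c c' c).hom ⊵ₗ x = (αₗ _ _ _).hom ≫ (αₗ _ _ _).hom ≫
      c ⊴ₗ (αₗ _ _ _).inv ≫ (αₗ _ _ _).inv := by
    rw [← associator_actionHom_assoc]
    simp
  have h3 : (ρ_ c).inv ⊵ₗ x = c ⊴ₗ (λₗ x).inv ≫ (αₗ _ _ _).inv := by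
    rw [← cancel_epi ((ρ_ c).hom ⊵ₗ x), hom_inv_actionHomLeft]
    simp [-actionHomRight_comp, ← actionHomRight_comp_assoc]
  simp only [comp_actionHomLeft, h1, whiskerLeft_actionHomLeft, leftUnitor_actionHom,
    h3, Category.assoc, Iso.inv_hom_id_assoc] at h
  rw [actionHomLeft_action]
  simp only [Category.assoc, actionHomRight_comp]
  rw [Iso.inv_comp_eq, Iso.inv_comp_eq, Category.comp_id,
    ← cancel_mono (c ⊴ₗ (λₗ x).inv ≫ (αₗ _ _ _).inv)]
  simpa using h

/-! ### Duals make lax and oplax structure morphisms invertible -/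

section LaxDual

variable (F : D ⥤ E) [F.LaxLeftLinear C]

/-- The inverse of the structure morphism `c ⊙ F(d) ⟶ F(c ⊙ d)` of a lax module functor for an
object `c` with a right dual. -/
def laxInv (c c' : C) [ExactPairing c c'] (d : D) : F.obj (c ⊙ₗ d) ⟶ c ⊙ₗ F.obj d :=
  (λₗ _).inv ≫ (η_ c c') ⊵ₗ F.obj (c ⊙ₗ d) ≫ (αₗ _ _ _).hom ≫ c ⊴ₗ (μₗ F c' (c ⊙ₗ d) ≫
    F.map ((αₗ _ _ _).inv ≫ (ε_ c c') ⊵ₗ d ≫ (λₗ d).hom))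

/-- By lax associativity, naturality and unitality, applying the two structure morphisms and
evaluating inside `F` is the same as evaluating outside `F` (`key`). What remains is the zigzag at
F(d). -/
theorem μₗ_comp_laxInv (c c' : C) [ExactPairing c c'] (d : D) :
    μₗ F c d ≫ laxInv F c c' d = 𝟙 _ := by
  have key : c' ⊴ₗ μₗ F c d ≫ μₗ F c' (c ⊙ₗ d) ≫
      F.map ((αₗ _ _ _).inv ≫ (ε_ c c') ⊵ₗ d ≫ (λₗ d).hom) =
      (αₗ _ _ _).inv ≫ (ε_ c c') ⊵ₗ _ ≫ (λₗ _).hom := by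
    rw [F.map_comp, μₗ_associativity_inv_assoc, F.map_comp, ← μₗ_naturality_left_assoc,
      ← μₗ_unitality]
  refine Eq.trans ?_ (duality_zigzag c c' (F.obj d))
  rw [← key, laxInv, ← Category.assoc, ← actionUnitIso_inv_naturality]
  simp only [Category.assoc]
  congr 1
  rw [← Category.assoc, action_exchange]
  simp only [Category.assoc, actionHomRight_comp, tensor_actionHomRight, Iso.inv_hom_id_assoc]

/-- In this order the whole composite can be moved inside `F`, where it is the image of the zigzag
at `d`. -/
theorem laxInv_comp_μₗ (c c' : C) [ExactPairing c c'] (d : D) :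
    laxInv F c c' d ≫ μₗ F c d = 𝟙 _ := by
  rw [laxInv, actionHomRight_comp]
  simp only [Category.assoc]
  rw [μₗ_naturality_right]
  have : (αₗ c c' (F.obj (c ⊙ₗ d))).hom ≫ c ⊴ₗ μₗ F c' (c ⊙ₗ d) ≫ μₗ F c (c' ⊙ₗ c ⊙ₗ d) =
    μₗ F (c ⊗ c') _ ≫ F.map (αₗ _ _ _).hom := (μₗ_associativity F _ _ _).symm
  rw [reassoc_of% this, μₗ_naturality_left_assoc, μₗ_unitality_inv_assoc, ← F.map_comp,
    ← F.map_comp, ← F.map_comp, duality_zigzag, F.map_id]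

end LaxDual

section OplaxDual

variable (F : D ⥤ E) [F.OplaxLeftLinear C]

/-- The other triangle identity, in which `c` is the second member of the dual pair; it serves oplax
functors as `duality_zigzag` serves lax ones. -/
theorem duality_zigzag' (c c' : C) [ExactPairing c' c] (x : D) :
    c ⊴ₗ ((λₗ x).inv ≫ (η_ c' c) ⊵ₗ x ≫ (αₗ c' c x).hom) ≫
     (αₗ c c' (c ⊙ₗ x)).inv ≫ (ε_ c' c) ⊵ₗ (c ⊙ₗ x) ≫ (λₗ (c ⊙ₗ x)).hom = 𝟙 (c ⊙ₗ x) := by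
  have h := congrArg (fun f => f ⊵ₗ x) (ExactPairing.coevaluation_evaluation c' c)
  have h1 : (α_ c c' c).inv ⊵ₗ x = (αₗ _ _ _).hom ≫ c ⊴ₗ (αₗ _ _ _).hom ≫ (αₗ _ _ _).inv ≫
      (αₗ _ _ _).inv := by
    have := associator_actionHom c c' c x
    rw [← cancel_epi ((α_ c c' c).hom ⊵ₗ x), hom_inv_actionHomLeft, reassoc_of% this]
    simp
  have h3 : (λ_ c).inv ⊵ₗ x = (λₗ _).inv ≫ (αₗ _ _ _).inv := by
    rw [← cancel_epi ((λ_ c).hom ⊵ₗ x), hom_inv_actionHomLeft]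
    simp
  simp only [comp_actionHomLeft, h1, whiskerLeft_actionHomLeft, rightUnitor_actionHom,
    h3, Category.assoc, Iso.inv_hom_id_assoc] at h
  rw [actionHomLeft_action]
  simp only [Category.assoc, actionHomRight_comp]
  rw [← cancel_epi ((αₗ c (𝟙_ C) x).hom ≫ c ⊴ₗ (λₗ x).hom), ← cancel_mono ((λₗ (c ⊙ₗ x)).inv ≫
    (αₗ _ _ _).inv)]
  simpa using h

/-- The inverse of the structure morphism `F(c ⊙ d) ⟶ c ⊙ F(d)` of an oplax module functor for an
object `c` with a left dual. -/
def oplaxInv (c c' : C) [ExactPairing c' c] (d : D) : c ⊙ₗ F.obj d ⟶ F.obj (c ⊙ₗ d) :=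
  c ⊴ₗ (F.map ((λₗ d).inv ≫ (η_ c' c) ⊵ₗ d ≫ (αₗ _ _ _).hom) ≫ δₗ F c' (c ⊙ₗ d)) ≫
    (αₗ _ _ _).inv ≫ (ε_ c' c) ⊵ₗ _ ≫ (λₗ _).hom

theorem oplaxInv_comp_δₗ (c c' : C) [ExactPairing c' c] (d : D) :
    oplaxInv F c c' d ≫ δₗ F c d = 𝟙 _ := by
  have key : F.map ((λₗ d).inv ≫ (η_ c' c) ⊵ₗ d ≫ (αₗ _ _ _).hom) ≫ δₗ F c' (c ⊙ₗ d) ≫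
      c' ⊴ₗ δₗ F c d = (λₗ _).inv ≫ (η_ c' c) ⊵ₗ _ ≫ (αₗ _ _ _).hom := by
    rw [F.map_comp, F.map_comp, Category.assoc, Category.assoc, ← δₗ_associativity,
      δₗ_naturality_left_assoc, ← δₗ_unitality_inv_assoc]
  refine Eq.trans ?_ (duality_zigzag' c c' (F.obj d))
  rw [← key, oplaxInv]
  simp only [Category.assoc, actionHomRight_comp]
  rw [actionUnitIso_hom_naturality, ← reassoc_of% (action_exchange (ε_ c' c) (δₗ F c d))]
  simp only [tensor_actionHomRight, Iso.inv_hom_id_assoc, Category.assoc]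

theorem δₗ_comp_oplaxInv (c c' : C) [ExactPairing c' c] (d : D) :
    δₗ F c d ≫ oplaxInv F c c' d = 𝟙 _ := by
  rw [oplaxInv, actionHomRight_comp]
  simp only [Category.assoc]
  have : δₗ F c (c' ⊙ₗ c ⊙ₗ d) ≫ c ⊴ₗ δₗ F c' (c ⊙ₗ d) ≫ (αₗ _ _ _).inv =
    F.map (αₗ _ _ _).inv ≫ δₗ F (c ⊗ c') _ := δₗ_associativity_inv F _ _ _
  rw [← δₗ_naturality_right_assoc, reassoc_of% this, ← δₗ_naturality_left_assoc,
    δₗ_unitality_hom, ← F.map_comp, ← F.map_comp, ← F.map_comp, duality_zigzag', F.map_id]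

end OplaxDual

section RightAdjoint

variable {F : D ⥤ E} {G : E ⥤ D} (adj : F ⊣ G)

variable (C) in
/-- A right adjoint of a module functor is a lax module functor. -/
@[reducible] def rightAdjointLax [F.LeftLinear C] : G.LaxLeftLinear C where
  -- The mate of the inverse structure morphism of `F`; each axiom then follows by transposing back
  -- along the adjunction.
  μₗ c e := adj.homEquiv _ _ (δₗ F c (G.obj e) ≫ c ⊴ₗ adj.counit.app e)
  μₗ_naturality_left f e := by
    rw [← adj.homEquiv_naturality_left, ← adj.homEquiv_naturality_right]
    congr 1
    rw [δₗ_naturality_left_assoc, Category.assoc, action_exchange]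
  μₗ_naturality_right c e e' f := by
    rw [← adj.homEquiv_naturality_left, ← adj.homEquiv_naturality_right]
    congr 1
    rw [δₗ_naturality_right_assoc, Category.assoc, ← actionHomRight_comp, ← actionHomRight_comp,
      adj.counit_naturality]
  μₗ_associativity c c' e := by
    rw [← adj.homEquiv_naturality_left, ← adj.homEquiv_naturality_left,
      ← adj.homEquiv_naturality_right]
    congr 1
    simp only [Category.assoc]
    rw [δₗ_naturality_right_assoc, ← actionHomRight_comp]
    simp only [adj.homEquiv_unit, F.map_comp, Category.assoc, adj.counit_naturality,
      adj.left_triangle_components_assoc]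
    rw [tensor_actionHomRight]
    simp
  μₗ_unitality e := by
    rw [← adj.homEquiv_naturality_right]
    apply (adj.homEquiv _ _).symm.injective
    rw [Equiv.symm_apply_apply, adj.homEquiv_counit, Category.assoc,
      ← actionUnitIso_hom_naturality, δₗ_unitality_hom_assoc]

variable (C) in
/-- A right adjoint of a module functor is a module functor if `C` has right duals. -/
@[reducible] noncomputable def rightAdjointLinear [F.LeftLinear C] [RightRigidCategory C] :
    G.LeftLinear C :=
  letI := rightAdjointLax C adj
  leftLinearOfLax G (fun c d => laxInv G c cᘁ d) (fun c d => μₗ_comp_laxInv G c cᘁ d)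
    (fun c d => laxInv_comp_μₗ G c cᘁ d)

end RightAdjoint

end LinearFunctors

end

/-! ### Adjunctions in the setting of module functors -/

section

section Adjoints

open Functor.LaxLeftLinear Functor.OplaxLeftLinear Functor.LeftLinear

universe v u v₁ u₁ v₂ u₂ v₃ u₃

section LeftAdjoint

variable {C : Type u} [Category.{v} C] [MonoidalCategory C]
  {D : Type u₁} [Category.{v₁} D] [MonoidalLeftAction C D]
  {E : Type u₂} [Category.{v₂} E] [MonoidalLeftAction C E]
  {L : D ⥤ E} {G : E ⥤ D} (adj : L ⊣ G)

variable (C) in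
/-- A left adjoint of a module functor is an oplax module functor. -/
@[reducible] def leftAdjointOplax [G.LeftLinear C] : L.OplaxLeftLinear C where
  δₗ c d := (adj.homEquiv _ _).symm (c ⊴ₗ adj.unit.app d ≫ μₗ G c (L.obj d))
  δₗ_naturality_left f d := by
    rw [← adj.homEquiv_naturality_left_symm, ← adj.homEquiv_naturality_right_symm]
    congr 1
    rw [Category.assoc, ← μₗ_naturality_left, reassoc_of% (action_exchange f (adj.unit.app d))]
  δₗ_naturality_right c d d' f := by
    rw [← adj.homEquiv_naturality_left_symm, ← adj.homEquiv_naturality_right_symm]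
    congr 1
    rw [Category.assoc, ← μₗ_naturality_right, ← actionHomRight_comp_assoc,
      ← actionHomRight_comp_assoc, ← adj.unit_naturality]
  δₗ_associativity c c' d := by
    rw [← adj.homEquiv_naturality_right_symm, ← adj.homEquiv_naturality_right_symm,
      ← adj.homEquiv_naturality_left_symm]
    congr 1
    simp only [Category.assoc]
    rw [← μₗ_naturality_right, ← actionHomRight_comp_assoc]
    rw [← adj.homEquiv_unit, Equiv.apply_symm_apply, tensor_actionHomRight]
    simp
  δₗ_unitality_inv d := by
    rw [← adj.homEquiv_naturality_left_symm]
    apply (adj.homEquiv _ _).injective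
    rw [Equiv.apply_symm_apply, adj.homEquiv_unit, ← Category.assoc,
      actionUnitIso_inv_naturality, Category.assoc]
    exact congrArg (adj.unit.app d ≫ ·) (μₗ_unitality_inv (C := C) G (L.obj d)).symm

variable (C) in
/-- A left adjoint of a module functor is a module functor if `C` has left duals. -/
@[reducible] noncomputable def leftAdjointLinear [G.LeftLinear C] [LeftRigidCategory C] :
    L.LeftLinear C :=
  letI := leftAdjointOplax C adj
  leftLinearOfOplax L (fun c d => oplaxInv L c (HasLeftDual.leftDual c) d)
    (fun c d => oplaxInv_comp_δₗ L c (HasLeftDual.leftDual c) d)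
    (fun c d => δₗ_comp_oplaxInv L c (HasLeftDual.leftDual c) d)

end LeftAdjoint

namespace ModFun

variable {C : Type u} [Category.{v} C] [MonoidalCategory C]
  {D : Type u₁} [Category.{v₁} D] [Preadditive D] [Linear ℂ D] [MonoidalLeftAction C D]
  {E : Type u₂} [Category.{v₂} E] [Preadditive E] [Linear ℂ E] [MonoidalLeftAction C E]
  {K : Type u₃} [Category.{v₃} K] [Preadditive K] [Linear ℂ K] [MonoidalLeftAction C K]

@[simp] theorem comp_nat {F G H : ModFun C D E} (f : F ⟶ G) (g : G ⟶ H) :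
    (f ≫ g).nat = f.nat ≫ g.nat := rfl

/-- The composition of module functors. -/
@[reducible] def comp (F : ModFun C D E) (G : ModFun C E K) : ModFun C D K where
  F := F.F ⋙ G.F
  leftLinear := leftLinearComp C F.F G.F

/-- The unit of an adjunction between module functors is compatible with the module structures. -/
def UnitComm (F : ModFun C D E) (G : ModFun C E D) (adj : F.F ⊣ G.F) : Prop :=
  ∀ (c : C) (d : D),
    adj.unit.app (c ⊙ₗ d) = c ⊴ₗ adj.unit.app d ≫ μₗ G.F c (F.F.obj d) ≫ G.F.map (μₗ F.F c d)

/-- The counit of an adjunction between module functors is compatible with the module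
structures. -/
def CounitComm (F : ModFun C D E) (G : ModFun C E D) (adj : F.F ⊣ G.F) : Prop :=
  ∀ (c : C) (e : E),
    F.F.map (μₗ G.F c e) ≫ adj.counit.app (c ⊙ₗ e) =
      δₗ F.F c (G.F.obj e) ≫ c ⊴ₗ adj.counit.app e

variable {F F' : ModFun C D E} {G G' : ModFun C E D} {adj : F.F ⊣ G.F} {adj' : F'.F ⊣ G'.F}

/-- Both sides have the structure morphism of `G` as their transpose, by the triangle identities.
With the converse below, compatibility may be checked on whichever of unit and counit is convenient:
the counit for a right adjoint built by mates, the unit for a left adjoint. -/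
theorem UnitComm.counitComm (h : UnitComm F G adj) : CounitComm F G adj := by
  intro c e
  apply (adj.homEquiv _ _).injective
  rw [adj.homEquiv_unit, adj.homEquiv_unit, G.F.map_comp, G.F.map_comp]
  have h1 := adj.unit_naturality (μₗ G.F c e)
  calc _ = μₗ G.F c e ≫ adj.unit.app _ ≫ G.F.map (adj.counit.app (c ⊙ₗ e)) := by
        rw [reassoc_of% h1]
    _ = μₗ G.F c e := by rw [adj.right_triangle_components, Category.comp_id]
    _ = c ⊴ₗ (adj.unit.app (G.F.obj e) ≫ G.F.map (adj.counit.app e)) ≫ μₗ G.F c e := by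
        rw [adj.right_triangle_components]
        exact (congrArg (· ≫ _) (actionHomRight_id _ _)).trans (Category.id_comp _) |>.symm
    _ = c ⊴ₗ adj.unit.app (G.F.obj e) ≫ μₗ G.F c _ ≫ G.F.map (c ⊴ₗ adj.counit.app e) := by
        rw [actionHomRight_comp, Category.assoc]
        exact congrArg (_ ≫ ·) (μₗ_naturality_right G.F c (adj.counit.app e))
    _ = _ := by
        rw [h c (G.F.obj e)]
        simp only [Category.assoc]
        rw [← G.F.map_comp_assoc (μₗ F.F _ _), μₗ_comp_δₗ, G.F.map_id, Category.id_comp]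

theorem CounitComm.unitComm (h : CounitComm F G adj) : UnitComm F G adj := by
  intro c d
  apply (adj.homEquiv _ _).symm.injective
  rw [adj.homEquiv_counit, adj.homEquiv_counit]
  have h1 := adj.counit_naturality (μₗ F.F c d)
  calc _ = 𝟙 (F.F.obj (c ⊙ₗ d)) := adj.left_triangle_components _
    _ = δₗ F.F c d ≫ c ⊴ₗ (F.F.map (adj.unit.app d) ≫ adj.counit.app (F.F.obj d)) ≫
          μₗ F.F c d := by
        rw [adj.left_triangle_components, actionHomRight_id, Category.id_comp, δₗ_comp_μₗ]
    _ = F.F.map (c ⊴ₗ adj.unit.app d) ≫ (δₗ F.F c _ ≫ c ⊴ₗ adj.counit.app (F.F.obj d)) ≫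
          μₗ F.F c d := by
        rw [actionHomRight_comp, Category.assoc, Category.assoc, δₗ_naturality_right_assoc]
        rfl
    _ = _ := by
        simp only [F.F.map_comp, Category.assoc]
        rw [h1]
        exact congrArg (F.F.map (c ⊴ₗ adj.unit.app d) ≫ ·)
          ((reassoc_of% (h c (F.F.obj d))) (μₗ F.F c d)).symm

/-- A right adjoint of a module functor, as a module functor. -/
@[reducible] noncomputable def rightAdjoint [RightRigidCategory C] (F : ModFun C D E) {G : E ⥤ D}
    (adj : F.F ⊣ G) : ModFun C E D :=
  haveI : G.Additive := adj.right_adjoint_additive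
  haveI : G.Linear ℂ := ⟨fun {X Y} f r => by
    apply (adj.homEquiv _ _).symm.injective
    simp [adj.homEquiv_counit, Functor.map_smul]⟩
  { F := G
    leftLinear := rightAdjointLinear C adj }

/-- The structure of `G` was defined as a transpose, and transposing it back is precisely counit
compatibility. -/
theorem rightAdjoint_unitComm [RightRigidCategory C] (F : ModFun C D E) {G : E ⥤ D}
    (adj : F.F ⊣ G) : UnitComm F (F.rightAdjoint adj) adj := by
  refine CounitComm.unitComm fun c e => ?_
  exact (adj.homEquiv_counit _ _ _).symm.trans (Equiv.symm_apply_apply _ _)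

/-- A left adjoint of a module functor, as a module functor. -/
@[reducible] noncomputable def leftAdjoint [LeftRigidCategory C] (G : ModFun C E D) {L : D ⥤ E}
    (adj : L ⊣ G.F) : ModFun C D E :=
  haveI : L.Additive := adj.left_adjoint_additive
  haveI : L.Linear ℂ := ⟨fun {X Y} f r => by
    apply (adj.homEquiv _ _).injective
    simp [adj.homEquiv_unit, Functor.map_smul]⟩
  { F := L
    leftLinear := leftAdjointLinear C adj }

theorem leftAdjoint_unitComm [LeftRigidCategory C] (G : ModFun C E D) {L : D ⥤ E}
    (adj : L ⊣ G.F) : UnitComm (G.leftAdjoint adj) G adj := by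
  let _ := leftAdjointLinear C adj
  intro c d
  change adj.unit.app (c ⊙ₗ d) = c ⊴ₗ adj.unit.app d ≫ μₗ G.F c (L.obj d) ≫ G.F.map (μₗ L c d)
  have h : adj.unit.app (c ⊙ₗ d) ≫ G.F.map (δₗ L c d) =
      c ⊴ₗ adj.unit.app d ≫ μₗ G.F c (L.obj d) :=
    (adj.homEquiv_unit _ _ _).symm.trans (Equiv.apply_symm_apply _ _)
  rw [← Category.assoc, ← h, Category.assoc, ← G.F.map_comp, δₗ_comp_μₗ, G.F.map_id]
  exact (Category.comp_id _).symm

/-- The conjugate of a transformation of module functors. -/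
def conj (h : UnitComm F G adj) (h' : UnitComm F' G' adj') (f : F ⟶ F') : G' ⟶ G where
  nat := conjugateEquiv adj' adj f.nat
  comm c e := by
    apply (adj.homEquiv _ _).symm.injective
    simp only [adj.homEquiv_counit, F.F.map_comp, Category.assoc]
    rw [conjugateEquiv_counit, h.counitComm, δₗ_naturality_right_assoc, ← actionHomRight_comp,
      conjugateEquiv_counit, NatTrans.naturality_assoc, h'.counitComm,
      ← cancel_epi (μₗ F.F c _), reassoc_of% (f.comm c (G'.F.obj e))]
    simp

/-- The transformation of left adjoints conjugate to a transformation of right adjoints. -/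
def conjSymm (h : UnitComm F G adj) (h' : UnitComm F' G' adj') (g : G' ⟶ G) : F ⟶ F' where
  nat := (conjugateEquiv adj' adj).symm g.nat
  comm c d := by
    have hu := unit_conjugateEquiv_symm adj' adj g.nat
    have key : δₗ F.F c d ≫ c ⊴ₗ ((conjugateEquiv adj' adj).symm g.nat).app d =
        ((conjugateEquiv adj' adj).symm g.nat).app (c ⊙ₗ d) ≫ δₗ F'.F c d := by
      apply (adj.homEquiv _ _).injective
      rw [adj.homEquiv_unit, adj.homEquiv_unit, G.F.map_comp, G.F.map_comp, ← reassoc_of% (hu (c ⊙ₗ d)),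
        h c d, h' c d]
      simp only [Category.assoc]
      rw [← g.nat.naturality, ← G.F.map_comp_assoc (μₗ F.F _ _), ← G'.F.map_comp_assoc (μₗ F'.F _ _),
        μₗ_comp_δₗ, μₗ_comp_δₗ, G.F.map_id, G'.F.map_id, Category.id_comp, Category.id_comp,
        ← μₗ_naturality_right, g.comm, ← actionHomRight_comp_assoc, ← actionHomRight_comp_assoc,
        hu]
    rw [← cancel_epi (δₗ F.F c d), reassoc_of% key]
    simp

end ModFun

end Adjoints

end

section

/-! ### Semisimple categories and relative tensor products -/

universe v u v₁ u₁ v₂ u₂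

section Semisimple

open Limits

variable {D : Type u₁} [Category.{v₁} D] [Abelian D] [Linear ℂ D] [FiniteSemisimple D]

/-- If `r` retracts the kernel inclusion ι, then 1 - rι kills the kernel; since `f` is the cokernel
of its kernel, this endomorphism factors through `f`, and the factor is a section. -/
theorem exists_section_of_epi {X Y : D} (f : X ⟶ Y) [Epi f] : ∃ s : Y ⟶ X, s ≫ f = 𝟙 Y := by
  obtain ⟨⟨r, hr⟩⟩ := (FiniteSemisimple.split (kernel.ι f)).exists_splitMono
  have h : kernel.ι f ≫ (𝟙 X - r ≫ kernel.ι f) = 0 := by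
    rw [Preadditive.comp_sub, reassoc_of% hr, Category.comp_id, sub_self]
  refine ⟨(Abelian.epiIsCokernelOfKernel _ (kernelIsKernel f)).desc
    (CokernelCofork.ofπ _ h), ?_⟩
  rw [← cancel_epi f]
  have h2 : f ≫ (Abelian.epiIsCokernelOfKernel _ (kernelIsKernel f)).desc
    (CokernelCofork.ofπ _ h) = 𝟙 X - r ≫ kernel.ι f :=
    (Abelian.epiIsCokernelOfKernel _ (kernelIsKernel f)).fac _ WalkingParallelPair.one
  rw [reassoc_of% h2]
  simp

/-- Every morphism of a semisimple category is von Neumann regular. -/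
theorem exists_regular {X Y : D} (f : X ⟶ Y) : ∃ s : Y ⟶ X, f ≫ s ≫ f = f := by
  obtain ⟨⟨r, hr⟩⟩ := (FiniteSemisimple.split (image.ι f)).exists_splitMono
  obtain ⟨s, hs⟩ := exists_section_of_epi (factorThruImage f)
  refine ⟨r ≫ s, ?_⟩
  have : f ≫ (r ≫ s) ≫ f = factorThruImage f ≫ (image.ι f ≫ r) ≫
      (s ≫ factorThruImage f) ≫ image.ι f := by
    simp only [Category.assoc, image.fac, image.fac_assoc]
  rw [this, hr, hs, Category.id_comp, Category.id_comp, image.fac]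

/-- The cokernel projection is split, by a section `σ` with `π σ = 1 - s f`. -/
theorem exists_cokernel_section {X Y : D} (f : X ⟶ Y) :
    ∃ (σ : cokernel f ⟶ Y) (s : Y ⟶ X), σ ≫ cokernel.π f = 𝟙 _ ∧
      cokernel.π f ≫ σ = 𝟙 Y - s ≫ f := by
  obtain ⟨s, hs⟩ := exists_regular f
  refine ⟨cokernel.desc f (𝟙 Y - s ≫ f) (by
    rw [Preadditive.comp_sub, Category.comp_id, hs, sub_self]), s, ?_, cokernel.π_desc _ _ _⟩
  rw [← cancel_epi (cokernel.π f), cokernel.π_desc_assoc]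
  simp

/-- A section of a cokernel projection. -/
noncomputable def cokernelSection {X Y : D} (f : X ⟶ Y) : cokernel f ⟶ Y :=
  (exists_cokernel_section f).choose

@[simp]
theorem cokernelSection_π {X Y : D} (f : X ⟶ Y) : cokernelSection f ≫ cokernel.π f = 𝟙 _ :=
  (exists_cokernel_section f).choose_spec.choose_spec.1

/-- Additive functors on semisimple categories preserve cokernels. -/
theorem map_π_section_comp {D' : Type u₂} [Category.{v₂} D'] [Preadditive D'] (F : D ⥤ D')
    [F.Additive] {X Y : D} (f : X ⟶ Y) {Z : D'} (h : F.obj Y ⟶ Z) (w : F.map f ≫ h = 0) :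
    F.map (cokernel.π f) ≫ F.map (cokernelSection f) ≫ h = h := by
  obtain ⟨s, hs⟩ := (exists_cokernel_section f).choose_spec
  -- The identity πσ = 1 - sf involves only composition and subtraction, so `F` preserves it, and
  -- `w` removes the term with sf.
  rw [← F.map_comp_assoc, cokernelSection, hs.2, F.map_sub, F.map_comp, F.map_id,
    Preadditive.sub_comp, Category.assoc, w, Limits.comp_zero, sub_zero, Category.id_comp]

end Semisimple

section Action

variable {C : Type u} [Category.{v} C] [MonoidalCategory C] [Preadditive C] [Linear ℂ C]
  [MonoidalPreadditive C] [MonoidalLinear ℂ C]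

instance {D : Type u₁} [Category.{v₁} D] [Preadditive D] [Linear ℂ D] [MonoidalLeftAction C D]
    [BilinearAction C D] (c : C) : ((curriedAction C D).obj c).Additive :=
  ⟨fun {X Y} f g => BilinearAction.actionHomRight_add c f g⟩

end Action

namespace RMod

variable {C : Type u} [Category.{v} C] [MonoidalCategory C] [Preadditive C] [Linear ℂ C]
  [MonoidalPreadditive C] [MonoidalLinear ℂ C] {A : Mon C}

@[simp] theorem comp_hom {X Y Z : RMod A} (f : X ⟶ Y) (g : Y ⟶ Z) :
    (f ≫ g).hom = f.hom ≫ g.hom := rfl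
@[simp] theorem id_hom (X : RMod A) : Hom.hom (𝟙 X) = 𝟙 X.X := rfl
@[simp] theorem add_hom {X Y : RMod A} (f g : X ⟶ Y) : (f + g).hom = f.hom + g.hom := rfl
@[simp] theorem smul_hom {X Y : RMod A} (z : ℂ) (f : X ⟶ Y) : (z • f).hom = z • f.hom := rfl
@[simp] theorem actionHomRight_hom (c : C) {X Y : RMod A} (f : X ⟶ Y) :
    (c ⊴ₗ f).hom = c ◁ f.hom := id_tensorHom c f.hom
@[simp] theorem actionHomLeft_hom {c c' : C} (f : c ⟶ c') (X : RMod A) :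
    (f ⊵ₗ X).hom = f ▷ X.X := tensorHom_id f X.X

end RMod

/-! ### The module functor X ↦ X ⊗_A E -/

section RelTensor

open Limits Functor.LaxLeftLinear Functor.OplaxLeftLinear Functor.LeftLinear

variable {C : Type u} [Category.{v} C] [MonoidalCategory C] [Preadditive C] [Linear ℂ C]
  [MonoidalPreadditive C] [MonoidalLinear ℂ C]
  {D : Type u₁} [Category.{v₁} D] [Abelian D] [Linear ℂ D] [FiniteSemisimple D]
  [MonoidalLeftAction C D] [BilinearAction C D] {A : Mon C} (E : D) [ModObj A.X E]

namespace RelTensor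

/-- The difference of the two actions of `A` on `X ⊗ E`, for a right `A`-module `X` and a left
`A`-module `E`. -/
def diff (X : RMod A) : (X.X ⊗ A.X) ⊙ₗ E ⟶ X.X ⊙ₗ E :=
  X.act ⊵ₗ E - (αₗ _ _ _).hom ≫ X.X ⊴ₗ γ

theorem diff_comp_eq_zero_iff (X : RMod A) {Z : D} (h : X.X ⊙ₗ E ⟶ Z) :
    diff E X ≫ h = 0 ↔ X.act ⊵ₗ E ≫ h = (αₗ _ _ _).hom ≫ X.X ⊴ₗ γ ≫ h := by
  rw [diff, Preadditive.sub_comp, sub_eq_zero, Category.assoc]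

/-- The object `X ⊗_A E`. -/
noncomputable def obj (X : RMod A) : D := cokernel (diff E X)

/-- The projection `X ⊗ E ⟶ X ⊗_A E`. -/
noncomputable def π (X : RMod A) : X.X ⊙ₗ E ⟶ obj E X := cokernel.π (diff E X)

/-- A section of the projection `X ⊗ E ⟶ X ⊗_A E`. -/
noncomputable def σ (X : RMod A) : obj E X ⟶ X.X ⊙ₗ E := cokernelSection (diff E X)

@[simp]
theorem σ_π (X : RMod A) : σ E X ≫ π E X = 𝟙 _ := cokernelSection_π _

@[simp]
theorem σ_π_assoc (X : RMod A) {Z : D} (h : obj E X ⟶ Z) :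
    σ E X ≫ π E X ≫ h = h := by
  rw [← Category.assoc, σ_π, Category.id_comp]

instance (X : RMod A) : IsSplitEpi (π E X) := ⟨⟨σ E X, σ_π E X⟩⟩

theorem act_π (X : RMod A) : X.act ⊵ₗ E ≫ π E X = (αₗ _ _ _).hom ≫ X.X ⊴ₗ γ ≫ π E X :=
  (diff_comp_eq_zero_iff E X _).1 (cokernel.condition _)

theorem act_π_assoc (X : RMod A) {Z : D} (h : obj E X ⟶ Z) :
    X.act ⊵ₗ E ≫ π E X ≫ h = (αₗ _ _ _).hom ≫ X.X ⊴ₗ γ ≫ π E X ≫ h := by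
  rw [← Category.assoc, act_π, Category.assoc, Category.assoc]

/-- Balanced morphisms out of F(X ⊗ E) descend to F(X ⊗_A E), for any additive `F`. This is used for
the identity, for the action of an object of C, and later for arbitrary module functors; no
exactness assumption is needed because the cokernel is split. -/
theorem map_π_σ {D' : Type u₂} [Category.{v₂} D'] [Preadditive D'] (F : D ⥤ D')
    [F.Additive] (X : RMod A) {Z : D'} (h : F.obj (X.X ⊙ₗ E) ⟶ Z)
    (w : F.map (X.act ⊵ₗ E) ≫ h = F.map (αₗ _ _ _).hom ≫ F.map (X.X ⊴ₗ γ) ≫ h) :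
    F.map (π E X) ≫ F.map (σ E X) ≫ h = h :=
  map_π_section_comp F (diff E X) h (by
    rw [diff, F.map_sub, Preadditive.sub_comp, sub_eq_zero, w, F.map_comp, Category.assoc])

theorem π_σ (X : RMod A) {Z : D} (h : X.X ⊙ₗ E ⟶ Z)
    (w : X.act ⊵ₗ E ≫ h = (αₗ _ _ _).hom ≫ X.X ⊴ₗ γ ≫ h) : π E X ≫ σ E X ≫ h = h :=
  map_π_σ E (𝟭 D) X h w

theorem action_π_σ (c : C) (X : RMod A) {Z : D} (h : c ⊙ₗ (X.X ⊙ₗ E) ⟶ Z)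
    (w : c ⊴ₗ (X.act ⊵ₗ E) ≫ h = c ⊴ₗ (αₗ _ _ _).hom ≫ c ⊴ₗ (X.X ⊴ₗ γ) ≫ h) :
    c ⊴ₗ π E X ≫ c ⊴ₗ σ E X ≫ h = h :=
  map_π_σ E ((curriedAction C D).obj c) X h w

instance (c : C) (X : RMod A) : IsSplitEpi (c ⊴ₗ π E X) :=
  ⟨⟨c ⊴ₗ σ E X, by rw [← actionHomRight_comp, σ_π, actionHomRight_id]⟩⟩

/-- The morphism `X ⊗_A E ⟶ Y ⊗_A E` induced by `f : X ⟶ Y`. -/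
noncomputable def map {X Y : RMod A} (f : X ⟶ Y) : obj E X ⟶ obj E Y :=
  σ E X ≫ f.hom ⊵ₗ E ≫ π E Y

@[simp]
theorem π_map {X Y : RMod A} (f : X ⟶ Y) : π E X ≫ map E f = f.hom ⊵ₗ E ≫ π E Y := by
  apply π_σ
  rw [← comp_actionHomLeft_assoc, f.act_hom, comp_actionHomLeft_assoc, act_π,
    whiskerRight_actionHomLeft]
  simp only [Category.assoc, Iso.inv_hom_id_assoc]
  rw [reassoc_of% (action_exchange f.hom (γ : A.X ⊙ₗ E ⟶ E))]

@[simp]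
theorem π_map_assoc {X Y : RMod A} (f : X ⟶ Y) {Z : D} (h : obj E Y ⟶ Z) :
    π E X ≫ map E f ≫ h = f.hom ⊵ₗ E ≫ π E Y ≫ h := by
  rw [← Category.assoc, π_map, Category.assoc]

variable (A) in
/-- The functor `X ↦ X ⊗_A E`. -/
@[reducible] noncomputable def functor : RMod A ⥤ D where
  obj := obj E
  map := map E
  map_id X := by rw [← cancel_epi (π E X)]; simp
  map_comp f g := by rw [← cancel_epi (π E _)]; simp

instance : (functor A E).Additive where
  map_add {X Y f g} := by
    rw [← cancel_epi (π E _)]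
    simp [BilinearAction.actionHomLeft_add, Preadditive.comp_add, Preadditive.add_comp]

instance : (functor A E).Linear ℂ where
  map_smul f z := by
    rw [← cancel_epi (π E _)]
    simp [BilinearAction.actionHomLeft_smul, Linear.comp_smul, Linear.smul_comp]

/-- The projection `(c ⊗ X) ⊗ E ⟶ (c ⊗ X) ⊗_A E`. -/
noncomputable def πT (c : C) (X : RMod A) : (c ⊗ X.X) ⊙ₗ E ⟶ obj E (c ⊙ₗ X) := π E (c ⊙ₗ X)

/-- The projection `(c ⊗ (c' ⊗ X)) ⊗ E ⟶ (c ⊗ (c' ⊗ X)) ⊗_A E`. -/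
noncomputable def πT₂ (c c' : C) (X : RMod A) :
    (c ⊗ (c' ⊗ X.X)) ⊙ₗ E ⟶ obj E (c ⊙ₗ c' ⊙ₗ X) := π E (c ⊙ₗ c' ⊙ₗ X)

instance (c : C) (X : RMod A) : IsSplitEpi (πT E c X) :=
  inferInstanceAs (IsSplitEpi (π E (c ⊙ₗ X)))

theorem act_πT (c : C) (X : RMod A) :
    ((α_ c X.X A.X).hom ≫ c ◁ X.act) ⊵ₗ E ≫ πT E c X =
      (αₗ (c ⊗ X.X) A.X E).hom ≫ (c ⊗ X.X) ⊴ₗ γ ≫ πT E c X := act_π E (c ⊙ₗ X)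

theorem πT_σ (c : C) (X : RMod A) {Z : D} (h : (c ⊗ X.X) ⊙ₗ E ⟶ Z)
    (w : ((α_ c X.X A.X).hom ≫ c ◁ X.act) ⊵ₗ E ≫ h =
      (αₗ (c ⊗ X.X) A.X E).hom ≫ (c ⊗ X.X) ⊴ₗ γ ≫ h) :
    πT E c X ≫ σ E (c ⊙ₗ X) ≫ h = h := π_σ E (c ⊙ₗ X) h w

@[simp]
theorem πT_map_left {c c' : C} (f : c ⟶ c') (X : RMod A) :
    πT E c X ≫ map E (f ⊵ₗ X) = (f ▷ X.X) ⊵ₗ E ≫ πT E c' X :=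
  (π_map E (f ⊵ₗ X)).trans (congrArg (fun g => g ⊵ₗ E ≫ πT E c' X) (tensorHom_id f X.X))

@[simp]
theorem πT_map_right (c : C) {X Y : RMod A} (f : X ⟶ Y) :
    πT E c X ≫ map E (c ⊴ₗ f) = (c ◁ f.hom) ⊵ₗ E ≫ πT E c Y :=
  (π_map E (c ⊴ₗ f)).trans (congrArg (fun g => g ⊵ₗ E ≫ πT E c Y) (id_tensorHom c f.hom))

@[simp]
theorem πT_map_assoc (c c' : C) (X : RMod A) :
    πT E (c ⊗ c') X ≫ map E (αₗ c c' X).hom = (α_ c c' X.X).hom ⊵ₗ E ≫ πT₂ E c c' X :=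
  π_map E (αₗ c c' X).hom

@[simp]
theorem πT_map_unitor (X : RMod A) :
    πT E (𝟙_ C) X ≫ map E (λₗ X).hom = (λ_ X.X).hom ⊵ₗ E ≫ π E X :=
  π_map E (λₗ X).hom

/-- The structure morphism `c ⊗ (X ⊗_A E) ⟶ (c ⊗ X) ⊗_A E`. -/
noncomputable def lin (c : C) (X : RMod A) : c ⊙ₗ obj E X ⟶ obj E (c ⊙ₗ X) :=
  c ⊴ₗ σ E X ≫ (αₗ c X.X E).inv ≫ πT E c X

-- The right action on c ⊗ X is that of X up to an associator, so the balancing relation of (c ⊗ X)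
-- ⊗_A E is the one of X ⊗_A E with `c` acting on it, and the morphism descends.
@[simp]
theorem π_lin (c : C) (X : RMod A) :
    c ⊴ₗ π E X ≫ lin E c X = (αₗ c X.X E).inv ≫ πT E c X := by
  apply action_π_σ
  have h := act_πT E c X
  rw [comp_actionHomLeft, whiskerLeft_actionHomLeft] at h
  have h1 := associator_actionHom c X.X A.X E
  have h2 := tensor_actionHomRight c X.X (γ : A.X ⊙ₗ E ⟶ E)
  rw [← cancel_epi ((αₗ (c ⊗ X.X) A.X E).hom ≫ (αₗ c X.X (A.X ⊙ₗ E)).hom ≫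
    c ⊴ₗ (αₗ X.X A.X E).inv)]
  have h3 : (αₗ (c ⊗ X.X) A.X E).hom ≫ (αₗ c X.X (A.X ⊙ₗ E)).hom ≫
      c ⊴ₗ (αₗ X.X A.X E).inv = (α_ c X.X A.X).hom ⊵ₗ E ≫ (αₗ c (X.X ⊗ A.X) E).hom := by
    rw [← reassoc_of% h1, actionHomRight_hom_inv, Category.comp_id]
  rw [h3]
  simp only [Category.assoc] at h ⊢
  rw [h, h2, ← reassoc_of% h3]
  simp

@[simp]
theorem π_lin_assoc (c : C) (X : RMod A) {Z : D} (h : obj E (c ⊙ₗ X) ⟶ Z) :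
    c ⊴ₗ π E X ≫ lin E c X ≫ h = (αₗ c X.X E).inv ≫ πT E c X ≫ h := by
  rw [← Category.assoc, π_lin, Category.assoc]

theorem πT_lin (c c' : C) (X : RMod A) :
    c ⊴ₗ πT E c' X ≫ lin E c (c' ⊙ₗ X) = (αₗ c (c' ⊗ X.X) E).inv ≫ πT₂ E c c' X :=
  π_lin E c (c' ⊙ₗ X)

/-- The inverse of `lin`. -/
noncomputable def linInv (c : C) (X : RMod A) : obj E (c ⊙ₗ X) ⟶ c ⊙ₗ obj E X :=
  σ E (c ⊙ₗ X) ≫ (αₗ c X.X E).hom ≫ c ⊴ₗ π E X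

@[simp]
theorem πT_linInv (c : C) (X : RMod A) :
    πT E c X ≫ linInv E c X = (αₗ c X.X E).hom ≫ c ⊴ₗ π E X := by
  refine πT_σ E c X ((αₗ c X.X E).hom ≫ c ⊴ₗ π E X) ?_
  have h := congrArg (fun f => c ⊴ₗ f) (act_π E X)
  simp only [actionHomRight_comp] at h
  have h2 := tensor_actionHomRight c X.X (γ : A.X ⊙ₗ E ⟶ E)
  rw [comp_actionHomLeft, whiskerLeft_actionHomLeft]
  simp only [Category.assoc, Iso.inv_hom_id_assoc, h, h2]
  rw [associator_actionHom_assoc]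

@[simp]
theorem πT_linInv_assoc (c : C) (X : RMod A) {Z : D} (h : c ⊙ₗ obj E X ⟶ Z) :
    πT E c X ≫ linInv E c X ≫ h = (αₗ c X.X E).hom ≫ c ⊴ₗ π E X ≫ h := by
  rw [← Category.assoc, πT_linInv, Category.assoc]

theorem lin_naturality_left {c c' : C} (f : c ⟶ c') (X : RMod A) :
    f ⊵ₗ obj E X ≫ lin E c' X = lin E c X ≫ map E (f ⊵ₗ X) := by
  rw [← cancel_epi (c ⊴ₗ π E X), reassoc_of% (action_exchange f (π E X)), π_lin, π_lin_assoc,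
    πT_map_left, whiskerRight_actionHomLeft]
  simp only [Category.assoc, Iso.inv_hom_id_assoc]

theorem lin_naturality_right (c : C) {X Y : RMod A} (f : X ⟶ Y) :
    c ⊴ₗ map E f ≫ lin E c Y = lin E c X ≫ map E (c ⊴ₗ f) := by
  rw [← cancel_epi (c ⊴ₗ π E X), ← actionHomRight_comp_assoc, π_map, π_lin_assoc,
    πT_map_right, actionHomRight_comp_assoc, π_lin, whiskerLeft_actionHomLeft]
  simp only [Category.assoc, Iso.inv_hom_id_assoc]

theorem lin_associativity (c c' : C) (X : RMod A) :
    lin E (c ⊗ c') X ≫ map E (αₗ c c' X).hom =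
      (αₗ c c' (obj E X)).hom ≫ c ⊴ₗ lin E c' X ≫ lin E c (c' ⊙ₗ X) := by
  rw [← cancel_epi ((c ⊗ c') ⊴ₗ π E X), π_lin_assoc, πT_map_assoc, tensor_actionHomRight]
  simp only [Category.assoc, Iso.inv_hom_id_assoc]
  rw [← actionHomRight_comp_assoc, π_lin, actionHomRight_comp_assoc, πT_lin, Iso.inv_comp_eq,
    ← associator_actionHom_assoc]
  simp

theorem lin_unitality (X : RMod A) :
    (λₗ (obj E X)).hom = lin E (𝟙_ C) X ≫ map E (λₗ X).hom := by
  rw [← cancel_epi (𝟙_ C ⊴ₗ π E X), π_lin_assoc, πT_map_unitor, leftUnitor_actionHom,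
    Category.assoc, Iso.inv_hom_id_assoc, actionUnitIso_hom_naturality]

theorem lin_linInv (c : C) (X : RMod A) : lin E c X ≫ linInv E c X = 𝟙 _ := by
  rw [← cancel_epi (c ⊴ₗ π E X), π_lin_assoc, πT_linInv, Iso.inv_hom_id_assoc, Category.comp_id]

theorem linInv_lin (c : C) (X : RMod A) : linInv E c X ≫ lin E c X = 𝟙 _ := by
  rw [← cancel_epi (πT E c X), πT_linInv_assoc, π_lin, Iso.hom_inv_id_assoc, Category.comp_id]

noncomputable instance : (functor A E).LaxLeftLinear C where
  μₗ := lin E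
  μₗ_naturality_left f X := lin_naturality_left E f X
  μₗ_naturality_right c _ _ f := lin_naturality_right E c f
  μₗ_associativity c c' X := lin_associativity E c c' X
  μₗ_unitality X := lin_unitality E X

noncomputable instance : (functor A E).LeftLinear C :=
  leftLinearOfLax _ (linInv E) (lin_linInv E) (linInv_lin E)

variable (A) in
/-- The module functor `X ↦ X ⊗_A E`. -/
@[reducible] noncomputable def modFun : ModFun C (RMod A) D where
  F := functor A E

/-- The projection `A ⊗ E ⟶ A ⊗_A E`. -/
noncomputable def πR : A.X ⊙ₗ E ⟶ obj E (RMod.ofBimod (Bimod.regular A)) :=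
  π E (RMod.ofBimod (Bimod.regular A))

/-- The action of `A` on `E` as a morphism `A ⊗_A E ⟶ E`. -/
noncomputable def regularHom : obj E (RMod.ofBimod (Bimod.regular A)) ⟶ E :=
  (show _ ⟶ A.X ⊙ₗ E from σ E (RMod.ofBimod (Bimod.regular A))) ≫ γ

instance : IsSplitEpi (πR (A := A) E) :=
  inferInstanceAs (IsSplitEpi (π E (RMod.ofBimod (Bimod.regular A))))

@[simp]
theorem πR_regularHom : πR (A := A) E ≫ regularHom E = γ :=
  π_σ E (RMod.ofBimod (Bimod.regular A)) (ModObj.smul (M := A.X) (X := E))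
    (ModObj.mul_smul (M := A.X) E)

@[simp]
theorem πR_regularHom_assoc {Z : D} (h : E ⟶ Z) :
    πR (A := A) E ≫ regularHom E ≫ h = γ ≫ h := by
  rw [← Category.assoc, πR_regularHom]

theorem mul_πR : (μ : A.X ⊗ A.X ⟶ A.X) ⊵ₗ E ≫ πR E =
    (αₗ A.X A.X E).hom ≫ A.X ⊴ₗ γ ≫ πR E := act_π E (RMod.ofBimod (Bimod.regular A))

/-- The isomorphism `A ⊗_A E ≅ E`. -/
noncomputable def regularIso : obj E (RMod.ofBimod (Bimod.regular A)) ≅ E where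
  hom := regularHom E
  inv := (λₗ E).inv ≫ (η : 𝟙_ C ⟶ A.X) ⊵ₗ E ≫ πR E
  hom_inv_id := by
    -- In elements: 1 ⊗ ae = 1a ⊗ e = a ⊗ e, by the balancing relation and the unit law.
    rw [← cancel_epi (πR (A := A) E), πR_regularHom_assoc, ← actionUnitIso_inv_naturality_assoc,
      reassoc_of% (action_exchange (η : 𝟙_ C ⟶ A.X) (γ : A.X ⊙ₗ E ⟶ E)), actionHomLeft_action]
    simp only [Category.assoc]
    rw [← mul_πR, ← comp_actionHomLeft_assoc, MonObj.one_mul, leftUnitor_actionHom]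
    simp
  inv_hom_id := by
    simp only [Category.assoc, πR_regularHom]
    rw [ModObj.one_smul, Iso.inv_hom_id]

variable (A) in
-- The isomorphism A ⊗_A E ≅ E is a ⊗ e ↦ ae, and its A-linearity is the associativity of the
-- action, tested on the epimorphism from A ⊗ (A ⊗ E).
theorem modFun_sendsRegularTo : SendsRegularTo (modFun A E) E := by
  refine ⟨regularIso E, ?_⟩
  change A.X ⊴ₗ regularHom E ≫ γ = (lin E A.X (RMod.ofBimod (Bimod.regular A)) ≫
    map E (RMod.leftAct (Bimod.regular A))) ≫ regularHom E
  let p : (A.X ⊗ A.X) ⊙ₗ E ⟶ obj E (A.X ⊙ₗ RMod.ofBimod (Bimod.regular A)) :=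
    πT E A.X (RMod.ofBimod (Bimod.regular A))
  have h1 : A.X ⊴ₗ πR E ≫ lin E A.X (RMod.ofBimod (Bimod.regular A)) =
    (αₗ A.X A.X E).inv ≫ p :=
    π_lin E A.X (RMod.ofBimod (Bimod.regular A))
  have h2 : p ≫ map E (RMod.leftAct (Bimod.regular A)) =
    (μ : A.X ⊗ A.X ⟶ A.X) ⊵ₗ E ≫ πR E := π_map E (RMod.leftAct (Bimod.regular A))
  have : Epi (A.X ⊴ₗ πR (A := A) E) :=
    inferInstanceAs (Epi (A.X ⊴ₗ π E (RMod.ofBimod (Bimod.regular A))))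
  rw [← cancel_epi (A.X ⊴ₗ πR (A := A) E), ← actionHomRight_comp_assoc, πR_regularHom,
    Category.assoc, reassoc_of% h1, reassoc_of% h2, πR_regularHom, ModObj.mul_smul]
  simp

end RelTensor

end RelTensor

end

section

/-! ### Internal homs and the right adjoint of the relative tensor product -/

universe v u v₁ u₁ v₂ u₂

/-- A `C`-module category with internal homs: all presheaves `Hom(- ⊗ E, N)` on `C` are
representable. -/
class ClosedAction (C : Type u) [Category.{v} C] [MonoidalCategory C]
    (D : Type u₁) [Category.{v₁} D] [MonoidalLeftAction C D] : Prop where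
  exists_internalHom : ∀ E N : D, ∃ (R : C) (ev : R ⊙ₗ E ⟶ N),
    ∀ X : C, Function.Bijective fun g : X ⟶ R => g ⊵ₗ E ≫ ev

section InternalHom

variable {C : Type u} [Category.{v} C] [MonoidalCategory C]
  {D : Type u₁} [Category.{v₁} D] [MonoidalLeftAction C D] [ClosedAction C D]

variable (C) in
/-- The internal hom `[E, N]`. -/
noncomputable def internalHom (E N : D) : C :=
  (ClosedAction.exists_internalHom (C := C) E N).choose

variable (C) in
/-- The evaluation `[E, N] ⊗ E ⟶ N`. -/
noncomputable def internalEv (E N : D) : internalHom C E N ⊙ₗ E ⟶ N :=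
  (ClosedAction.exists_internalHom (C := C) E N).choose_spec.choose

theorem internalEv_bijective (E N : D) (X : C) :
    Function.Bijective fun g : X ⟶ internalHom C E N => g ⊵ₗ E ≫ internalEv C E N :=
  (ClosedAction.exists_internalHom (C := C) E N).choose_spec.choose_spec X

theorem internalHom_ext {E N : D} {X : C} {g g' : X ⟶ internalHom C E N}
    (h : g ⊵ₗ E ≫ internalEv C E N = g' ⊵ₗ E ≫ internalEv C E N) : g = g' :=
  (internalEv_bijective E N X).1 h

/-- The morphism `X ⟶ [E, N]` corresponding to `X ⊗ E ⟶ N`. -/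
noncomputable def internalCurry {E N : D} {X : C} (f : X ⊙ₗ E ⟶ N) : X ⟶ internalHom C E N :=
  ((internalEv_bijective E N X).2 f).choose

@[simp]
theorem internalCurry_ev {E N : D} {X : C} (f : X ⊙ₗ E ⟶ N) :
    internalCurry f ⊵ₗ E ≫ internalEv C E N = f :=
  ((internalEv_bijective E N X).2 f).choose_spec

end InternalHom

namespace RelTensor

section

variable {C : Type u} [Category.{v} C] [MonoidalCategory C]
  {D : Type u₁} [Category.{v₁} D] [MonoidalLeftAction C D] [ClosedAction C D]

variable (A : Mon C) (E : D) [ModObj A.X E] (N : D)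

/-- The right action of `A` on `[E, N]`, for a left `A`-module `E`. -/
noncomputable def homAct : internalHom C E N ⊗ A.X ⟶ internalHom C E N :=
  internalCurry ((αₗ _ _ _).hom ≫ internalHom C E N ⊴ₗ γ ≫ internalEv C E N)

theorem homAct_ev : homAct A E N ⊵ₗ E ≫ internalEv C E N =
    (αₗ _ _ _).hom ≫ internalHom C E N ⊴ₗ γ ≫ internalEv C E N := internalCurry_ev _

variable {N} in
theorem whiskerRight_homAct_ev {Y : C} (g : Y ⟶ internalHom C E N) :
    (g ▷ A.X ≫ homAct A E N) ⊵ₗ E ≫ internalEv C E N =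
      (αₗ _ _ _).hom ≫ Y ⊴ₗ γ ≫ g ⊵ₗ E ≫ internalEv C E N := by
  rw [comp_actionHomLeft, Category.assoc, homAct_ev, whiskerRight_actionHomLeft]
  simp only [Category.assoc, Iso.inv_hom_id_assoc]
  rw [← reassoc_of% (action_exchange g (γ : A.X ⊙ₗ E ⟶ E))]

/-- The right `A`-module `[E, N]`, for a left `A`-module `E`. -/
noncomputable def homObj : RMod A where
  X := internalHom C E N
  act := homAct A E N
  act_one := by
    apply internalHom_ext
    rw [comp_actionHomLeft, Category.assoc, homAct_ev, whiskerLeft_actionHomLeft,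
      rightUnitor_actionHom, ← ModObj.one_smul (M := A.X) E, actionHomRight_comp]
    simp only [Category.assoc, Iso.inv_hom_id_assoc]
  act_assoc := by
    apply internalHom_ext
    have h := associator_actionHom (internalHom C E N) A.X A.X E
    rw [comp_actionHomLeft, Category.assoc, homAct_ev, whiskerLeft_actionHomLeft,
      comp_actionHomLeft, Category.assoc, Category.assoc, Category.assoc,
      whiskerRight_homAct_ev, homAct_ev]
    rw [← cancel_epi ((α_ (internalHom C E N) A.X A.X).hom ⊵ₗ E), hom_inv_actionHomLeft_assoc]
    simp only [Iso.inv_hom_id_assoc]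
    rw [← actionHomRight_comp_assoc, ModObj.mul_smul, actionHomRight_comp_assoc,
      actionHomRight_comp_assoc, reassoc_of% h]
    simp only [tensor_actionHomRight, Category.assoc, Iso.inv_hom_id_assoc]

variable {E N} in
-- Right linear morphisms into [E, N] are the transposes of balanced morphisms X ⊗ E ⟶ N. The
-- adjunction between - ⊗_A E and [E, -] rests on this.
theorem equivariant_iff (X : RMod A) (g : X.X ⟶ internalHom C E N) :
    X.act ≫ g = g ▷ A.X ≫ homAct A E N ↔
      X.act ⊵ₗ E ≫ g ⊵ₗ E ≫ internalEv C E N =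
        (αₗ _ _ _).hom ≫ X.X ⊴ₗ γ ≫ g ⊵ₗ E ≫ internalEv C E N := by
  rw [← whiskerRight_homAct_ev, ← comp_actionHomLeft_assoc]
  exact ⟨fun h => by rw [h], internalHom_ext⟩

end

variable {C : Type u} [Category.{v} C] [MonoidalCategory C] [Preadditive C] [Linear ℂ C]
  [MonoidalPreadditive C] [MonoidalLinear ℂ C]
  {D : Type u₁} [Category.{v₁} D] [Abelian D] [Linear ℂ D] [FiniteSemisimple D]
  [MonoidalLeftAction C D] [BilinearAction C D] [ClosedAction C D] (A : Mon C)
  (E : D) [ModObj A.X E]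

/-- The morphism in `C` underlying a morphism of right modules `X ⟶ [E, N]`. -/
def underlying {X : RMod A} {N : D} (g : X ⟶ homObj A E N) : X.X ⟶ internalHom C E N := g.hom

/-- Morphisms `X ⊗_A E ⟶ N` correspond to morphisms of right modules `X ⟶ [E, N]`. -/
noncomputable def homEquiv (X : RMod A) (N : D) : (obj E X ⟶ N) ≃ (X ⟶ homObj A E N) where
  toFun f := ⟨internalCurry (π E X ≫ f), (equivariant_iff A X _).2 (by
    rw [internalCurry_ev, act_π_assoc])⟩
  invFun g := σ E X ≫ underlying A E g ⊵ₗ E ≫ internalEv C E N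
  left_inv f := by
    rw [← cancel_epi (π E X)]
    change π E X ≫ σ E X ≫ internalCurry (C := C) (π E X ≫ f) ⊵ₗ E ≫ internalEv C E N = _
    rw [internalCurry_ev, σ_π_assoc]
  right_inv g := by
    apply RMod.hom_ext
    apply internalHom_ext
    refine (internalCurry_ev _).trans ?_
    exact π_σ E X _ ((equivariant_iff A X (underlying A E g)).1 g.act_hom)

variable {A} in
theorem underlying_homEquiv_ev {X : RMod A} {N : D} (f : obj E X ⟶ N) :
    underlying A E (homEquiv A E X N f) ⊵ₗ E ≫ internalEv C E N = π E X ≫ f :=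
  internalCurry_ev _

theorem homEquiv_naturality (X' X : RMod A) (N : D) (f : X' ⟶ X) (g : obj E X ⟶ N) :
    homEquiv A E X' N (map E f ≫ g) = f ≫ homEquiv A E X N g := by
  apply RMod.hom_ext
  apply internalHom_ext
  refine (underlying_homEquiv_ev E (map E f ≫ g)).trans ?_
  rw [π_map_assoc, ← underlying_homEquiv_ev]
  exact (comp_actionHomLeft_assoc _ _ _ _).symm

/-- The functor `N ↦ [E, N]` with values in right `A`-modules. -/
noncomputable def homFunctor : D ⥤ RMod A :=
  Adjunction.rightAdjointOfEquiv (F := functor A E) (homEquiv A E) (homEquiv_naturality A E)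

/-- The functor `- ⊗_A E` is left adjoint to `[E, -]`. -/
noncomputable def adj : functor A E ⊣ homFunctor A E :=
  Adjunction.adjunctionOfEquivRight (F := functor A E) (homEquiv A E) (homEquiv_naturality A E)

theorem adj_homEquiv (X : RMod A) (N : D) : (adj A E).homEquiv X N = homEquiv A E X N :=
  congrFun (congrFun (Adjunction.mkOfHomEquiv_homEquiv (F := functor A E) (G := homFunctor A E) _)
    X) N

end RelTensor

end

section

/-! ### Module categories as categories of modules over internal Ends -/

universe v u v₁ u₁ v₂ u₂

open Functor.LaxLeftLinear Functor.OplaxLeftLinear Functor.LeftLinear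

section Free

variable {C : Type u} [Category.{v} C] [MonoidalCategory C] [Preadditive C] [Linear ℂ C]
  [MonoidalPreadditive C] [MonoidalLinear ℂ C] {A : Mon C}

namespace RMod

variable (A) in
/-- The regular right `A`-module. -/
@[reducible] def regular : RMod A := ofBimod (Bimod.regular A)

/-- The action `X ⊗ A ⟶ X` as a morphism of right modules. -/
def freeAct (X : RMod A) : X.X ⊙ₗ regular A ⟶ X where
  hom := X.act
  act_hom := by
    change ((α_ X.X A.X A.X).hom ≫ X.X ◁ μ) ≫ X.act = _
    rw [Category.assoc, X.act_assoc]
    exact Iso.hom_inv_id_assoc _ _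

/-- The difference of the two maps `X ⊗ A ⊗ A ⟶ X ⊗ A`. -/
def freeDiff (X : RMod A) : X.X ⊙ₗ A.X ⊙ₗ regular A ⟶ X.X ⊙ₗ regular A :=
  X.X ⊴ₗ leftAct (Bimod.regular A) - (αₗ X.X A.X (regular A)).inv ≫ X.act ⊵ₗ regular A

theorem freeDiff_comp_eq_zero_iff (X : RMod A) {Y : RMod A} (h : X.X ⊙ₗ regular A ⟶ Y)
    (k : X.X ⊗ A.X ⟶ Y.X) (hk : k = h.hom) :
    freeDiff X ≫ h = 0 ↔ X.X ◁ (μ : A.X ⊗ A.X ⟶ A.X) ≫ k = (α_ _ _ _).inv ≫ X.act ▷ A.X ≫ k := by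
  subst hk
  rw [freeDiff, Preadditive.sub_comp, sub_eq_zero, Category.assoc]
  have h1 := actionHomRight_hom X.X (leftAct (Bimod.regular A))
  have h2 := actionHomLeft_hom X.act (regular A)
  constructor
  · intro e
    refine Eq.trans (congrArg (· ≫ h.hom) h1.symm) ((congrArg Hom.hom e).trans ?_)
    exact congrArg ((α_ _ _ _).inv ≫ · ≫ h.hom) h2
  · intro e
    apply hom_ext
    refine Eq.trans (congrArg (· ≫ h.hom) h1) (e.trans ?_)
    exact congrArg ((α_ _ _ _).inv ≫ · ≫ h.hom) h2.symm

theorem freeDiff_freeAct (X : RMod A) : freeDiff X ≫ freeAct X = 0 :=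
  (freeDiff_comp_eq_zero_iff X _ X.act rfl).2 X.act_assoc

/-- Inserting the unit of `A` splits the action in `C`. The splitting is not a morphism of right
modules, but it suffices for cancellation. -/
instance (X : RMod A) : Epi (freeAct X) where
  left_cancellation f g h := by
    apply hom_ext
    have e : X.act ≫ f.hom = X.act ≫ g.hom := congrArg Hom.hom h
    have e2 := congrArg (fun k => (ρ_ X.X).inv ≫ X.X ◁ η ≫ k) e
    simpa [reassoc_of% X.act_one] using e2

/-- `X` is the cokernel of `X ⊗ A ⊗ A ⟶ X ⊗ A`. -/
theorem exists_freeDesc (X : RMod A) {Y : RMod A} (h : X.X ⊙ₗ regular A ⟶ Y)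
    (w : freeDiff X ≫ h = 0) : ∃ h' : X ⟶ Y, freeAct X ≫ h' = h := by
  obtain ⟨k, hk⟩ : ∃ k : X.X ⊗ A.X ⟶ Y.X, k = h.hom := ⟨_, rfl⟩
  have w' := (freeDiff_comp_eq_zero_iff X h k hk).1 w
  have h2 : ((α_ X.X A.X A.X).hom ≫ X.X ◁ μ) ≫ k = k ▷ A.X ≫ Y.act := hk ▸ h.act_hom
  -- The descended morphism is x ↦ k(x ⊗ 1). The hypothesis on `h` gives k(xa ⊗ 1) = k(x ⊗ a), and
  -- k(x ⊗ a) = k(x ⊗ 1)a because `k` is right linear.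
  have h1 : X.act ≫ ((ρ_ X.X).inv ≫ X.X ◁ (η : 𝟙_ C ⟶ A.X) ≫ k) = k := by
    have e : X.act ≫ (ρ_ X.X).inv ≫ X.X ◁ (η : 𝟙_ C ⟶ A.X) =
        (ρ_ _).inv ≫ (X.X ⊗ A.X) ◁ (η : 𝟙_ C ⟶ A.X) ≫ X.act ▷ A.X := by
      rw [whisker_exchange, ← rightUnitor_inv_naturality_assoc]
    have w2 : X.act ▷ A.X ≫ k = (α_ _ _ _).hom ≫ X.X ◁ (μ : A.X ⊗ A.X ⟶ A.X) ≫ k := by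
      rw [w', Iso.hom_inv_id_assoc]
    have e2 : (ρ_ (X.X ⊗ A.X)).inv ≫ (X.X ⊗ A.X) ◁ (η : 𝟙_ C ⟶ A.X) ≫ (α_ _ _ _).hom ≫
        X.X ◁ (μ : A.X ⊗ A.X ⟶ A.X) = 𝟙 _ := by
      rw [associator_naturality_right_assoc, ← whiskerLeft_comp, MonObj.mul_one]
      simp
    rw [reassoc_of% e, w2, reassoc_of% e2]
  refine ⟨⟨(ρ_ X.X).inv ≫ X.X ◁ (η : 𝟙_ C ⟶ A.X) ≫ k, ?_⟩, hom_ext ?_⟩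
  · rw [h1, comp_whiskerRight, comp_whiskerRight, Category.assoc, Category.assoc, ← h2]
    have e3 : (ρ_ X.X).inv ▷ A.X ≫ (X.X ◁ (η : 𝟙_ C ⟶ A.X)) ▷ A.X ≫ (α_ _ _ _).hom ≫
        X.X ◁ (μ : A.X ⊗ A.X ⟶ A.X) = 𝟙 _ := by
      have : (X.X ◁ (η : 𝟙_ C ⟶ A.X)) ▷ A.X ≫ (α_ _ _ _).hom = (α_ _ _ _).hom ≫
        X.X ◁ ((η : 𝟙_ C ⟶ A.X) ▷ A.X) := by simp
      rw [reassoc_of% this, ← whiskerLeft_comp, MonObj.one_mul]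
      simp
    simp only [Category.assoc]
    rw [reassoc_of% e3]
  · exact h1.trans hk

end RMod

end Free

end

/-! ### The boundary category as the category of right modules over an internal End -/

section

universe v u v₁ u₁ v₂ u₂

open Limits Functor.LaxLeftLinear Functor.OplaxLeftLinear Functor.LeftLinear

section Equivalence

variable {C : Type u} [Category.{v} C] [MonoidalCategory C] [Preadditive C] [Linear ℂ C]
  [MonoidalPreadditive C] [MonoidalLinear ℂ C]

theorem RMod.isIso_of_isIso_hom {A : Mon C} {X Y : RMod A} (f : X ⟶ Y) (h : IsIso f.hom) :
    IsIso f := by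
  have : f = (RMod.mkIso (asIso f.hom) f.act_hom).hom := rfl
  rw [this]
  infer_instance

/-- Unit compatibility writes the unit at c ⊗ d as `c` acting on the unit at `d`, followed by
structure isomorphisms. -/
theorem ModFun.UnitComm.isIso_unit_action {D : Type u₁} [Category.{v₁} D] [Preadditive D]
    [Linear ℂ D] [MonoidalLeftAction C D] {E : Type u₂} [Category.{v₂} E] [Preadditive E]
    [Linear ℂ E] [MonoidalLeftAction C E] {F : ModFun C D E} {G : ModFun C E D}
    {adj : F.F ⊣ G.F} (h : UnitComm F G adj) (c : C) (d : D) [IsIso (adj.unit.app d)] :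
    IsIso (adj.unit.app (c ⊙ₗ d)) := by
  rw [h c d]
  have h2 : IsIso (c ⊴ₗ adj.unit.app d) := inferInstance
  have h3 : IsIso (μₗ G.F c (F.F.obj d)) := ⟨δₗ G.F _ _, μₗ_comp_δₗ _ _ _, δₗ_comp_μₗ _ _ _⟩
  have h4 : IsIso (μₗ F.F c d) := ⟨δₗ F.F _ _, μₗ_comp_δₗ _ _ _, δₗ_comp_μₗ _ _ _⟩
  exact IsIso.comp_isIso' h2 (IsIso.comp_isIso' h3 inferInstance)

/-- For an adjunction between additive functors, invertibility of the unit on free modules implies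
invertibility on all modules. -/
theorem RMod.isIso_unit_of_free {D : Type u₁} [Category.{v₁} D] [Abelian D] [Linear ℂ D]
    [FiniteSemisimple D] {A : Mon C} {T : RMod A ⥤ D} {G : D ⥤ RMod A} [T.Additive]
    (adj : T ⊣ G) (X : RMod A) (h₀ : IsIso (adj.unit.app (X.X ⊙ₗ regular A)))
    (h₁ : IsIso (adj.unit.app (X.X ⊙ₗ A.X ⊙ₗ regular A))) : IsIso (adj.unit.app X) := by
  have hG : G.Additive := adj.right_adjoint_additive
  have hT : Epi (T.map (freeAct X)) := by
    have := adj.leftAdjoint_preservesColimits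
    infer_instance
  -- The left adjoint `T` sends the free presentation of `X` to a presentation of T(X), which splits
  -- because `D` is semisimple. The morphism `s` found below is the splitting; `G` preserves it,
  -- being additive.
  obtain ⟨σ, t, hσ, ht⟩ := exists_cokernel_section (T.map (freeDiff X))
  obtain ⟨h', hh'⟩ := exists_freeDesc X
    (adj.homEquiv _ _ (cokernel.π (T.map (freeDiff X)))) (by
      rw [← adj.homEquiv_naturality_left, cokernel.condition, adj.homEquiv_unit, G.map_zero,
        comp_zero])
  have hψ : T.map (freeAct X) ≫ (adj.homEquiv _ _).symm h' = cokernel.π (T.map (freeDiff X)) := by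
    rw [← adj.homEquiv_naturality_left_symm, hh', Equiv.symm_apply_apply]
  obtain ⟨s, hs⟩ : ∃ s : T.obj X ⟶ T.obj (X.X ⊙ₗ regular A), T.map (freeAct X) ≫ s =
      𝟙 _ - t ≫ T.map (freeDiff X) :=
    ⟨(adj.homEquiv _ _).symm h' ≫ σ, by rw [reassoc_of% hψ, ht]⟩
  have hd : T.map (freeDiff X) ≫ T.map (freeAct X) = 0 := by
    rw [← T.map_comp, freeDiff_freeAct, T.map_zero]
  have hs' : s ≫ T.map (freeAct X) = 𝟙 _ := by
    rw [← cancel_epi (T.map (freeAct X)), reassoc_of% hs, Preadditive.sub_comp, Category.assoc,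
      hd, comp_zero, sub_zero, Category.id_comp, Category.comp_id]
  have n₁ := adj.unit_naturality (freeDiff X)
  have n₀ := adj.unit_naturality (freeAct X)
  -- The inverse lifts GT(X) to GT(X ⊗ A) by the splitting, inverts the unit on the free module and
  -- acts. The error term T(`freeDiff`) of the splitting is killed by naturality of the unit at X ⊗
  -- A ⊗ A.
  refine ⟨G.map s ≫ inv (adj.unit.app (X.X ⊙ₗ regular A)) ≫ freeAct X, ?_, ?_⟩
  · rw [← cancel_epi (freeAct X), ← reassoc_of% n₀, ← G.map_comp_assoc, hs, G.map_sub, G.map_id,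
      Preadditive.sub_comp, Preadditive.comp_sub, Category.id_comp, IsIso.hom_inv_id_assoc,
      G.map_comp, Category.assoc]
    have e : G.map (T.map (freeDiff X)) ≫ inv (adj.unit.app (X.X ⊙ₗ regular A)) ≫ freeAct X = 0 := by
      rw [← cancel_epi (adj.unit.app (X.X ⊙ₗ A.X ⊙ₗ regular A)), reassoc_of% n₁,
        IsIso.hom_inv_id_assoc, freeDiff_freeAct, comp_zero]
    rw [e]
    simp
  · rw [Category.assoc, Category.assoc, ← n₀, IsIso.inv_hom_id_assoc, ← G.map_comp, hs', G.map_id]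
    rfl

variable {D : Type u₁} [Category.{v₁} D] [Abelian D] [Linear ℂ D] [FiniteSemisimple D]
  [MonoidalLeftAction C D] [BilinearAction C D] {A : Mon C} (M : D) [ModObj A.X M]

namespace RelTensor

/-- The isomorphism `(X ⊗ A) ⊗_A M ≅ X ⊗ M`. -/
noncomputable def freeIso (X : C) : obj M (X ⊙ₗ RMod.regular A) ≅ X ⊙ₗ M where
  hom := linInv M X (RMod.regular A) ≫ X ⊴ₗ (regularIso M).hom
  inv := X ⊴ₗ (regularIso M).inv ≫ lin M X (RMod.regular A)
  hom_inv_id := by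
    rw [Category.assoc, ← actionHomRight_comp_assoc, Iso.hom_inv_id, actionHomRight_id,
      Category.id_comp, linInv_lin]
  inv_hom_id := by
    rw [Category.assoc, reassoc_of% (lin_linInv M X (RMod.regular A)), ← actionHomRight_comp,
      Iso.inv_hom_id, actionHomRight_id]

variable [ClosedAction C D]

theorem underlying_unit (X : RMod A) :
    underlying A M ((adj A M).unit.app X) ⊵ₗ M ≫ internalEv C M (obj M X) = π M X := by
  rw [← Adjunction.homEquiv_id, adj_homEquiv]
  exact (underlying_homEquiv_ev M (𝟙 (obj M X))).trans (Category.comp_id _)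

/-- Under Hom(X, [M, A ⊗_A M]) ≅ Hom(X ⊗ M, A ⊗_A M) ≅ Hom(X ⊗ M, M), composition with the unit
becomes the map Hom(X, A) ⟶ Hom(X ⊗ M, M) of the internal End. That map is bijective for every `X`,
and Yoneda concludes. -/
theorem isIso_unit_regular (hA : IsInternalEnd A M) :
    IsIso ((adj A M).unit.app (RMod.regular A)) := by
  apply RMod.isIso_of_isIso_hom
  let u : A.X ⟶ internalHom C M (obj M (RMod.regular A)) :=
    underlying A M ((adj A M).unit.app (RMod.regular A))
  have hu : u ⊵ₗ M ≫ internalEv C M (obj M (RMod.regular A)) = πR M :=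
    underlying_unit M (RMod.regular A)
  suffices h : IsIso u from h
  rw [isIso_iff_yoneda_map_bijective]
  intro X
  have h1 : Function.Bijective fun f : X ⟶ internalHom C M (obj M (RMod.regular A)) =>
      (f ⊵ₗ M ≫ internalEv C M _) ≫ (regularIso M).hom :=
    (((regularIso M).homToEquiv (Z := X ⊙ₗ M)).bijective).comp (internalEv_bijective M _ X)
  refine (Function.Bijective.of_comp_iff' h1 _).1 ?_
  convert hA X using 1
  funext f
  change ((f ≫ u) ⊵ₗ M ≫ _) ≫ regularHom M = _
  rw [comp_actionHomLeft, Category.assoc, Category.assoc, reassoc_of% hu, πR_regularHom]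

variable [RightRigidCategory C]

/-- The free modules X ⊗ A and X ⊗ A ⊗ A arise from the regular module by one and two applications
of the action of `C`. Right duals enter because they make [M, -] a module functor. -/
theorem isIso_unit (hA : IsInternalEnd A M) (X : RMod A) : IsIso ((adj A M).unit.app X) := by
  have h := isIso_unit_regular M hA
  have h' := fun (c : C) (Y : RMod A) (hY : IsIso ((adj A M).unit.app Y)) =>
    (ModFun.rightAdjoint_unitComm (modFun A M) (adj A M)).isIso_unit_action c Y
  exact RMod.isIso_unit_of_free (adj A M) X (h' _ _ h) (h' _ _ (h' _ _ h))

theorem isEquivalence_functor (hM : IsGenerator C M) (hA : IsInternalEnd A M) :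
    (functor A M).IsEquivalence := by
  have hu := isIso_unit M hA
  have hG : (homFunctor A M).Additive := (adj A M).right_adjoint_additive
  -- A triangle identity with invertible unit.
  have hGε (n : D) : IsIso ((homFunctor A M).map ((adj A M).counit.app n)) :=
    have := hu ((homFunctor A M).obj n)
    IsIso.of_isIso_fac_left ((adj A M).right_triangle_components n)
  -- The generator hypothesis, stated for the objects (X ⊗ A) ⊗_A M ≅ X ⊗ M, whose outgoing
  -- morphisms can be transposed.
  have key (n k : D) (hk : ∀ (X : C) (g : obj M (X ⊙ₗ RMod.regular A) ⟶ k), g = 0) : IsZero k := by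
    by_contra h
    obtain ⟨X, f, hf⟩ := hM k h
    refine hf ?_
    rw [← cancel_epi (freeIso (A := A) M X).hom, hk X ((freeIso M X).hom ≫ f), comp_zero]
  have hε (n : D) : IsIso ((adj A M).counit.app n) := by
    have hm : Mono ((adj A M).counit.app n) := by
      refine Preadditive.mono_of_isZero_kernel _ (key n _ fun X g => ?_)
      rw [← cancel_mono (kernel.ι _), zero_comp]
      apply ((adj A M).homEquiv _ _).injective
      rw [← cancel_mono ((homFunctor A M).map ((adj A M).counit.app n)),
        ← (adj A M).homEquiv_naturality_right, ← (adj A M).homEquiv_naturality_right]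
      simp
    -- A morphism from (X ⊗ A) ⊗_A M to the cokernel lifts to `n` along the section; the lift
    -- factors through the counit, so it dies in the cokernel.
    have he : Epi ((adj A M).counit.app n) := by
      refine Preadditive.epi_of_isZero_cokernel _ (key n _ fun X g => ?_)
      have h1 := (adj A M).homEquiv_counit _ _ ((adj A M).homEquiv _ _ (g ≫ cokernelSection _))
      rw [Equiv.symm_apply_apply] at h1
      have h2 := congrArg (· ≫ cokernel.π ((adj A M).counit.app n)) h1
      simpa using h2
    exact isIso_of_mono_of_epi _
  have hu' : IsIso (adj A M).unit := NatIso.isIso_of_isIso_app _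
  have hε' : IsIso (adj A M).counit := NatIso.isIso_of_isIso_app _
  exact (adj A M).toEquivalence.isEquivalence_functor

end RelTensor

end Equivalence

end

section

/-! ### Evaluation of module functors at a generator -/

universe v u v₁ u₁ v₂ u₂

open Functor.LaxLeftLinear Functor.OplaxLeftLinear Functor.LeftLinear

section Transfer

variable {C : Type u} [Category.{v} C] [MonoidalCategory C]
  {D : Type u₁} [Category.{v₁} D] [Preadditive D] [Linear ℂ D] [MonoidalLeftAction C D]
  {E : Type u₂} [Category.{v₂} E] [Preadditive E] [Linear ℂ E] [MonoidalLeftAction C E]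

namespace ModFun

/-- The image under a module functor of an object with an action of `A`. -/
@[reducible] def modObj (F : ModFun C D E) (A : Mon C) (M : D) [ModObj A.X M] :
    ModObj A.X (F.F.obj M) where
  smul := F.objAct A M
  one_smul := by
    rw [objAct, μₗ_naturality_left_assoc, ← F.F.map_comp, ModObj.one_smul, μₗ_unitality]
  mul_smul := by
    rw [objAct, μₗ_naturality_left_assoc, ← F.F.map_comp, ModObj.mul_smul, F.F.map_comp,
      μₗ_associativity_assoc, F.F.map_comp, actionHomRight_comp, Category.assoc,
      μₗ_naturality_right_assoc]

variable {F G : ModFun C D E} {M : D}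

variable (F G) in
/-- The morphism `F(c ⊗ M) ⟶ G(c ⊗ M)` induced by `φ : F(M) ⟶ G(M)`. -/
def transfer (φ : F.F.obj M ⟶ G.F.obj M) (c : C) : F.F.obj (c ⊙ₗ M) ⟶ G.F.obj (c ⊙ₗ M) :=
  δₗ F.F c M ≫ c ⊴ₗ φ ≫ μₗ G.F c M

variable (φ : F.F.obj M ⟶ G.F.obj M)

theorem transfer_naturality {c c' : C} (f : c ⟶ c') :
    F.F.map (f ⊵ₗ M) ≫ transfer F G φ c' = transfer F G φ c ≫ G.F.map (f ⊵ₗ M) := by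
  simp only [transfer, Category.assoc]
  rw [← μₗ_naturality_left, δₗ_naturality_left_assoc,
    reassoc_of% (action_exchange f φ)]

/-- Associativity of the structure morphisms of `F` and `G`. It is the reason why a transformation
assembled from `transfer` respects the action of `C`. -/
theorem transfer_action (c c' : C) :
    μₗ F.F c (c' ⊙ₗ M) ≫ F.F.map (αₗ c c' M).inv ≫ transfer F G φ (c ⊗ c') ≫
      G.F.map (αₗ c c' M).hom = c ⊴ₗ transfer F G φ c' ≫ μₗ G.F c (c' ⊙ₗ M) := by
  simp only [transfer, Category.assoc, actionHomRight_comp]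
  rw [μₗ_associativity, tensor_actionHomRight]
  have h : μₗ F.F c (c' ⊙ₗ M) ≫ F.F.map (αₗ c c' M).inv ≫ δₗ F.F (c ⊗ c') M =
      c ⊴ₗ δₗ F.F c' M ≫ (αₗ c c' (F.F.obj M)).inv := by
    rw [← cancel_epi (δₗ F.F c (c' ⊙ₗ M)), δₗ_comp_μₗ_assoc]
    exact (δₗ_associativity_inv F.F _ _ _).symm
  rw [reassoc_of% h]
  simp

theorem transfer_unit :
    F.F.map (λₗ M).inv ≫ transfer F G φ (𝟙_ C) ≫ G.F.map (λₗ M).hom = φ := by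
  simp only [transfer, Category.assoc]
  rw [← μₗ_unitality, ← actionUnitIso_hom_naturality, ← δₗ_unitality_inv_assoc]
  simp

/-- A module transformation has no freedom on c ⊗ M once its value at `M` is known; this is the
source of uniqueness. -/
theorem transfer_app (α : F ⟶ G) (c : C) :
    transfer F G (α.nat.app M) c = α.nat.app (c ⊙ₗ M) := by
  rw [transfer, ← α.comm, δₗ_comp_μₗ_assoc]

/-- The morphism `φ` extends to a transformation of module functors, provided that it extends
pointwise. -/
theorem exists_of_transfer (α : ∀ n : D, F.F.obj n ⟶ G.F.obj n)
    (hα : ∀ (n : D) (c : C) (f : c ⊙ₗ M ⟶ n),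
      F.F.map f ≫ α n = transfer F G φ c ≫ G.F.map f)
    (r : ∀ n : D, ∃ (c : C) (f : c ⊙ₗ M ⟶ n), IsSplitEpi f) :
    ∃ β : F ⟶ G, β.nat.app M = φ := by
  -- Naturality is tested on a cover f : c ⊗ M ⟶ n. As `f` is split, F(f) is still epi, and `hα`
  -- applies to both f and fg.
  have hn {n n' : D} (g : n ⟶ n') : F.F.map g ≫ α n' = α n ≫ G.F.map g := by
    obtain ⟨c, f, hf⟩ := r n
    rw [← cancel_epi (F.F.map f), ← F.F.map_comp_assoc, hα, G.F.map_comp,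
      ← Category.assoc, ← Category.assoc, hα]
  refine ⟨⟨⟨α, fun _ _ g => hn g⟩, fun c n => ?_⟩, ?_⟩
  -- Likewise `c` acting on F(f) is split epi, and on this cover the claim is `transfer_action`.
  · obtain ⟨c', f, hf⟩ := r n
    have : IsSplitEpi (c ⊴ₗ F.F.map f) :=
      ⟨⟨c ⊴ₗ F.F.map (section_ f), by rw [← actionHomRight_comp, ← F.F.map_comp]; simp⟩⟩
    rw [← cancel_epi (c ⊴ₗ F.F.map f), μₗ_naturality_right_assoc,
      ← actionHomRight_comp_assoc, hα, actionHomRight_comp, Category.assoc,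
      μₗ_naturality_right, ← reassoc_of% (transfer_action φ c c'), ← G.F.map_comp, ← hα,
      F.F.map_comp]
    simp only [Category.assoc]
    rw [← F.F.map_comp_assoc, Iso.inv_hom_id, F.F.map_id, Category.id_comp]
  · have h := hα M (𝟙_ C) (λₗ M).hom
    change α M = φ
    rw [← transfer_unit φ, ← h, ← F.F.map_comp_assoc]
    simp

theorem ext_of_cover (r : ∀ n : D, ∃ (c : C) (f : c ⊙ₗ M ⟶ n), IsSplitEpi f) {α β : F ⟶ G}
    (h : α.nat.app M = β.nat.app M) : α = β := by
  apply hom_ext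
  ext n
  obtain ⟨c, f, hf⟩ := r n
  rw [← cancel_epi (F.F.map f), α.nat.naturality, β.nat.naturality, ← transfer_app, h,
    transfer_app]

/-- The compatibility of `transfer` with the actions of `A`, for an `A`-linear morphism `φ`. -/
theorem transfer_act {A : Mon C} [ModObj A.X M]
    (hφ : F.objAct A M ≫ φ = A.X ⊴ₗ φ ≫ G.objAct A M) (c : C) :
    F.F.map (c ⊴ₗ γ) ≫ transfer F G φ c = F.F.map (αₗ c A.X M).inv ≫
      transfer F G φ (c ⊗ A.X) ≫ G.F.map (αₗ c A.X M).hom ≫ G.F.map (c ⊴ₗ γ) := by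
  have h : F.F.map (γ : A.X ⊙ₗ M ⟶ M) ≫ φ = transfer F G φ A.X ≫ G.F.map γ := by
    simp only [objAct, Category.assoc] at hφ
    rw [transfer, Category.assoc, Category.assoc, ← hφ, δₗ_comp_μₗ_assoc]
  rw [transfer, reassoc_of% (δₗ_naturality_right F.F c (γ : A.X ⊙ₗ M ⟶ M)), ← actionHomRight_comp_assoc, h,
    actionHomRight_comp_assoc, μₗ_naturality_right, ← reassoc_of% (transfer_action φ c A.X),
    δₗ_comp_μₗ_assoc]

end ModFun

end Transfer

/-! ### Extending A-linear morphisms from the generator -/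

section Extension

variable {C : Type u} [Category.{v} C] [MonoidalCategory C] [Preadditive C] [Linear ℂ C]
  [MonoidalPreadditive C] [MonoidalLinear ℂ C]
  {D : Type u₁} [Category.{v₁} D] [Abelian D] [Linear ℂ D] [FiniteSemisimple D]
  [MonoidalLeftAction C D] [BilinearAction C D] [ClosedAction C D]
  {E : Type u₂} [Category.{v₂} E] [Preadditive E] [Linear ℂ E] [MonoidalLeftAction C E]
  (A : Mon C) {M : D} [ModObj A.X M]

namespace RelTensor

variable (M) in
-- The counit is evaluation descended to [M, n] ⊗_A M. Once it is invertible, evaluation presents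
-- `n` as a split cokernel.
theorem π_counit (n : D) :
    π M (homObj A M n) ≫ (show obj M (homObj A M n) ⟶ n from (adj A M).counit.app n) =
      internalEv C M n := by
  rw [← underlying_homEquiv_ev, ← adj_homEquiv]
  refine Eq.trans ?_ ((congrArg (· ≫ _) (id_actionHomLeft _ _)).trans (Category.id_comp _))
  exact congrArg (fun g => underlying A M g ⊵ₗ M ≫ internalEv C M n)
    ((((adj A M).homEquiv _ n).symm_apply_eq).1 ((adj A M).homEquiv_symm_id n)).symm

variable (M) in
theorem isSplitEpi_internalEv [(functor A M).IsEquivalence] (n : D) :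
    IsSplitEpi (internalEv C M n) := by
  let ε : obj M (homObj A M n) ⟶ n := (adj A M).counit.app n
  have : IsIso ε := inferInstanceAs (IsIso ((adj A M).counit.app n))
  rw [← π_counit A]
  exact inferInstanceAs (IsSplitEpi (π M (homObj A M n) ≫ ε))

/-- Morphisms out of `F([M, n] ⊗ M)` that coequalize the two actions of `A` descend to `F(n)`. -/
theorem exists_desc_internalEv [(functor A M).IsEquivalence] (F : D ⥤ E) [F.Additive] (n : D)
    {Z : E} (h : F.obj (internalHom C M n ⊙ₗ M) ⟶ Z)
    (w : F.map (homAct A M n ⊵ₗ M) ≫ h =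
      F.map (αₗ _ _ _).hom ≫ F.map (internalHom C M n ⊴ₗ γ) ≫ h) :
    ∃ k : F.obj n ⟶ Z, F.map (internalEv C M n) ≫ k = h := by
  let ε : obj M (homObj A M n) ⟶ n := (adj A M).counit.app n
  have : IsIso ε := inferInstanceAs (IsIso ((adj A M).counit.app n))
  refine ⟨F.map (inv ε) ≫ F.map (σ M (homObj A M n)) ≫ h, ?_⟩
  rw [← π_counit A]
  change F.map (π M (homObj A M n) ≫ ε) ≫ _ = _
  rw [F.map_comp, Category.assoc, ← F.map_comp_assoc ε, IsIso.hom_inv_id, F.map_id,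
    Category.id_comp]
  exact map_π_σ M F (homObj A M n) h w

end RelTensor

namespace ModFun

variable {A} {F G : ModFun C D E}

variable (A) in
theorem ext_of_app [(RelTensor.functor A M).IsEquivalence] {α β : F ⟶ G} (h : α.nat.app M = β.nat.app M) : α = β :=
  ext_of_cover (fun n => ⟨_, _, RelTensor.isSplitEpi_internalEv A M n⟩) h

/-- On [M, n] ⊗ M the extension must be `transfer`. Linearity of `φ` (`transfer_act`) shows that
this, followed by G of the evaluation, is balanced, so it descends to F(n). Any c ⊗ M ⟶ n factors
through the evaluation by its transpose, which gives the condition of `exists_of_transfer`. -/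
theorem exists_app_eq [(RelTensor.functor A M).IsEquivalence] (φ : F.F.obj M ⟶ G.F.obj M)
    (hφ : F.objAct A M ≫ φ = A.X ⊴ₗ φ ≫ G.objAct A M) :
    ∃ α : F ⟶ G, α.nat.app M = φ := by
  have key (n : D) : ∃ k : F.F.obj n ⟶ G.F.obj n, F.F.map (internalEv C M n) ≫ k =
      transfer F G φ _ ≫ G.F.map (internalEv C M n) := by
    refine RelTensor.exists_desc_internalEv A F.F n _ ?_
    rw [reassoc_of% (transfer_naturality φ (RelTensor.homAct A M n)),
      reassoc_of% (transfer_act φ hφ), ← F.F.map_comp_assoc, Iso.hom_inv_id, F.F.map_id,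
      Category.id_comp, ← G.F.map_comp, RelTensor.homAct_ev, G.F.map_comp, G.F.map_comp]
  choose k hk using key
  refine exists_of_transfer φ k (fun n c f => ?_)
    (fun n => ⟨_, _, RelTensor.isSplitEpi_internalEv A M n⟩)
  conv_lhs => rw [← internalCurry_ev f, F.F.map_comp, Category.assoc, hk,
    reassoc_of% (transfer_naturality φ (internalCurry f)), ← G.F.map_comp, internalCurry_ev]

end ModFun

end Extension

end

/-! ### The evaluation functor with values in bimodules -/

section

universe v u v₁ u₁ v₂ u₂

open Functor.LaxLeftLinear Functor.OplaxLeftLinear Functor.LeftLinear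

section Evaluation

variable {C : Type u} [Category.{v} C] [MonoidalCategory C] [Preadditive C] [Linear ℂ C]
  [MonoidalPreadditive C] [MonoidalLinear ℂ C] {A B : Mon C}

namespace RMod

/-- The bimodule given by an `A`-module in the category of right `B`-modules. -/
@[reducible] def toBimod (X : RMod B) (m : ModObj A.X X) : Bimod A B where
  X := X.X
  actLeft := m.smul.hom
  one_actLeft := by
    rw [← actionHomLeft_hom]
    exact congrArg Hom.hom m.one_smul
  left_assoc := by
    rw [← actionHomLeft_hom]
    refine (congrArg Hom.hom m.mul_smul).trans ?_
    exact congrArg (fun g => (α_ A.X A.X X.X).hom ≫ g ≫ m.smul.hom) (actionHomRight_hom A.X m.smul)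
  actRight := X.act
  actRight_one := X.act_one
  right_assoc := X.act_assoc
  middle_assoc := m.smul.act_hom.symm.trans (Category.assoc _ _ _)

/-- The action of `A` on a bimodule, regarded as a right `B`-module. -/
@[reducible] def leftModObj (Y : Bimod A B) : ModObj A.X (ofBimod Y) where
  smul := leftAct Y
  one_smul := hom_ext <| by
    refine Eq.trans ?_ Y.one_actLeft
    exact congrArg (· ≫ Y.actLeft) (actionHomLeft_hom η (ofBimod Y))
  mul_smul := hom_ext <| by
    refine Eq.trans (congrArg (· ≫ Y.actLeft) (actionHomLeft_hom μ (ofBimod Y))) ?_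
    refine Y.left_assoc.trans ?_
    exact (congrArg (fun g => (α_ A.X A.X Y.X).hom ≫ g ≫ Y.actLeft)
      (actionHomRight_hom A.X (leftAct Y))).symm

/-- An `A`-linear morphism of right `B`-modules is a morphism of bimodules. -/
def toBimodHom {X Y : Bimod A B} (f : ofBimod X ⟶ ofBimod Y)
    (h : leftAct X ≫ f = A.X ⊴ₗ f ≫ leftAct Y) : X ⟶ Y where
  hom := f.hom
  left_act_hom := (congrArg Hom.hom h).trans
    (congrArg (· ≫ Y.actLeft) (actionHomRight_hom A.X f))
  right_act_hom := f.act_hom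

theorem leftAct_ofBimodMap {X Y : Bimod A B} (f : X ⟶ Y) :
    leftAct X ≫ ofBimodMap f = A.X ⊴ₗ ofBimodMap f ≫ leftAct Y :=
  hom_ext <| f.left_act_hom.trans
    (congrArg (· ≫ Y.actLeft) (actionHomRight_hom A.X (ofBimodMap f))).symm

/-- An `A`-linear isomorphism of right `B`-modules is an isomorphism of bimodules. -/
def toBimodIso {X Y : Bimod A B} (f : ofBimod X ≅ ofBimod Y)
    (h : leftAct X ≫ f.hom = A.X ⊴ₗ f.hom ≫ leftAct Y) : X ≅ Y where
  hom := toBimodHom f.hom h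
  inv := toBimodHom f.inv (by
    rw [← cancel_mono f.hom, Category.assoc, Category.assoc, f.inv_hom_id, h,
      ← actionHomRight_comp_assoc, f.inv_hom_id, actionHomRight_id, Category.id_comp,
      Category.comp_id])
  hom_inv_id := Bimod.hom_ext _ _ (congrArg Hom.hom f.hom_inv_id)
  inv_hom_id := Bimod.hom_ext _ _ (congrArg Hom.hom f.inv_hom_id)

end RMod

variable {D : Type u₁} [Category.{v₁} D] [Preadditive D] [Linear ℂ D] [MonoidalLeftAction C D]
  {E : Type u₂} [Category.{v₂} E] [Preadditive E] [Linear ℂ E] [MonoidalLeftAction C E]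

namespace ModFun

theorem objAct_app {F G : ModFun C D E} (f : F ⟶ G) (A : Mon C) (M : D) [ModObj A.X M] :
    F.objAct A M ≫ f.nat.app M = A.X ⊴ₗ f.nat.app M ≫ G.objAct A M := by
  rw [objAct, objAct, Category.assoc, f.nat.naturality, reassoc_of% (f.comm A.X M)]

theorem map_linear (F : ModFun C D E) {c : C} {d d' : D} {a : c ⊙ₗ d ⟶ d} {a' : c ⊙ₗ d' ⟶ d'}
    {f : d ⟶ d'} (h : a ≫ f = c ⊴ₗ f ≫ a') :
    (μₗ F.F c d ≫ F.F.map a) ≫ F.F.map f = c ⊴ₗ F.F.map f ≫ μₗ F.F c d' ≫ F.F.map a' := by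
  rw [μₗ_naturality_right_assoc, Category.assoc, ← F.F.map_comp, h, F.F.map_comp]

theorem linear_of_map_linear (F : ModFun C D E) [F.F.Faithful] {c : C} {d d' : D}
    {a : c ⊙ₗ d ⟶ d} {a' : c ⊙ₗ d' ⟶ d'} {f : d ⟶ d'}
    (h : (μₗ F.F c d ≫ F.F.map a) ≫ F.F.map f = c ⊴ₗ F.F.map f ≫ μₗ F.F c d' ≫ F.F.map a') :
    a ≫ f = c ⊴ₗ f ≫ a' := by
  apply F.F.map_injective
  rw [← cancel_epi (μₗ F.F c d), F.F.map_comp, F.F.map_comp, ← μₗ_naturality_right_assoc, ← h,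
    Category.assoc]

/-- Naturality of the unit together with unit compatibility. This and its counit analogue carry
actions of `A` back and forth between E and C_B. -/
theorem UnitComm.unit_linear {F : ModFun C D E} {G : ModFun C E D} {adj : F.F ⊣ G.F}
    (h : UnitComm F G adj) {c : C} {d : D} (a : c ⊙ₗ d ⟶ d) : a ≫ adj.unit.app d =
      c ⊴ₗ adj.unit.app d ≫ μₗ G.F c (F.F.obj d) ≫ G.F.map (μₗ F.F c d ≫ F.F.map a) := by
  have h1 := adj.unit_naturality a
  rw [G.F.map_comp, ← h1, h c d]
  simp only [Category.assoc]

theorem CounitComm.counit_linear {F : ModFun C D E} {G : ModFun C E D} {adj : F.F ⊣ G.F}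
    (h : CounitComm F G adj) {c : C} {e : E} (a : c ⊙ₗ e ⟶ e) : c ⊴ₗ adj.counit.app e ≫ a =
      (μₗ F.F c (G.F.obj e) ≫ F.F.map (μₗ G.F c e ≫ G.F.map a)) ≫ adj.counit.app e := by
  have h1 : F.F.map (G.F.map a) ≫ adj.counit.app e = adj.counit.app (c ⊙ₗ e) ≫ a :=
    adj.counit_naturality a
  have h2 := (reassoc_of% (h c e)) a
  rw [F.F.map_comp, Category.assoc, Category.assoc, h1]
  refine Eq.trans ?_ (congrArg (μₗ F.F c (G.F.obj e) ≫ ·) h2.symm)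
  exact (μₗ_comp_δₗ_assoc F.F c (G.F.obj e) (c ⊴ₗ adj.counit.app e ≫ a)).symm

variable (M : D) [ModObj A.X M] (R : ModFun C E (RMod B))

/-- The bimodule `R(F(M))`. -/
@[reducible] def evalObj (F : ModFun C D E) : Bimod A B :=
  RMod.toBimod (R.F.obj (F.F.obj M))
    (@modObj _ _ _ _ _ _ _ _ _ _ _ _ _ R A (F.F.obj M) (F.modObj A M))

/-- The functor `F ↦ R(F(M))`. -/
@[reducible] def evalFunctor [BilinearAction C E] : ModFun C D E ⥤ Bimod A B where
  obj F := evalObj M R F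
  map {F G} f := RMod.toBimodHom (X := evalObj M R F) (Y := evalObj M R G)
    (R.F.map (f.nat.app M))
    (map_linear R (objAct_app f A M))
  map_id F := Bimod.hom_ext _ _ (congrArg RMod.Hom.hom (R.F.map_id (F.F.obj M)))
  map_comp f g := Bimod.hom_ext _ _
    (congrArg RMod.Hom.hom (R.F.map_comp (f.nat.app M) (g.nat.app M)))

theorem evalFunctor_additive [BilinearAction C E] : (evalFunctor (A := A) (D := D) M R).Additive where
  map_add {F G f g} := Bimod.hom_ext _ _
    (congrArg RMod.Hom.hom (R.F.map_add (f := f.nat.app M) (g := g.nat.app M)))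

theorem evalFunctor_linear [BilinearAction C E] : (evalFunctor (A := A) (D := D) M R).Linear ℂ where
  map_smul f z := Bimod.hom_ext _ _
    (congrArg RMod.Hom.hom (R.F.map_smul z (f.nat.app M)))

variable {R} {Q : ModFun C (RMod B) E} {adj : Q.F ⊣ R.F}

/-- The required isomorphisms Q(R(F(M))) ≅ F(M) are the components of the counit. -/
theorem evalFunctor_isEvaluation [BilinearAction C E] [Q.F.IsEquivalence]
    (h : UnitComm Q R adj) : IsEvaluation M Q (evalFunctor (A := A) (D := D) M R) := by
  refine ⟨fun F => (asIso adj.counit).app (F.F.obj M), fun F G f => ?_, fun F => ?_⟩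
  · exact (adj.counit.naturality (f.nat.app M)).symm
  · exact h.counitComm.counit_linear (F.objAct A M)

variable [BilinearAction C E]

/-- A bimodule morphism comes from some F(M) ⟶ G(M) because `R` is full. Its A-linearity is
reflected by the faithful functor `R`, and `hM` then extends it to a transformation. -/
theorem evalFunctor_full [Q.F.IsEquivalence] (adj : Q.F ⊣ R.F)
    (hM : ∀ (F G : ModFun C D E) (φ : F.F.obj M ⟶ G.F.obj M),
      F.objAct A M ≫ φ = A.X ⊴ₗ φ ≫ G.objAct A M → ∃ α : F ⟶ G, α.nat.app M = φ) :
    (evalFunctor (A := A) (D := D) M R).Full where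
  map_surjective {F G} g := by
    have : R.F.IsEquivalence := adj.isEquivalence_right_of_isEquivalence_left
    obtain ⟨φ, hφ⟩ : ∃ φ : F.F.obj M ⟶ G.F.obj M, R.F.map φ = RMod.ofBimodMap g :=
      R.F.map_surjective _
    obtain ⟨α, hα⟩ := hM F G φ (linear_of_map_linear R (by
      rw [hφ]
      exact RMod.leftAct_ofBimodMap g))
    refine ⟨α, Bimod.hom_ext _ _ ?_⟩
    exact congrArg RMod.Hom.hom ((congrArg R.F.map hα).trans hφ)

theorem evalFunctor_faithful [Q.F.IsEquivalence] (adj : Q.F ⊣ R.F)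
    (hM : ∀ (F G : ModFun C D E) (α β : F ⟶ G), α.nat.app M = β.nat.app M → α = β) :
    (evalFunctor (A := A) (D := D) M R).Faithful where
  map_injective {F G α β} h := by
    have : R.F.IsEquivalence := adj.isEquivalence_right_of_isEquivalence_left
    refine hM F G α β (R.F.map_injective (RMod.hom_ext ?_))
    exact congrArg Bimod.Hom.hom h

/-- A module functor whose value at `M` is the bimodule `Y` under `Q` is sent to `Y`. -/
theorem evalFunctor_obj_iso [Q.F.IsEquivalence] (h : UnitComm Q R adj) (Y : Bimod A B)
    (F : ModFun C D E) (i : F.F.obj M ≅ Q.F.obj (RMod.ofBimod Y))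
    (hi : F.objAct A M ≫ i.hom = A.X ⊴ₗ i.hom ≫ bimodAct Q Y) :
    Nonempty ((evalFunctor (A := A) (D := D) M R).obj F ≅ Y) := by
  have hi' : bimodAct Q Y ≫ i.inv = A.X ⊴ₗ i.inv ≫ F.objAct A M := by
    rw [← cancel_mono i.hom, Category.assoc, Category.assoc, i.inv_hom_id, hi,
      ← actionHomRight_comp_assoc, i.inv_hom_id, actionHomRight_id, Category.id_comp,
      Category.comp_id]
  have hu := h.unit_linear (RMod.leftAct Y)
  have h2 := map_linear R hi'
  let e : RMod.ofBimod Y ≅ R.F.obj (F.F.obj M) :=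
    (asIso adj.unit).app (RMod.ofBimod Y) ≪≫ R.F.mapIso i.symm
  refine ⟨(RMod.toBimodIso (X := Y) (Y := evalObj M R F) e ?_).symm⟩
  refine Eq.trans (Category.assoc _ _ _).symm ((congrArg (· ≫ R.F.map i.inv) hu).trans ?_)
  refine (Category.assoc _ _ _).trans ((congrArg (_ ≫ ·) h2).trans ?_)
  refine (Category.assoc _ _ _).symm.trans (congrArg (· ≫ _) ?_)
  exact (actionHomRight_comp A.X (adj.unit.app (RMod.ofBimod Y)) (R.F.map i.inv)).symm

end ModFun


end Evaluation

end

/-! ### Evaluation at a generator is an equivalence -/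

section

universe v u v₁ u₁ v₂ u₂

open Functor.LaxLeftLinear Functor.OplaxLeftLinear Functor.LeftLinear

section LinearMaps

variable {C : Type u} [Category.{v} C] [MonoidalCategory C]
  {D : Type u₁} [Category.{v₁} D] [MonoidalLeftAction C D] {c : C} {d d' d'' : D}
  {a : c ⊙ₗ d ⟶ d} {a' : c ⊙ₗ d' ⟶ d'} {a'' : c ⊙ₗ d'' ⟶ d''}

theorem linear_comp {f : d ⟶ d'} {g : d' ⟶ d''} (hf : a ≫ f = c ⊴ₗ f ≫ a')
    (hg : a' ≫ g = c ⊴ₗ g ≫ a'') : a ≫ f ≫ g = c ⊴ₗ (f ≫ g) ≫ a'' := by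
  rw [reassoc_of% hf, hg, actionHomRight_comp_assoc]

theorem linear_inv (e : d ≅ d') (h : a ≫ e.hom = c ⊴ₗ e.hom ≫ a') :
    a' ≫ e.inv = c ⊴ₗ e.inv ≫ a := by
  rw [← cancel_mono e.hom, Category.assoc, Category.assoc, e.inv_hom_id, h,
    ← actionHomRight_comp_assoc, e.inv_hom_id, actionHomRight_id, Category.id_comp,
    Category.comp_id]

end LinearMaps

section EvaluationEquivalence

variable {C : Type u} [Category.{v} C] [MonoidalCategory C] [Preadditive C] [Linear ℂ C]
  [MonoidalPreadditive C] [MonoidalLinear ℂ C] {A B : Mon C}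

theorem SendsRegularTo.exists_iso {D : Type u₁} [Category.{v₁} D] [Preadditive D] [Linear ℂ D]
    [MonoidalLeftAction C D] {P : ModFun C (RMod A) D} {R : ModFun C D (RMod A)}
    [P.F.IsEquivalence] {adj : P.F ⊣ R.F} (h : ModFun.UnitComm P R adj) {M : D} [ModObj A.X M]
    (hP : SendsRegularTo P M) : ∃ j : RMod.regular A ≅ R.F.obj M,
      RMod.leftAct (Bimod.regular A) ≫ j.hom = A.X ⊴ₗ j.hom ≫ R.objAct A M := by
  obtain ⟨θ, hθ⟩ := hP
  exact ⟨(asIso adj.unit).app (RMod.regular A) ≪≫ R.F.mapIso θ,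
    linear_comp (h.unit_linear (RMod.leftAct (Bimod.regular A))) (ModFun.map_linear R hθ.symm)⟩

variable {D : Type u₁} [Category.{v₁} D] [Abelian D] [Linear ℂ D] [FiniteSemisimple D]
  [MonoidalLeftAction C D] [BilinearAction C D]
  {E : Type u₂} [Category.{v₂} E] [Abelian E] [Linear ℂ E] [FiniteSemisimple E]
  [MonoidalLeftAction C E] [BilinearAction C E]

/-- Every `A`-module in `E` is the value at `M` of a module functor. -/
theorem ModFun.exists_obj_iso {P : ModFun C (RMod A) D} {R : ModFun C D (RMod A)}
    [P.F.IsEquivalence] {adj : P.F ⊣ R.F} (h : ModFun.UnitComm P R adj) {M : D} [ModObj A.X M]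
    (hP : SendsRegularTo P M) (K : E) [ModObj A.X K] :
    ∃ i : (R.comp (RelTensor.modFun A K)).F.obj M ≅ K,
      (R.comp (RelTensor.modFun A K)).objAct A M ≫ i.hom = A.X ⊴ₗ i.hom ≫ γ := by
  -- The functor is `R` followed by - ⊗_A K: R(M) is the regular module and A ⊗_A K ≅ K, both
  -- compatibly with `A`.
  obtain ⟨j, hj⟩ := hP.exists_iso h
  obtain ⟨θ, hθ⟩ := RelTensor.modFun_sendsRegularTo A K
  refine ⟨(RelTensor.modFun A K).F.mapIso j.symm ≪≫ θ, ?_⟩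
  have h1 := linear_comp (ModFun.map_linear (RelTensor.modFun A K) (linear_inv j hj)) hθ.symm
  refine Eq.trans (congrArg (· ≫ _) ?_) h1
  rw [objAct, objAct, Functor.map_comp]
  exact Category.assoc _ _ _

variable [RightRigidCategory C] [ClosedAction C D] [ClosedAction C E]

/-- The functor is F ↦ [N, F(M)], with [N, -] quasi-inverse to - ⊗_B N. Only `D` needs A as an
internal End, in order to extend morphisms from M; the internal End B is used to identify E with
C_B. -/
theorem exists_evaluation_equivalence (M : D) [ModObj A.X M] (hM : IsGenerator C M)
    (hA : IsInternalEnd A M) (N : E) [ModObj B.X N] (hN : IsGenerator C N)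
    (hB : IsInternalEnd B N) : ∃ Φ : ModFun C D E ≌ Bimod A B, Φ.functor.Additive ∧
      Φ.functor.Linear ℂ ∧ IsEvaluation M (RelTensor.modFun B N) Φ.functor := by
  have hP : (RelTensor.functor A M).IsEquivalence := RelTensor.isEquivalence_functor M hM hA
  have hQ : (RelTensor.modFun B N).F.IsEquivalence := RelTensor.isEquivalence_functor N hN hB
  have hu := ModFun.rightAdjoint_unitComm (RelTensor.modFun A M) (RelTensor.adj A M)
  have hv := ModFun.rightAdjoint_unitComm (RelTensor.modFun B N) (RelTensor.adj B N)
  let Φ : ModFun C D E ⥤ Bimod A B := ModFun.evalFunctor M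
    ((RelTensor.modFun B N).rightAdjoint (RelTensor.adj B N))
  have hfull : Φ.Full := ModFun.evalFunctor_full (Q := RelTensor.modFun B N) M (RelTensor.adj B N)
    fun F G φ hφ => ModFun.exists_app_eq φ hφ
  have hfaithful : Φ.Faithful := ModFun.evalFunctor_faithful (Q := RelTensor.modFun B N) M (RelTensor.adj B N)
    fun F G α β h => ModFun.ext_of_app A h
  have hess : Φ.EssSurj := ⟨fun Y => by
    -- A bimodule is a left A-module in C_B, and the module functor - ⊗_B N makes it an A-module in
    -- E.
    let K : E := (RelTensor.modFun B N).F.obj (RMod.ofBimod Y)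
    let _ : ModObj A.X (RMod.ofBimod Y) := RMod.leftModObj Y
    let _ : ModObj A.X K := (RelTensor.modFun B N).modObj A (RMod.ofBimod Y)
    have hP' : (RelTensor.modFun A M).F.IsEquivalence := hP
    obtain ⟨i, hi⟩ := ModFun.exists_obj_iso hu (RelTensor.modFun_sendsRegularTo A M) K
    exact ⟨_, ModFun.evalFunctor_obj_iso M hv Y _ i hi⟩⟩
  have : Φ.IsEquivalence := { }
  exact ⟨Φ.asEquivalence, ModFun.evalFunctor_additive M _, ModFun.evalFunctor_linear M _,
    ModFun.evalFunctor_isEvaluation M hv⟩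

end EvaluationEquivalence

end

section

/-! ### The right adjoint of a module functor -/

universe v u v₁ u₁ v₂ u₂

open Functor.LaxLeftLinear Functor.OplaxLeftLinear Functor.LeftLinear

namespace ModFun

section Conjugates

variable {C : Type u} [Category.{v} C] [MonoidalCategory C]
  {D : Type u₁} [Category.{v₁} D] [Preadditive D] [Linear ℂ D] [MonoidalLeftAction C D]
  {E : Type u₂} [Category.{v₂} E] [Preadditive E] [Linear ℂ E] [MonoidalLeftAction C E]
  {F F' F'' : ModFun C D E} {G G' G'' : ModFun C E D} {adj : F.F ⊣ G.F} {adj' : F'.F ⊣ G'.F}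
  {adj'' : F''.F ⊣ G''.F}

theorem conj_id (h : UnitComm F G adj) : conj h h (𝟙 F) = 𝟙 G :=
  hom_ext (conjugateEquiv_id adj)

theorem conj_comp (h : UnitComm F G adj) (h' : UnitComm F' G' adj') (h'' : UnitComm F'' G'' adj'')
    (f : F ⟶ F') (g : F' ⟶ F'') : conj h' h'' g ≫ conj h h' f = conj h h'' (f ≫ g) :=
  hom_ext (conjugateEquiv_comp adj'' adj' adj g.nat f.nat)

/-- Taking mates is bijective on all natural transformations, and both directions preserve module
transformations. -/
theorem conj_bijective (h : UnitComm F G adj) (h' : UnitComm F' G' adj') :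
    Function.Bijective (conj h h') := by
  constructor
  · intro f g e
    exact hom_ext ((conjugateEquiv adj' adj).injective (congrArg Hom.nat e))
  · intro g
    exact ⟨conjSymm h h' g, hom_ext ((conjugateEquiv adj' adj).apply_symm_apply g.nat)⟩

/-- Right adjoints of module functors are unique. -/
def rightAdjointUniq {G' : ModFun C E D} {adj' : F.F ⊣ G'.F} (h : UnitComm F G adj)
    (h' : UnitComm F G' adj') : G ≅ G' where
  hom := conj h' h (𝟙 F)
  inv := conj h h' (𝟙 F)
  hom_inv_id := by rw [conj_comp, Category.comp_id, conj_id]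
  inv_hom_id := by rw [conj_comp, Category.comp_id, conj_id]

variable (C D E) in
/-- The functor sending a module functor to its right adjoint. -/
noncomputable def rightAdjointFunctor [RightRigidCategory C]
    [∀ F : ModFun C D E, F.F.IsLeftAdjoint] : (ModFun C D E)ᵒᵖ ⥤ ModFun C E D where
  obj F := F.unop.rightAdjoint (Adjunction.ofIsLeftAdjoint F.unop.F)
  map f := conj (rightAdjoint_unitComm _ _) (rightAdjoint_unitComm _ _) f.unop
  map_id F := conj_id _
  map_comp f g := (conj_comp _ _ _ g.unop f.unop).symm

variable (C D E) in
-- Mates give full faithfulness. Each `G` is the right adjoint of its left adjoint, which left duals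
-- make a module functor, and right adjoints are unique.
theorem rightAdjointFunctor_isEquivalence [RightRigidCategory C] [LeftRigidCategory C]
    [∀ F : ModFun C D E, F.F.IsLeftAdjoint] [∀ G : ModFun C E D, G.F.IsRightAdjoint] :
    (rightAdjointFunctor C D E).IsEquivalence where
  faithful := ⟨fun {F G f g} e => Quiver.Hom.unop_inj
    ((conj_bijective (rightAdjoint_unitComm G.unop _) (rightAdjoint_unitComm F.unop _)).1 e)⟩
  full := ⟨fun {F G} f => by
    obtain ⟨g, hg⟩ := (conj_bijective (rightAdjoint_unitComm G.unop _)
      (rightAdjoint_unitComm F.unop _)).2 f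
    exact ⟨g.op, hg⟩⟩
  essSurj := ⟨fun G => ⟨Opposite.op (G.leftAdjoint (Adjunction.ofIsRightAdjoint G.F)),
    ⟨rightAdjointUniq (rightAdjoint_unitComm _ _) (leftAdjoint_unitComm G _)⟩⟩⟩

end Conjugates

end ModFun

/-! ### Existence of left adjoints -/

section Existence

open Limits

/-- An object `K` such that the identity of every object is a sum of morphisms factoring
through `K`. -/
def IsAdditiveGenerator {D : Type u₁} [Category.{v₁} D] [Preadditive D] (K : D) : Prop :=
  ∀ X : D, ∃ (n : ℕ) (i : Fin n → (X ⟶ K)) (r : Fin n → (K ⟶ X)), ∑ j, i j ≫ r j = 𝟙 X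

section Left

variable {D : Type u₁} [Category.{v₁} D] [Preadditive D] [Linear ℂ D]
  {E : Type u₂} [Category.{v₂} E] [Abelian E] [Linear ℂ E] [FiniteSemisimple E] {K : E}
  (G : E ⥤ D) [G.Additive] [G.Linear ℂ]

/-- The object is a sum of copies of `K` indexed by a basis of Hom(m, G(K)), and `u` is the tuple of
basis vectors. Morphisms into G(K) factor by taking linear combinations of projections, and those
into a general G(n) because the identity of `n` is a sum of morphisms through `K`. -/
theorem exists_weakly_universal (hK : IsAdditiveGenerator K) (m : D)
    (hfin : Module.Finite ℂ (m ⟶ G.obj K)) :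
    ∃ (x : E) (u : m ⟶ G.obj x), ∀ (n : E) (f : m ⟶ G.obj n), ∃ h : x ⟶ n, u ≫ G.map h = f := by
  have := Abelian.hasFiniteBiproducts (C := E)
  let b := Module.finBasis ℂ (m ⟶ G.obj K)
  let x : E := ⨁ fun _ : Fin (Module.finrank ℂ (m ⟶ G.obj K)) => K
  let u : m ⟶ G.obj x := ∑ k, b k ≫ G.map (biproduct.ι (fun _ => K) k)
  have hu (k) : u ≫ G.map (biproduct.π (fun _ => K) k) = b k := by
    simp only [u, Preadditive.sum_comp, Category.assoc, ← G.map_comp]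
    rw [Finset.sum_eq_single k]
    · simp
    · intro j _ hj
      rw [biproduct.ι_π_ne _ hj, G.map_zero, comp_zero]
    · simp
  have h1 (f : m ⟶ G.obj K) : ∃ h : x ⟶ K, u ≫ G.map h = f := by
    refine ⟨∑ k, b.repr f k • biproduct.π (fun _ => K) k, ?_⟩
    rw [G.map_sum, Preadditive.comp_sum]
    simp only [G.map_smul, Linear.comp_smul, hu]
    exact b.sum_repr f
  refine ⟨x, u, fun n f => ?_⟩
  obtain ⟨l, i, r, hir⟩ := hK n
  choose h hh using fun j => h1 (f ≫ G.map (i j))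
  refine ⟨∑ j, h j ≫ r j, ?_⟩
  rw [G.map_sum, Preadditive.comp_sum]
  simp only [G.map_comp, reassoc_of% hh]
  simp only [← G.map_comp, ← Preadditive.comp_sum, ← G.map_sum, hir, G.map_id, Category.comp_id]

/-- Every linear functor out of a semisimple category with an additive generator has a left
adjoint. -/
theorem isRightAdjoint_of_additiveGenerator (hK : IsAdditiveGenerator K)
    (hfin : ∀ m : D, Module.Finite ℂ (m ⟶ G.obj K)) : G.IsRightAdjoint := by
  have (m : D) : HasInitial (StructuredArrow m G) := by
    let p : ℕ → Prop := fun d => ∃ (x : E) (u : m ⟶ G.obj x),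
      Module.finrank ℂ (x ⟶ K) = d ∧ ∀ (n : E) (f : m ⟶ G.obj n), ∃ h : x ⟶ n, u ≫ G.map h = f
    have hp : ∃ d, p d := by
      obtain ⟨x, u, hu⟩ := exists_weakly_universal G hK m (hfin m)
      exact ⟨_, x, u, rfl, hu⟩
    classical
    -- Among weakly universal morphisms, one with dim Hom(x, K) least is chosen; minimality will
    -- give uniqueness of factorisations.
    obtain ⟨x, u, hd, hu⟩ := Nat.find_spec hp
    -- The image of such an idempotent is again weakly universal. By minimality every x ⟶ K factors
    -- through it, so `e` fixes all morphisms to `K`, and hence the identity of `x`.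
    have hmin (e : x ⟶ x) (he : u ≫ G.map e = u) (hee : e ≫ e = e) : e = 𝟙 x := by
      have hip : image.ι e ≫ factorThruImage e = 𝟙 _ := by
        rw [← cancel_epi (factorThruImage e), ← cancel_mono (image.ι e)]
        simpa using hee
      have hle : Module.finrank ℂ (x ⟶ K) ≤ Module.finrank ℂ (image e ⟶ K) := by
        rw [hd]
        refine Nat.find_min' hp ⟨image e, u ≫ G.map (factorThruImage e), rfl, fun n f => ?_⟩
        obtain ⟨h, hh⟩ := hu n f
        refine ⟨image.ι e ≫ h, ?_⟩
        rw [Category.assoc, ← G.map_comp, image.fac_assoc, G.map_comp, reassoc_of% he, hh]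
      have := FiniteSemisimple.hom_finite x K
      have := FiniteSemisimple.hom_finite (image e) K
      have hinj : Function.Injective (Linear.leftComp ℂ K (factorThruImage e)) :=
        fun g g' h => (cancel_epi (factorThruImage e)).1 h
      have hsurj := (LinearMap.injective_iff_surjective_of_finrank_eq_finrank
        ((LinearMap.finrank_le_finrank_of_injective hinj).antisymm hle)).1 hinj
      have heg (g : x ⟶ K) : e ≫ g = g := by
        obtain ⟨g', rfl⟩ := hsurj g
        have h1 : e ≫ factorThruImage e = factorThruImage e := by
          rw [← cancel_mono (image.ι e), Category.assoc, image.fac, hee]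
        exact (reassoc_of% h1) g'
      obtain ⟨l, i, r, hir⟩ := hK x
      rw [← Category.comp_id e, ← hir, Preadditive.comp_sum]
      simp only [reassoc_of% heg]
    -- With hsh = h, the idempotent 1 - hs fixes `u`, so hs = 0 and h = hsh = 0.
    have hzero (n : E) (h : x ⟶ n) (w : u ≫ G.map h = 0) : h = 0 := by
      obtain ⟨s, hs⟩ := exists_regular h
      have h1 := hmin (𝟙 x - h ≫ s)
        (by rw [G.map_sub, G.map_id, G.map_comp, Preadditive.comp_sub, reassoc_of% w]; simp)
        (by simp [reassoc_of% hs])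
      rw [sub_eq_self] at h1
      rw [← hs, reassoc_of% h1, zero_comp]
    have huniq (n : E) (h h' : x ⟶ n) (w : u ≫ G.map h = u ≫ G.map h') : h = h' := by
      rw [← sub_eq_zero]
      exact hzero n _ (by rw [G.map_sub, Preadditive.comp_sub, w, sub_self])
    refine (IsInitial.ofUniqueHom (X := StructuredArrow.mk u)
      (fun Y => StructuredArrow.homMk (hu Y.right Y.hom).choose (hu Y.right Y.hom).choose_spec)
      fun Y f => ?_).hasInitial
    ext
    exact huniq _ _ _ ((StructuredArrow.w f).trans (hu Y.right Y.hom).choose_spec.symm)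
  exact isRightAdjointOfStructuredArrowInitials G

end Left

end Existence

end

/-! ### Adjoints of module functors between boundaries -/

section

universe v u v₁ u₁ v₂ u₂ v₃ u₃

section Defects

variable {C : Type u} [Category.{v} C] [MonoidalCategory C] [Preadditive C] [Linear ℂ C]
  [MonoidalPreadditive C] [MonoidalLinear ℂ C] {A B : Mon C}
  {D : Type u₁} [Category.{v₁} D] [Abelian D] [Linear ℂ D] [FiniteSemisimple D]
  [MonoidalLeftAction C D] [BilinearAction C D] [ClosedAction C D]
  {E : Type u₂} [Category.{v₂} E] [Abelian E] [Linear ℂ E] [FiniteSemisimple E]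
  [MonoidalLeftAction C E] [BilinearAction C E]

/-- Every `X` is a retract of [M, X] ⊗ M, and the identity of [M, X] is a sum of morphisms through
`K`. -/
theorem IsAdditiveGenerator.action {K : C} (hK : IsAdditiveGenerator K) (A : Mon C) (M : D)
    [ModObj A.X M] [(RelTensor.functor A M).IsEquivalence] : IsAdditiveGenerator (K ⊙ₗ M) := by
  intro X
  obtain ⟨n, i, r, h⟩ := hK (internalHom C M X)
  have := RelTensor.isSplitEpi_internalEv A M X
  refine ⟨n, fun j => section_ (internalEv C M X) ≫ i j ⊵ₗ M,
    fun j => r j ⊵ₗ M ≫ internalEv C M X, ?_⟩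
  have h1 : ∑ j, i j ⊵ₗ M ≫ r j ⊵ₗ M = 𝟙 _ := by
    simp only [← comp_actionHomLeft]
    rw [← id_actionHomLeft, ← h]
    exact (map_sum (AddMonoidHom.mk' (fun f : internalHom C M X ⟶ internalHom C M X => f ⊵ₗ M)
      (fun f g => BilinearAction.actionHomLeft_add f g M)) _ _).symm
  calc _ = section_ (internalEv C M X) ≫ (∑ j, i j ⊵ₗ M ≫ r j ⊵ₗ M) ≫ internalEv C M X := by
        simp only [Preadditive.sum_comp, Preadditive.comp_sum, Category.assoc]
    _ = _ := by rw [h1, Category.id_comp, IsSplitEpi.id]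

variable [RightRigidCategory C]

/-- The functors `F` and [M, -] ⊗_A F(M) have isomorphic A-modules as values at `M`, hence are
isomorphic. The second is an equivalence followed by a functor with right adjoint [F(M), -]. -/
theorem ModFun.isLeftAdjoint [ClosedAction C E] (A : Mon C) (M : D) [ModObj A.X M]
    [hP : (RelTensor.functor A M).IsEquivalence] (F : ModFun C D E) : F.F.IsLeftAdjoint := by
  have hu := ModFun.rightAdjoint_unitComm (RelTensor.modFun A M) (RelTensor.adj A M)
  have hP' : (RelTensor.modFun A M).F.IsEquivalence := hP
  let _ : ModObj A.X (F.F.obj M) := F.modObj A M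
  obtain ⟨i, hi⟩ := ModFun.exists_obj_iso hu (RelTensor.modFun_sendsRegularTo A M) (F.F.obj M)
  have hi' := linear_inv i hi
  obtain ⟨α, hα⟩ := exists_app_eq (A := A) (G := F) i.hom hi
  obtain ⟨β, hβ⟩ := exists_app_eq (A := A) (F := F) i.inv hi'
  have h1 : α ≫ β = 𝟙 _ := ext_of_app A (by
    rw [comp_nat, NatTrans.comp_app, hα, hβ, i.hom_inv_id]
    rfl)
  have h2 : β ≫ α = 𝟙 _ := ext_of_app A (by
    rw [comp_nat, NatTrans.comp_app, hα, hβ, i.inv_hom_id]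
    rfl)
  have e : RelTensor.homFunctor A M ⋙ RelTensor.functor A (F.F.obj M) ≅ F.F :=
    ⟨α.nat, β.nat, congrArg Hom.nat h1, congrArg Hom.nat h2⟩
  have : (RelTensor.homFunctor A M).IsEquivalence :=
    (RelTensor.adj A M).isEquivalence_right_of_isEquivalence_left
  have : (RelTensor.functor A (F.F.obj M)).IsLeftAdjoint := (RelTensor.adj A _).isLeftAdjoint
  exact Functor.isLeftAdjoint_of_iso e

/-- The equivalence is passage to the right adjoint followed by `Φ`, so the asserted isomorphism is
an identity. -/
theorem exists_opposite_equivalence [LeftRigidCategory C] [ClosedAction C E] {K : C}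
    (hK : IsAdditiveGenerator K)
    (M : D) [ModObj A.X M] (hM : IsGenerator C M) (hA : IsInternalEnd A M)
    (N : E) [ModObj B.X N] (hN : IsGenerator C N) (hB : IsInternalEnd B N)
    {T : Type u₃} [Category.{v₃} T] (Φ : ModFun C E D ≌ T) :
    ∃ Ψ : (ModFun C D E)ᵒᵖ ≌ T, ∀ F : ModFun C D E, ∃ G : ModFun C E D,
      F.IsRightAdjoint G ∧ Nonempty (Ψ.functor.obj (Opposite.op F) ≅ Φ.functor.obj G) := by
  have hP := RelTensor.isEquivalence_functor M hM hA
  have hQ := RelTensor.isEquivalence_functor N hN hB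
  have hl : ∀ F : ModFun C D E, F.F.IsLeftAdjoint := fun F => F.isLeftAdjoint A M
  have hr : ∀ G : ModFun C E D, G.F.IsRightAdjoint := fun G =>
    isRightAdjoint_of_additiveGenerator G.F (hK.action B N)
      fun m => FiniteSemisimple.hom_finite _ _
  have := ModFun.rightAdjointFunctor_isEquivalence C D E
  refine ⟨(ModFun.rightAdjointFunctor C D E).asEquivalence.trans Φ, fun F => ?_⟩
  exact ⟨F.rightAdjoint (Adjunction.ofIsLeftAdjoint F.F),
    ⟨Adjunction.ofIsLeftAdjoint F.F, ModFun.rightAdjoint_unitComm F _⟩, ⟨Iso.refl _⟩⟩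

end Defects

end

section

/-! ### Duals of representations of a Hopf algebra -/

open Module (Dual)

section Coevaluation

variable {V : Type*} [AddCommGroup V] [Module ℂ V] [Module.Finite ℂ V]

/-- The coevaluation of 1 is the sum of basis vectors tensor dual basis vectors; expanding `f` in
matrix coefficients moves it to the dual factor as its transpose. -/
theorem rTensor_coevaluation (f : V →ₗ[ℂ] V) (c : ℂ) : f.rTensor _ (coevaluation ℂ V c) =
    (Dual.transpose (R := ℂ) f).lTensor V (coevaluation ℂ V c) := by
  suffices h : f.rTensor _ (coevaluation ℂ V 1) =
      (Dual.transpose (R := ℂ) f).lTensor V (coevaluation ℂ V 1) by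
    rw [← mul_one c, ← smul_eq_mul, map_smul, map_smul, map_smul, h]
  rw [coevaluation_apply_one]
  set b := Module.Basis.ofVectorSpace ℂ V
  have h1 (i) : Dual.transpose (R := ℂ) f (b.coord i) = ∑ j, b.coord i (f (b j)) • b.coord j :=
    (b.sum_dual_apply_smul_coord _).symm
  have h2 (j) : f (b j) = ∑ i, b.coord i (f (b j)) • b i := by simp [b.sum_repr]
  simp only [map_sum, LinearMap.rTensor_tmul, LinearMap.lTensor_tmul, h1, TensorProduct.tmul_sum]
  rw [Finset.sum_comm]
  refine Finset.sum_congr rfl fun j _ => ?_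
  conv_lhs => rw [h2 j, TensorProduct.sum_tmul]
  simp only [TensorProduct.smul_tmul]

end Coevaluation

namespace FdMod

variable {H : Type} [Ring H] [Bialgebra ℂ H]

/-- The dual of a representation, for an anti-endomorphism `S` of the algebra. -/
@[reducible] noncomputable def dual (S : H →ₐ[ℂ] Hᵐᵒᵖ) (X : FdMod H) : FdMod H where
  V := Dual ℂ X.V
  ρ := AlgHom.ofLinearMap (Dual.transpose (R := ℂ) ∘ₗ X.ρ.toLinearMap ∘ₗ
      (MulOpposite.opLinearEquiv ℂ).symm.toLinearMap ∘ₗ S.toLinearMap)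
    (by ext; simp; rfl) (fun a b => by ext; simp; rfl)

theorem dual_rho (S : H →ₐ[ℂ] Hᵐᵒᵖ) (X : FdMod H) (h : H) :
    (dual S X).ρ h = Dual.transpose (R := ℂ) (X.ρ (S h).unop) := rfl

/-- The linear map underlying an anti-endomorphism. -/
@[reducible] def antiLin (S : H →ₐ[ℂ] Hᵐᵒᵖ) : H →ₗ[ℂ] H :=
  (MulOpposite.opLinearEquiv ℂ).symm.toLinearMap ∘ₗ S.toLinearMap

theorem rTensor_rho_algebraMap (X : FdMod H) (z : ℂ) {W : Type*} [AddCommGroup W] [Module ℂ W]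
    (w : X.V ⊗[ℂ] W) : (X.ρ (algebraMap ℂ H z)).rTensor W w = z • w := by
  rw [AlgHom.commutes, Module.algebraMap_end_eq_smul_id, LinearMap.rTensor_smul,
    LinearMap.rTensor_id]
  rfl

theorem lTensor_rho_algebraMap (X : FdMod H) (z : ℂ) {W : Type*} [AddCommGroup W] [Module ℂ W]
    (w : W ⊗[ℂ] X.V) : (X.ρ (algebraMap ℂ H z)).lTensor W w = z • w := by
  rw [AlgHom.commutes, Module.algebraMap_end_eq_smul_id, LinearMap.lTensor_smul,
    LinearMap.lTensor_id]
  rfl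

/-- Since g acts on a functional by precomposition with S(g), the pairing of gf with hv is
f(S(g)hv). Invariance of the evaluation thereby becomes an identity in `H`. -/
theorem contractLeft_box (S : H →ₐ[ℂ] Hᵐᵒᵖ) (X : FdMod H) (t : H ⊗[ℂ] H) :
    contractLeft ℂ X.V ∘ₗ box (dual S X).ρ X.ρ t = contractLeft ℂ X.V ∘ₗ
      (X.ρ (LinearMap.mul' ℂ H ((antiLin S).rTensor H t))).lTensor _ := by
  induction t with
  | zero => simp
  | add s t hs ht => simp only [map_add, LinearMap.comp_add, hs, ht, LinearMap.lTensor_add]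
  | tmul g h =>
    ext f v
    simp [Dual.transpose]

/-- By `rTensor_coevaluation` the action of h on the dual factor can be moved to the first one as
S(h), where it combines with g to gS(h). -/
theorem box_coevaluation (S : H →ₐ[ℂ] Hᵐᵒᵖ) (X : FdMod H) (t : H ⊗[ℂ] H) (c : ℂ) :
    box X.ρ (dual S X).ρ t (coevaluation ℂ X.V c) =
      (X.ρ (LinearMap.mul' ℂ H ((antiLin S).lTensor H t))).rTensor _ (coevaluation ℂ X.V c) := by
  induction t with
  | zero => simp
  | add s t hs ht => simp only [map_add, LinearMap.add_apply, hs, ht, LinearMap.rTensor_add]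
  | tmul g h =>
    rw [LinearMap.lTensor_tmul, LinearMap.mul'_apply, map_mul, Module.End.mul_eq_comp,
      LinearMap.rTensor_comp_apply, rTensor_coevaluation, box_tmul, dual_rho]
    exact (LinearMap.congr_fun (LinearMap.rTensor_comp_lTensor _ (X.ρ g) _) _).symm

/-- The right dual of a representation of a Hopf algebra. -/
@[reducible] noncomputable def exactPairingRight (S : H →ₐ[ℂ] Hᵐᵒᵖ)
    (h₁ : ∀ h : H, LinearMap.mul' ℂ H ((antiLin S).rTensor H (Coalgebra.comul (R := ℂ) h)) =
      algebraMap ℂ H (Coalgebra.counit (R := ℂ) h))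
    (h₂ : ∀ h : H, LinearMap.mul' ℂ H ((antiLin S).lTensor H (Coalgebra.comul (R := ℂ) h)) =
      algebraMap ℂ H (Coalgebra.counit (R := ℂ) h)) (X : FdMod H) : ExactPairing X (dual S X) where
  coevaluation' := ⟨coevaluation ℂ X.V, fun h => LinearMap.ext fun c => by
    refine Eq.trans ?_ (box_coevaluation S X (Coalgebra.comul (R := ℂ) h) c).symm
    rw [h₂, rTensor_rho_algebraMap]
    exact (coevaluation ℂ X.V).map_smul _ _⟩
  evaluation' := ⟨contractLeft ℂ X.V, fun h => by
    refine (contractLeft_box S X (Coalgebra.comul (R := ℂ) h)).trans ?_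
    rw [h₁]
    refine LinearMap.ext fun w => (congrArg (contractLeft ℂ X.V)
      (lTensor_rho_algebraMap X _ w)).trans ?_
    exact (contractLeft ℂ X.V).map_smul _ _⟩
  coevaluation_evaluation' := hom_ext (contractLeft_assoc_coevaluation ℂ X.V)
  evaluation_coevaluation' := hom_ext (contractLeft_assoc_coevaluation' ℂ X.V)

/-- With evaluation and coevaluation of the left dual defined by flipping the tensor factors, this
and the next identity reduce its triangle identities to the known ones. -/
theorem contractLeft_comm (V : Type*) [AddCommGroup V] [Module ℂ V] (w : V ⊗[ℂ] Dual ℂ V) (v : V) :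
    (contractLeft ℂ V ∘ₗ (TensorProduct.comm ℂ V (Dual ℂ V)).toLinearMap).rTensor V
      ((TensorProduct.assoc ℂ _ _ _).symm (v ⊗ₜ TensorProduct.comm ℂ _ _ w)) =
    TensorProduct.comm ℂ _ _ ((contractLeft ℂ V).lTensor V (TensorProduct.assoc ℂ _ _ _ (w ⊗ₜ v))) := by
  induction w with
  | zero => simp
  | add s t hs ht => simp only [map_add, TensorProduct.tmul_add, TensorProduct.add_tmul, hs, ht]
  | tmul x f => simp

theorem contractLeft_comm' (V : Type*) [AddCommGroup V] [Module ℂ V] (w : V ⊗[ℂ] Dual ℂ V)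
    (f : Dual ℂ V) :
    (contractLeft ℂ V ∘ₗ (TensorProduct.comm ℂ V (Dual ℂ V)).toLinearMap).lTensor (Dual ℂ V)
      (TensorProduct.assoc ℂ _ _ _ (TensorProduct.comm ℂ _ _ w ⊗ₜ f)) =
    TensorProduct.comm ℂ _ _ ((contractLeft ℂ V).rTensor (Dual ℂ V)
      ((TensorProduct.assoc ℂ _ _ _).symm (f ⊗ₜ w))) := by
  induction w with
  | zero => simp
  | add s t hs ht => simp only [map_add, TensorProduct.tmul_add, TensorProduct.add_tmul, hs, ht]
  | tmul x f => simp

theorem box_comm {V W : Type} [AddCommGroup V] [Module ℂ V] [AddCommGroup W] [Module ℂ W]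
    (f : H →ₐ[ℂ] Module.End ℂ V) (g : H →ₐ[ℂ] Module.End ℂ W) (t : H ⊗[ℂ] H) :
    (TensorProduct.comm ℂ V W).toLinearMap ∘ₗ box f g t =
      box g f (TensorProduct.comm ℂ H H t) ∘ₗ (TensorProduct.comm ℂ V W).toLinearMap := by
  induction t with
  | zero => simp
  | add s t hs ht => simp only [map_add, LinearMap.comp_add, LinearMap.add_comp, hs, ht]
  | tmul a b => exact TensorProduct.ext' fun _ _ => rfl

theorem comm_coevaluation_eq (S : H →ₐ[ℂ] Hᵐᵒᵖ) (X : FdMod H) (h : H)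
    (h₂ : LinearMap.mul' ℂ H ((antiLin S).lTensor H
      (TensorProduct.comm ℂ H H (Coalgebra.comul (R := ℂ) h))) =
      algebraMap ℂ H (Coalgebra.counit (R := ℂ) h)) (c : ℂ) :
    TensorProduct.comm ℂ X.V (Dual ℂ X.V) (Coalgebra.counit (R := ℂ) h • coevaluation ℂ X.V c) =
      box (dual S X).ρ X.ρ (Coalgebra.comul (R := ℂ) h)
        (TensorProduct.comm ℂ X.V (Dual ℂ X.V) (coevaluation ℂ X.V c)) := by
  have h3 := LinearMap.congr_fun (box_comm X.ρ (dual S X).ρ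
    (TensorProduct.comm ℂ H H (Coalgebra.comul (R := ℂ) h))) (coevaluation ℂ X.V c)
  rw [TensorProduct.comm_comm, LinearMap.comp_apply, box_coevaluation, h₂,
    rTensor_rho_algebraMap] at h3
  exact h3

/-- The left dual of a representation of a Hopf algebra. -/
@[reducible] noncomputable def exactPairingLeft (S : H →ₐ[ℂ] Hᵐᵒᵖ)
    (h₁ : ∀ h : H, LinearMap.mul' ℂ H ((antiLin S).rTensor H
      (TensorProduct.comm ℂ H H (Coalgebra.comul (R := ℂ) h))) =
      algebraMap ℂ H (Coalgebra.counit (R := ℂ) h))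
    (h₂ : ∀ h : H, LinearMap.mul' ℂ H ((antiLin S).lTensor H
      (TensorProduct.comm ℂ H H (Coalgebra.comul (R := ℂ) h))) =
      algebraMap ℂ H (Coalgebra.counit (R := ℂ) h)) (X : FdMod H) : ExactPairing (dual S X) X where
  coevaluation' := ⟨(TensorProduct.comm ℂ X.V (Dual ℂ X.V)).toLinearMap ∘ₗ coevaluation ℂ X.V,
      fun h => LinearMap.ext fun (c : ℂ) => by
    refine Eq.trans ?_ (comm_coevaluation_eq S X h (h₂ h) c)
    exact congrArg (TensorProduct.comm ℂ X.V (Dual ℂ X.V))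
      ((coevaluation ℂ X.V).map_smul (Coalgebra.counit (R := ℂ) h) c)⟩
  evaluation' := ⟨contractLeft ℂ X.V ∘ₗ (TensorProduct.comm ℂ X.V (Dual ℂ X.V)).toLinearMap,
      fun h => by
    have h3 := congrArg (contractLeft ℂ X.V ∘ₗ ·)
      (box_comm X.ρ (dual S X).ρ (Coalgebra.comul (R := ℂ) h))
    refine h3.trans ?_
    change (contractLeft ℂ X.V ∘ₗ box (dual S X).ρ X.ρ _) ∘ₗ _ = _
    rw [contractLeft_box, h₁]
    refine LinearMap.ext fun w => (congrArg (contractLeft ℂ X.V)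
      (lTensor_rho_algebraMap X _ _)).trans ?_
    exact (contractLeft ℂ X.V).map_smul _ _⟩
  coevaluation_evaluation' := hom_ext (TensorProduct.ext' fun v (c : ℂ) => by
    refine (contractLeft_comm X.V (coevaluation ℂ X.V c) v).trans ?_
    exact congrArg (TensorProduct.comm ℂ X.V ℂ)
      (LinearMap.congr_fun (contractLeft_assoc_coevaluation' ℂ X.V) (c ⊗ₜ v)))
  evaluation_coevaluation' := hom_ext (TensorProduct.ext' fun (c : ℂ) f => by
    refine (contractLeft_comm' X.V (coevaluation ℂ X.V c) f).trans ?_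
    exact congrArg (TensorProduct.comm ℂ ℂ (Dual ℂ X.V))
      (LinearMap.congr_fun (contractLeft_assoc_coevaluation ℂ X.V) (f ⊗ₜ c)))

/-! ### Rigidity of Rep(H): antipode and involution -/

section Rigid

variable {H : Type} [Ring H] [HopfAlgebra ℂ H]

noncomputable instance : RightRigidCategory (FdMod H) where
  rightDual X :=
    { rightDual := dual (HopfAlgebra.antipodeAlgHomOp ℂ H) X
      exact := exactPairingRight (HopfAlgebra.antipodeAlgHomOp ℂ H)
        HopfAlgebra.mul_antipode_rTensor_comul_apply
        HopfAlgebra.mul_antipode_lTensor_comul_apply X }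

variable [StarRing H] [StarModule ℂ H]

theorem exists_comul_star [CStarHopfAlgebra H] (h : H) : ∃ s : Finset (H × H),
    Coalgebra.comul (R := ℂ) h = ∑ p ∈ s, p.1 ⊗ₜ[ℂ] p.2 ∧
      Coalgebra.comul (R := ℂ) (star h) = ∑ p ∈ s, star p.1 ⊗ₜ[ℂ] star p.2 := by
  obtain ⟨s, hs⟩ := TensorProduct.exists_finset (Coalgebra.comul (R := ℂ) h)
  exact ⟨s, hs, CStarHopfAlgebra.comul_star h s hs⟩

/-- The sum of ε(h₁*) times the conjugate of ε(h₂) is computed twice: the counit axiom for `h` gives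
ε(h*), the one for h* gives the conjugate of ε(h). -/
theorem counit_star [CStarHopfAlgebra H] (h : H) :
    Coalgebra.counit (R := ℂ) (star h) = star (Coalgebra.counit (R := ℂ) h) := by
  obtain ⟨s, hs, hs'⟩ := exists_comul_star h
  have h1 := Coalgebra.rTensor_counit_comul (R := ℂ) (star h)
  have h2 := Coalgebra.lTensor_counit_comul (R := ℂ) h
  rw [hs'] at h1
  rw [hs] at h2
  have h3 := congrArg (TensorProduct.lid ℂ H) h1
  have h4 := congrArg (TensorProduct.rid ℂ H) h2
  simp only [map_sum, LinearMap.rTensor_tmul, LinearMap.lTensor_tmul, TensorProduct.lid_tmul,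
    TensorProduct.rid_tmul, one_smul] at h3 h4
  have h5 := congrArg (fun x => Coalgebra.counit (R := ℂ) (star x)) h3
  have h6 := congrArg (fun x => Coalgebra.counit (R := ℂ) (star x)) h4
  simp only [star_sum, star_smul, star_star, map_sum, map_smul, smul_eq_mul] at h5 h6
  have h7 := congrArg star h5
  simp only [star_sum, star_mul', star_star] at h7
  rw [← h6, ← h7]
  exact Finset.sum_congr rfl fun p _ => mul_comm _ _

/-- The algebra anti-homomorphism `x ↦ S(x*)*`, inverse to the antipode. -/
noncomputable def starAntipode : H →ₐ[ℂ] Hᵐᵒᵖ :=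
  AlgHom.ofLinearMap
    { toFun x := MulOpposite.op (star (HopfAlgebra.antipode ℂ (star x)))
      map_add' x y := by simp
      map_smul' c x := by simp }
    (by simp)
    (fun x y => by simp [HopfAlgebra.antipode_mul_antidistrib])

/-- A left dual needs the antipode axioms with the two tensor factors exchanged. These are the stars
of the ordinary axioms at h*: the involution reverses products and commutes with the
comultiplication. -/
noncomputable instance [CStarHopfAlgebra H] : LeftRigidCategory (FdMod H) where
  leftDual X :=
    { leftDual := dual starAntipode X
      exact := exactPairingLeft starAntipode
        (fun h => by
          obtain ⟨s, hs, hs'⟩ := exists_comul_star h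
          have h1 := congrArg star (HopfAlgebra.mul_antipode_lTensor_comul_apply (R := ℂ) (star h))
          rw [hs', counit_star, algebraMap_star_comm, star_star] at h1
          rw [← h1, hs]
          simp only [map_sum, star_sum, TensorProduct.comm_tmul, LinearMap.rTensor_tmul,
            LinearMap.lTensor_tmul, LinearMap.mul'_apply, star_mul, star_star]
          rfl)
        (fun h => by
          obtain ⟨s, hs, hs'⟩ := exists_comul_star h
          have h1 := congrArg star (HopfAlgebra.mul_antipode_rTensor_comul_apply (R := ℂ) (star h))
          rw [hs', counit_star, algebraMap_star_comm, star_star] at h1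
          rw [← h1, hs]
          simp only [map_sum, star_sum, TensorProduct.comm_tmul, LinearMap.rTensor_tmul,
            LinearMap.lTensor_tmul, LinearMap.mul'_apply, star_mul, star_star]
          rfl) X }

end Rigid

end FdMod

end

section

/-! ### Semisimplicity and internal homs -/

/-- The Jacobson radical is nilpotent. For `x` in it, x*x is nilpotent and represented by a
self-adjoint operator; such an operator is 0, and the C*-identity and faithfulness give x = 0. -/
theorem isSemisimpleRing_of_cstar {H : Type} [Ring H] [HopfAlgebra ℂ H] [StarRing H]
    [StarModule ℂ H] [CStarHopfAlgebra H] : IsSemisimpleRing H := by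
  have : Module.Finite ℂ H := CStarHopfAlgebra.finite
  have : IsArtinianRing H := IsArtinianRing.of_finite ℂ H
  rw [IsArtinianRing.isSemisimpleRing_iff_jacobson, ← Ideal.jacobson_bot, eq_bot_iff]
  obtain ⟨n, hn⟩ := IsArtinianRing.isNilpotent_jacobson_bot (R := H)
  obtain ⟨E, _, _, _, π, hπ⟩ := CStarHopfAlgebra.exists_faithful (H := H)
  intro x hx
  have h1 : (star x * x) ^ n = 0 := by
    have := Ideal.pow_mem_pow (Ideal.mul_mem_left _ (star x) hx) n
    rw [hn] at this
    exact this
  have h2 : IsSelfAdjoint (π (star x * x)) := (IsSelfAdjoint.star_mul_self x).map π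
  -- For self-adjoint operators the norm is multiplicative on powers with exponent 2^n, so the
  -- nilpotency exponent n is enlarged to 2^n.
  have h3 : π (star x * x) ^ 2 ^ n = 0 := by
    rw [← map_pow, pow_eq_zero_of_le n.lt_two_pow_self.le h1, map_zero]
  have h4 := h2.norm_pow_two_pow n
  rw [h3, norm_zero] at h4
  have h5 : star (π x) * π x = 0 := by
    rw [← map_star, ← map_mul]
    exact norm_eq_zero.mp (eq_zero_of_pow_eq_zero h4.symm)
  rw [CStarRing.star_mul_self_eq_zero_iff] at h5
  exact hπ (h5.trans (map_zero π).symm)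

namespace FdMod

section Regular

variable {A : Type} [Ring A] [Algebra ℂ A] [Module.Finite ℂ A]

variable (A) in
/-- The regular left module. -/
@[reducible] noncomputable def regular : FdMod A where
  V := A
  ρ := Algebra.lmul ℂ A

/-- The morphism `a ↦ a x` from the regular module. -/
@[reducible] noncomputable def elt (X : FdMod A) : X.V →ₗ[ℂ] (regular A ⟶ X) where
  toFun x := ⟨X.ρ.toLinearMap.flip x, fun a => LinearMap.ext fun b =>
    LinearMap.congr_fun (map_mul X.ρ a b) x⟩
  map_add' x y := hom_ext (map_add X.ρ.toLinearMap.flip x y)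
  map_smul' c x := hom_ext (map_smul X.ρ.toLinearMap.flip c x)

theorem elt_rho (X : FdMod A) (a : A) (x : X.V) :
    elt X (X.ρ a x) = elt (regular A) a ≫ elt X x :=
  hom_ext (LinearMap.ext fun b => (LinearMap.congr_fun (map_mul X.ρ b a) x).symm)

theorem elt_comp {X Y : FdMod A} (f : X ⟶ Y) (x : X.V) : elt X x ≫ f = elt Y (f.hom x) :=
  hom_ext (LinearMap.ext fun b => comm_apply f b x)

theorem eq_elt {X : FdMod A} (f : regular A ⟶ X) : f = elt X (f.hom 1) :=
  hom_ext (LinearMap.ext fun b => by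
    refine Eq.trans ?_ (comm_apply f b 1)
    exact congrArg f.hom (mul_one b).symm)

theorem sum_hom {X Y : FdMod A} {J : Type} (t : Finset J) (f : J → (X ⟶ Y)) :
    (∑ j ∈ t, f j : X ⟶ Y).hom = ∑ j ∈ t, (f j).hom :=
  map_sum (⟨⟨fun g => g.hom, rfl⟩, fun _ _ => rfl⟩ : (X ⟶ Y) →+ (X.V →ₗ[ℂ] Y.V)) f t

/-- A finitely generated module is a quotient of Aⁿ, and the quotient map splits because all modules
over a semisimple ring are projective. The coordinates of the splitting and the images of the basis
vectors are the required morphisms. -/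
theorem isAdditiveGenerator_regular [IsSemisimpleRing A] : IsAdditiveGenerator (regular A) := by
  intro X
  let _ : Module A X.V := Module.compHom X.V X.ρ.toRingHom
  have hs (a : A) (x : X.V) : a • x = X.ρ a x := rfl
  have : IsScalarTower ℂ A X.V := ⟨fun c a x => by
    rw [hs, hs, map_smul]
    rfl⟩
  have : Module.Finite A X.V := Module.Finite.of_restrictScalars_finite ℂ A X.V
  have : Module.Projective A X.V := Module.projective_of_isSemisimpleRing A X.V
  obtain ⟨n, p, hp⟩ := Module.Finite.exists_fin' A X.V
  obtain ⟨s, hsp⟩ := Module.projective_lifting_property p LinearMap.id hp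
  refine ⟨n, fun j => ⟨(LinearMap.proj j ∘ₗ s).restrictScalars ℂ, fun a => ?_⟩,
    fun j => elt X (p (Pi.single j 1)), ?_⟩
  · exact LinearMap.ext fun x => congrFun (s.map_smul a x) j
  · apply hom_ext
    rw [sum_hom]
    refine LinearMap.ext fun x => ?_
    rw [LinearMap.sum_apply]
    refine Eq.trans ?_ (LinearMap.congr_fun hsp x)
    change ∑ j, s x j • p (Pi.single j 1) = p (s x)
    conv_rhs => rw [← Finset.univ_sum_single (s x), map_sum]
    refine Finset.sum_congr rfl fun j _ => ?_
    rw [← map_smul, ← Pi.single_smul, smul_eq_mul, mul_one]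

end Regular

end FdMod

/-! ### Internal homs from the regular representation -/

section ClosedAction

universe v u

variable {H : Type} [Ring H] [Bialgebra ℂ H] [Module.Finite ℂ H] [IsSemisimpleRing H]
  {D : Type u} [Category.{v} D] [Preadditive D] [Linear ℂ D]
  [MonoidalLeftAction (FdMod H) D] [BilinearAction (FdMod H) D]

open FdMod

theorem sum_actionHomLeft {X Y : FdMod H} {J : Type} (s : Finset J) (f : J → (X ⟶ Y)) (d : D) :
    (∑ j ∈ s, f j) ⊵ₗ d = ∑ j ∈ s, f j ⊵ₗ d :=
  map_sum (⟨⟨fun g => g ⊵ₗ d, by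
    have := BilinearAction.actionHomLeft_smul (0 : ℂ) (0 : X ⟶ Y) d
    simpa using this⟩, fun f g => BilinearAction.actionHomLeft_add f g d⟩ :
      (X ⟶ Y) →+ (X ⊙ₗ d ⟶ Y ⊙ₗ d)) f s

/-- Precomposition `T ↦ (f ⊗ d) ≫ T`, as a linear map in both arguments. -/
@[reducible] noncomputable def precompAction (X Y : FdMod H) (d n : D) :
    (X ⟶ Y) →ₗ[ℂ] (Y ⊙ₗ d ⟶ n) →ₗ[ℂ] (X ⊙ₗ d ⟶ n) :=
  LinearMap.mk₂ ℂ (fun f T => f ⊵ₗ d ≫ T)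
    (fun f g T => by rw [BilinearAction.actionHomLeft_add, Preadditive.add_comp])
    (fun c f T => by rw [BilinearAction.actionHomLeft_smul, Linear.smul_comp])
    (fun f T T' => Preadditive.comp_add _ _ _ _ _ _)
    (fun c f T => Linear.comp_smul _ _ _ _ _ _)

/-- The internal hom `[d, n]`, on the space `Hom(H ⊗ d, n)` identified with `ℂⁿ`. -/
@[reducible] noncomputable def homRep {d n : D} {k : ℕ}
    (e : (regular H ⊙ₗ d ⟶ n) ≃ₗ[ℂ] (Fin k → ℂ)) : FdMod H where
  -- Coordinates bring Hom(H ⊗ d, n), which may lie in any universe, into `Type`. The algebra acts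
  -- by precomposition with right multiplications of `H`.
  V := Fin k → ℂ
  ρ := AlgHom.ofLinearMap
    (e.conj.toLinearMap ∘ₗ precompAction (regular H) (regular H) d n ∘ₗ elt (regular H))
    (by
      have h1 : elt (regular H) (1 : H) = 𝟙 (regular H) := (eq_elt (𝟙 (regular H))).symm
      have h2 : precompAction (regular H) (regular H) d n (𝟙 _) = LinearMap.id :=
        LinearMap.ext fun T => by simp
      change e.conj (precompAction (regular H) (regular H) d n (elt (regular H) 1)) = _
      rw [h1, h2]
      exact LinearEquiv.conj_id e)
    (fun a b => by
      have h1 : elt (regular H) (a * b) = elt (regular H) a ≫ elt (regular H) b :=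
        elt_rho (regular H) a b
      have h2 : precompAction (regular H) (regular H) d n (elt (regular H) (a * b)) =
          precompAction (regular H) (regular H) d n (elt (regular H) a) ∘ₗ
          precompAction (regular H) (regular H) d n (elt (regular H) b) :=
        LinearMap.ext fun T => by
          rw [h1]
          exact (congrArg (· ≫ T) (comp_actionHomLeft _ _ d)).trans (Category.assoc _ _ _)
      exact (congrArg e.conj h2).trans (LinearEquiv.conj_comp e _ _))

theorem homRep_rho {d n : D} {k : ℕ} (e : (regular H ⊙ₗ d ⟶ n) ≃ₗ[ℂ] (Fin k → ℂ)) (a : H)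
    (T : regular H ⊙ₗ d ⟶ n) :
    (homRep e).ρ a (e T) = e (elt (regular H) a ⊵ₗ d ≫ T) := by
  change e (elt (regular H) a ⊵ₗ d ≫ e.symm (e T)) = _
  rw [e.symm_apply_apply]

/-- Morphisms `X ⊗ d ⟶ n` as morphisms from `X` to the internal hom. -/
@[reducible] noncomputable def toHomRep {d n : D} {k : ℕ}
    (e : (regular H ⊙ₗ d ⟶ n) ≃ₗ[ℂ] (Fin k → ℂ)) {X : FdMod H} (T : X ⊙ₗ d ⟶ n) :
    X ⟶ homRep e where
  hom := e.toLinearMap ∘ₗ (precompAction (regular H) X d n).flip T ∘ₗ elt X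
  comm a := LinearMap.ext fun x => by
    refine Eq.trans ?_ (homRep_rho e a _).symm
    change e (elt X (X.ρ a x) ⊵ₗ d ≫ T) = e (elt (regular H) a ⊵ₗ d ≫ elt X x ⊵ₗ d ≫ T)
    rw [elt_rho, comp_actionHomLeft, Category.assoc]

theorem toHomRep_hom_apply {d n : D} {k : ℕ} (e : (regular H ⊙ₗ d ⟶ n) ≃ₗ[ℂ] (Fin k → ℂ))
    {X : FdMod H} (T : X ⊙ₗ d ⟶ n) (x : X.V) :
    (toHomRep e T).hom x = e (elt X x ⊵ₗ d ≫ T) := rfl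

theorem toHomRep_comp {d n : D} {k : ℕ} (e : (regular H ⊙ₗ d ⟶ n) ≃ₗ[ℂ] (Fin k → ℂ))
    {X Y : FdMod H} (g : X ⟶ Y) (T : Y ⊙ₗ d ⟶ n) :
    toHomRep e (g ⊵ₗ d ≫ T) = g ≫ toHomRep e T :=
  hom_ext (LinearMap.ext fun x => by
    change e (elt X x ⊵ₗ d ≫ g ⊵ₗ d ≫ T) = e (elt Y (g.hom x) ⊵ₗ d ≫ T)
    rw [← elt_comp, comp_actionHomLeft, Category.assoc])

/-- For the regular module this is Hom_H(H, V) = V. The general case follows because the identity of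
`X` is a sum of morphisms through `H`. -/
theorem toHomRep_bijective {d n : D} {k : ℕ} (e : (regular H ⊙ₗ d ⟶ n) ≃ₗ[ℂ] (Fin k → ℂ))
    (X : FdMod H) : Function.Bijective (toHomRep e : (X ⊙ₗ d ⟶ n) → (X ⟶ homRep e)) := by
  obtain ⟨m, i, r, hir⟩ := isAdditiveGenerator_regular X
  have hsum (T : X ⊙ₗ d ⟶ n) : T = ∑ j, i j ⊵ₗ d ≫ r j ⊵ₗ d ≫ T := by
    have h := congrArg (· ⊵ₗ d ≫ T) hir
    simp only [sum_actionHomLeft, Preadditive.sum_comp, comp_actionHomLeft, Category.assoc,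
      id_actionHomLeft, Category.id_comp] at h
    exact h.symm
  constructor
  · intro T T' h
    rw [hsum T, hsum T']
    refine Finset.sum_congr rfl fun j _ => congrArg _ ?_
    rw [eq_elt (r j)]
    exact e.injective (LinearMap.congr_fun (congrArg Hom.hom h) ((r j).hom 1))
  · intro τ
    -- The preimage is prescribed on each copy of `H` by the value of `τ` at the generator r_j(1).
    refine ⟨∑ j, i j ⊵ₗ d ≫ e.symm (τ.hom ((r j).hom 1)), hom_ext (LinearMap.ext fun x => ?_)⟩
    have h1 : x = ∑ j, X.ρ ((i j).hom x) ((r j).hom 1) := by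
      have h := LinearMap.congr_fun ((sum_hom _ _).symm.trans (congrArg Hom.hom hir)) x
      rw [LinearMap.sum_apply] at h
      refine h.symm.trans (Finset.sum_congr rfl fun j _ => ?_)
      exact LinearMap.congr_fun (congrArg Hom.hom (eq_elt (r j))) ((i j).hom x)
    rw [toHomRep_hom_apply, Preadditive.comp_sum, map_sum]
    conv_rhs => rw [h1, map_sum]
    refine Finset.sum_congr rfl fun j _ => ?_
    refine Eq.trans ?_ (comm_apply τ ((i j).hom x) ((r j).hom 1)).symm
    have h2 := homRep_rho e ((i j).hom x) (e.symm (τ.hom ((r j).hom 1)))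
    rw [e.apply_symm_apply] at h2
    refine Eq.trans ?_ h2.symm
    rw [← elt_comp, comp_actionHomLeft, Category.assoc]

/-- The evaluation is the morphism corresponding to the identity of the representing object; by
naturality, `toHomRep` inverts the map that it induces. -/
theorem closedAction_of_finite (hD : ∀ X Y : D, Module.Finite ℂ (X ⟶ Y)) :
    ClosedAction (FdMod H) D where
  exists_internalHom d n := by
    have := hD (regular H ⊙ₗ d) n
    let e := (Module.finBasis ℂ (regular H ⊙ₗ d ⟶ n)).equivFun
    obtain ⟨ev, hev⟩ := (toHomRep_bijective e (homRep e)).2 (𝟙 _)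
    refine ⟨homRep e, ev, fun X => ?_⟩
    rw [← (toHomRep_bijective e X).of_comp_iff']
    convert Function.bijective_id (α := X ⟶ homRep e) using 1
    funext g
    exact (toHomRep_comp e g ev).trans ((congrArg (g ≫ ·) hev).trans (Category.comp_id g))

end ClosedAction

end

section

/-! ### Right `𝔐`-modules as modules over the smash product -/

namespace Smash


variable {H 𝔐 : Type} [Ring H] [Bialgebra ℂ H] [Ring 𝔐] [Algebra ℂ 𝔐] [HModuleAlgebra H 𝔐]

section Mul

theorem mk_one_mul_mk (a b : 𝔐) (g : H) : (mk a 1 * mk b g : Smash H 𝔐) = mk (b * a) g := by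
  have h := mk_mul_mk (H := H) a b 1 g {(1, 1)} (by
    rw [Bialgebra.comul_one, Finset.sum_singleton]
    rfl)
  rw [h, Finset.sum_singleton, map_one, one_mul]
  rfl

theorem mk_eq_mul (a : 𝔐) (h : H) : (mk a h : Smash H 𝔐) = mk a 1 * mk 1 h := by
  rw [mk_one_mul_mk, one_mul]

theorem one_mk_mul_one_mk (h g : H) : (mk 1 h * mk 1 g : Smash H 𝔐) = mk 1 (h * g) := by
  obtain ⟨s, hs⟩ := TensorProduct.exists_finset (Coalgebra.comul (R := ℂ) h)
  rw [mk_mul_mk 1 1 h g s hs]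
  have h1 := Coalgebra.lTensor_counit_comul (R := ℂ) h
  rw [hs] at h1
  have h2 := congrArg (fun x => (mk 1 (TensorProduct.rid ℂ H x * g) : Smash H 𝔐)) h1
  simp only [map_sum, LinearMap.lTensor_tmul, TensorProduct.rid_tmul, one_smul,
    Finset.sum_mul] at h2
  rw [← h2]
  refine Eq.trans ?_ (TensorProduct.tmul_sum _ _ _).symm
  refine Finset.sum_congr rfl fun p _ => ?_
  rw [HModuleAlgebra.act_one, mul_one, smul_mul_assoc]
  exact TensorProduct.smul_tmul _ _ _

/-- The algebra homomorphism `h ↦ 1 # h`. -/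
noncomputable def ofH (H 𝔐 : Type) [Ring H] [Bialgebra ℂ H] [Ring 𝔐] [Algebra ℂ 𝔐]
    [HModuleAlgebra H 𝔐] : H →ₐ[ℂ] Smash H 𝔐 :=
  AlgHom.ofLinearMap (TensorProduct.mk ℂ 𝔐 H 1 : H →ₗ[ℂ] 𝔐 ⊗[ℂ] H) rfl
    fun h g => (one_mk_mul_one_mk h g).symm

end Mul

section ToSmash

variable [Module.Finite ℂ 𝔐] (X : RMod (HModuleAlgebra.mon H 𝔐))

/-- The action `x ⊗ a ↦ x ◁ a` of a right module. -/
@[reducible] noncomputable def actR : X.X.V →ₗ[ℂ] 𝔐 →ₗ[ℂ] X.X.V :=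
  TensorProduct.curry X.act.hom

theorem actR_one (x : X.X.V) : actR X x (1 : 𝔐) = x := by
  have h := LinearMap.congr_fun (congrArg FdMod.Hom.hom X.act_one) (x ⊗ₜ[ℂ] (1 : ℂ))
  have h2 : X.act.hom (x ⊗ₜ[ℂ] ((1 : ℂ) • (1 : 𝔐))) = (1 : ℂ) • x := h
  rw [one_smul, one_smul] at h2
  exact h2

theorem actR_mul (x : X.X.V) (a b : 𝔐) : actR X x (a * b) = actR X (actR X x a) b :=
  LinearMap.congr_fun (congrArg FdMod.Hom.hom X.act_assoc) (x ⊗ₜ[ℂ] (a ⊗ₜ[ℂ] b))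

theorem rho_actR (h : H) (s : Finset (H × H))
    (hs : Coalgebra.comul (R := ℂ) h = ∑ p ∈ s, p.1 ⊗ₜ[ℂ] p.2) (x : X.X.V) (a : 𝔐) :
    X.X.ρ h (actR X x a) = ∑ p ∈ s, actR X (X.X.ρ p.1 x) (HModuleAlgebra.act p.2 a) := by
  refine (FdMod.comm_apply X.act h (x ⊗ₜ[ℂ] a)).symm.trans ?_
  have h1 : (X.X ⊗ (HModuleAlgebra.mon H 𝔐).X).ρ h (x ⊗ₜ[ℂ] a) =
      ∑ p ∈ s, X.X.ρ p.1 x ⊗ₜ[ℂ] HModuleAlgebra.act (M := 𝔐) p.2 a := by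
    change FdMod.box X.X.ρ HModuleAlgebra.act (Coalgebra.comul (R := ℂ) h) (x ⊗ₜ[ℂ] a) = _
    rw [hs, map_sum, LinearMap.sum_apply]
    rfl
  exact (congrArg X.act.hom h1).trans (map_sum X.act.hom _ _)

/-- The action of the smash product, as a linear map. -/
noncomputable def rhoL : 𝔐 ⊗[ℂ] H →ₗ[ℂ] Module.End ℂ X.X.V :=
  TensorProduct.lift ((LinearMap.mul ℂ (Module.End ℂ X.X.V)).compl₁₂ (actR X).flip
    X.X.ρ.toLinearMap)

theorem rhoL_mk (a : 𝔐) (h : H) (x : X.X.V) :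
    rhoL X (a ⊗ₜ[ℂ] h) x = actR X (X.X.ρ h x) a := rfl

/-- H-linearity of the right action turns (h(gx ◁ b)) ◁ a into the sum of (h₁gx ◁ (h₂ ▷ b)) ◁ a, and
associativity merges the last two actions into (h₂ ▷ b)a. This is what dictates the product of the
smash product. -/
theorem rhoL_mul_mk (a b : 𝔐) (h g : H) :
    rhoL X (mk a h * mk b g : Smash H 𝔐) = rhoL X (a ⊗ₜ h) * rhoL X (b ⊗ₜ g) := by
  obtain ⟨s, hs⟩ := TensorProduct.exists_finset (Coalgebra.comul (R := ℂ) h)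
  rw [mk_mul_mk a b h g s hs]
  refine (map_sum (rhoL X) _ _).trans (LinearMap.ext fun x => ?_)
  rw [LinearMap.sum_apply, Module.End.mul_apply, rhoL_mk, rhoL_mk, rho_actR X h s hs, map_sum,
    LinearMap.sum_apply]
  refine Finset.sum_congr rfl fun p _ => ?_
  refine (rhoL_mk X _ _ x).trans ?_
  rw [actR_mul, map_mul]
  rfl

/-- The action of the smash product. -/
noncomputable def rhoS : Smash H 𝔐 →ₗ[ℂ] Module.End ℂ X.X.V := rhoL X

/-- The module over the smash product with the same underlying space. -/
@[reducible] noncomputable def ofRMod : FdMod (Smash H 𝔐) where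
  V := X.X.V
  ρ := AlgHom.ofLinearMap (rhoS X)
    (LinearMap.ext fun x => by
      refine (rhoL_mk X 1 1 x).trans ?_
      refine Eq.trans ?_ (actR_one X x)
      exact congrArg (fun y => actR X y 1) (LinearMap.congr_fun (map_one X.X.ρ) x))
    (fun u v => by
      refine ind u ?_ (fun a h => ?_) (fun u u' hu hu' => ?_)
      · rw [zero_mul, map_zero, zero_mul]
      · refine ind v ?_ (fun b g => ?_) (fun v v' hv hv' => ?_)
        · rw [mul_zero, map_zero, mul_zero]
        · exact rhoL_mul_mk X a b h g
        · rw [mul_add, map_add, map_add, mul_add, hv, hv']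
      · rw [add_mul, map_add, map_add, add_mul, hu, hu'])

theorem ext_mk {V W : Type} [AddCommGroup V] [Module ℂ V] [AddCommGroup W] [Module ℂ W]
    {F G : Smash H 𝔐 →ₗ[ℂ] V →ₗ[ℂ] W} (h : ∀ a g v, F (mk a g) v = G (mk a g) v)
    (u : Smash H 𝔐) : F u = G u := by
  refine ind u ?_ (fun a h' => LinearMap.ext (h a h')) (fun u v hu hv => ?_)
  · rw [map_zero, map_zero]
  · rw [map_add, map_add, hu, hv]

/-- A linear map commuting with the operators `a # h` is a morphism. -/
@[reducible] def homMk {Y Z : FdMod (Smash H 𝔐)} (f : Y.V →ₗ[ℂ] Z.V)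
    (h : ∀ a g v, f (Y.ρ (mk a g) v) = Z.ρ (mk a g) (f v)) : Y ⟶ Z where
  hom := f
  comm u := ext_mk (F := (LinearMap.compRight ℂ f) ∘ₗ Y.ρ.toLinearMap)
    (G := (LinearMap.lcomp ℂ Z.V f) ∘ₗ Z.ρ.toLinearMap) h u

variable {X} in
theorem actR_hom {Y : RMod (HModuleAlgebra.mon H 𝔐)} (f : X ⟶ Y) (x : X.X.V) (a : 𝔐) :
    f.hom.hom (actR X x a) = actR Y (f.hom.hom x) a :=
  LinearMap.congr_fun (congrArg FdMod.Hom.hom f.act_hom) (x ⊗ₜ[ℂ] a)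

variable (H 𝔐) in
/-- Right `𝔐`-modules in `Rep(H)` as modules over the smash product. -/
@[reducible] noncomputable def ofRModFunctor : RMod (HModuleAlgebra.mon H 𝔐) ⥤ FdMod (Smash H 𝔐) where
  obj := ofRMod
  map {X Y} f := homMk f.hom.hom fun a g x => by
    refine (actR_hom f (X.X.ρ g x) a).trans ?_
    exact congrArg (fun y => actR Y y a) (FdMod.comm_apply f.hom g x)

instance : (ofRModFunctor H 𝔐).Additive where
  map_add := rfl

instance : (ofRModFunctor H 𝔐).Linear ℂ where
  map_smul _ _ := rfl

/-- Both sides are the sum of h₁w ⊗ (h₂x ◁ a): on the left by the coaction, on the right because `𝔐`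
acts on the second factor only. -/
theorem tensor_rho_mk (W : FdMod H) (a : 𝔐) (h : H) (w : W.V) (x : X.X.V) :
    (FdMod.tensor W (ofRMod X)).ρ (mk a h) (w ⊗ₜ[ℂ] x) =
      (ofRMod (W ⊙ₗ X)).ρ (mk a h) (w ⊗ₜ[ℂ] x) := by
  have h1 (t : H ⊗[ℂ] H) : FdMod.boxRho W (ofRMod X) (leftCommS (a ⊗ₜ t)) (w ⊗ₜ[ℂ] x) =
      actR (W ⊙ₗ X) (FdMod.box W.ρ X.X.ρ t (w ⊗ₜ[ℂ] x)) a := by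
    induction t with
    | zero =>
      simp only [TensorProduct.tmul_zero, map_zero, LinearMap.zero_apply]
      exact (LinearMap.map_zero₂ (actR (W ⊙ₗ X)) a).symm
    | add s t hs ht =>
      simp only [TensorProduct.tmul_add, map_add, LinearMap.add_apply, hs, ht]
      exact (LinearMap.map_add₂ (actR (W ⊙ₗ X)) _ _ a).symm
    | tmul g k => rfl
  exact h1 _

/-- The identity maps `W ⊗ E(X) ≅ E(W ⊗ X)`. -/
@[reducible] noncomputable def tensorIso (W : FdMod H) :
    W ⊙ₗ (ofRModFunctor H 𝔐).obj X ≅ (ofRModFunctor H 𝔐).obj (W ⊙ₗ X) :=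
  FdMod.mkIso (LinearEquiv.refl ℂ (W.V ⊗[ℂ] X.X.V)) fun u => by
    refine ext_mk (F := (FdMod.tensor W (ofRMod X)).ρ.toLinearMap)
      (G := (ofRMod (W ⊙ₗ X)).ρ.toLinearMap) (fun a h v => ?_) u
    have key : (FdMod.tensor W (ofRMod X)).ρ (mk a h) = (ofRMod (W ⊙ₗ X)).ρ (mk a h) :=
      TensorProduct.ext' (tensor_rho_mk X W a h)
    exact LinearMap.congr_fun key v

noncomputable instance : (ofRModFunctor H 𝔐).LaxLeftLinear (FdMod H) where
  μₗ W X := (tensorIso X W).hom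
  μₗ_naturality_left f X := rfl
  μₗ_naturality_right W _ _ f := rfl
  μₗ_associativity W W' X := FdMod.hom_ext (TensorProduct.ext_threefold fun _ _ _ => rfl)
  μₗ_unitality X := rfl

noncomputable instance : (ofRModFunctor H 𝔐).LeftLinear (FdMod H) :=
  leftLinearOfLax _ (fun W X => (tensorIso X W).inv) (fun W X => (tensorIso X W).hom_inv_id)
    (fun W X => (tensorIso X W).inv_hom_id)

theorem ofRMod_rho_one_mk (h : H) : (ofRMod X).ρ (mk 1 h) = X.X.ρ h :=
  LinearMap.ext fun _ => actR_one X _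

theorem ofRMod_rho_mk_one (a : 𝔐) (x : X.X.V) : (ofRMod X).ρ (mk a 1) x = actR X x a :=
  congrArg (fun y => actR X y a) (LinearMap.congr_fun (map_one X.X.ρ) x)

instance : (ofRModFunctor H 𝔐).Faithful where
  map_injective h := by
    have h1 := congrArg FdMod.Hom.hom h
    exact RMod.hom_ext (FdMod.hom_ext h1)

/-- Commuting with the elements 1 # h is H-linearity, and commuting with the elements a # 1 is right
𝔐-linearity. -/
instance : (ofRModFunctor H 𝔐).Full where
  map_surjective {X Y} f := ⟨⟨⟨f.hom, fun h => by
    have h1 := f.comm (mk 1 h)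
    rw [ofRMod_rho_one_mk, ofRMod_rho_one_mk] at h1
    exact h1⟩, FdMod.hom_ext (TensorProduct.ext' fun x a => by
      have h1 := FdMod.comm_apply f (mk a 1) x
      exact (congrArg f.hom (ofRMod_rho_mk_one X a x)).symm.trans
        (h1.trans (ofRMod_rho_mk_one Y a (f.hom x))))⟩, rfl⟩

end ToSmash

section FromSmash

variable (Y : FdMod (Smash H 𝔐))

/-- The representation of `H` underlying a module over the smash product. -/
@[reducible] noncomputable def resH : FdMod H where
  V := Y.V
  ρ := Y.ρ.comp (ofH H 𝔐)

/-- The map `y ⊗ a ↦ (a # 1) y`. -/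
noncomputable def actS : Y.V ⊗[ℂ] 𝔐 →ₗ[ℂ] Y.V :=
  TensorProduct.lift (Y.ρ.toLinearMap ∘ₗ mkL ∘ₗ (TensorProduct.mk ℂ 𝔐 H).flip 1).flip

/-- The relation (1 # h)(a # 1) = ∑ (h₂ ▷ a) # h₁ of the smash product is exactly the H-linearity of
the right action y ◁ a = (a # 1)y. -/
theorem actS_box (h : H) (y : Y.V) (a : 𝔐) :
    actS Y (FdMod.box (resH Y).ρ HModuleAlgebra.act (Coalgebra.comul (R := ℂ) h) (y ⊗ₜ a)) =
      Y.ρ (mk 1 h) (Y.ρ (mk a 1) y) := by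
  obtain ⟨s, hs⟩ := TensorProduct.exists_finset (Coalgebra.comul (R := ℂ) h)
  rw [← Module.End.mul_apply, ← map_mul, mk_mul_mk 1 a h 1 s hs, hs]
  simp only [map_sum, LinearMap.sum_apply]
  refine Finset.sum_congr rfl fun p _ => ?_
  rw [mul_one, mul_one, mk_eq_mul, map_mul]
  rfl

variable [Module.Finite ℂ 𝔐]

/-- The right `𝔐`-module of a module over the smash product. -/
@[reducible] noncomputable def toRMod : RMod (HModuleAlgebra.mon H 𝔐) where
  X := resH Y
  act := ⟨actS Y, fun h => TensorProduct.ext' fun y a => actS_box Y h y a⟩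
  act_one := FdMod.hom_ext (TensorProduct.ext' fun y (c : ℂ) => by
    change Y.ρ (mk (c • (1 : 𝔐)) 1) y = c • y
    have h1 : (mk (c • (1 : 𝔐)) 1 : Smash H 𝔐) = c • 1 := TensorProduct.smul_tmul' c _ _
    rw [h1, map_smul, map_one]
    rfl)
  act_assoc := FdMod.hom_ext (TensorProduct.ext_threefold' fun y (a b : 𝔐) => by
    change Y.ρ (mk (a * b) 1) y = Y.ρ (mk b 1) (Y.ρ (mk a 1) y)
    rw [← Module.End.mul_apply, ← map_mul, mk_one_mul_mk])

/-- Every module over the smash product comes from a right `𝔐`-module. -/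
@[reducible] noncomputable def ofRModToRMod : ofRMod (toRMod Y) ≅ Y :=
  FdMod.mkIso (LinearEquiv.refl ℂ Y.V) fun u =>
    ext_mk (F := (ofRMod (toRMod Y)).ρ.toLinearMap) (G := Y.ρ.toLinearMap) (fun a g v => by
      refine Eq.trans ?_ (LinearMap.congr_fun (congrArg Y.ρ (mk_eq_mul a g)) v).symm
      rw [map_mul]
      rfl) u

variable (H 𝔐) in
theorem isEquivalence_ofRModFunctor : (ofRModFunctor H 𝔐).IsEquivalence where
  essSurj := ⟨fun Y => ⟨toRMod Y, ⟨ofRModToRMod Y⟩⟩⟩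

variable (H 𝔐) in
theorem exists_smashAction : ∃ E : ModFun (FdMod H) (RMod (HModuleAlgebra.mon H 𝔐)) (FdMod (Smash H 𝔐)),
    E.F.IsEquivalence ∧ IsSmashAction E :=
  ⟨⟨ofRModFunctor H 𝔐⟩, isEquivalence_ofRModFunctor H 𝔐,
    fun X => LinearEquiv.refl ℂ X.X.V, fun _ _ _ _ => rfl, fun _ _ _ _ => rfl,
    fun _ _ _ _ => rfl⟩

end FromSmash

end Smash

end

end QuantumDouble

theorem mainTheorem4
    {H : Type} [Ring H] [HopfAlgebra ℂ H] [StarRing H] [StarModule ℂ H] [CStarHopfAlgebra H]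
    {𝔐 : Type} [Ring 𝔐] [Algebra ℂ 𝔐] [Module.Finite ℂ 𝔐] [HModuleAlgebra H 𝔐]
    {𝔑 : Type} [Ring 𝔑] [Algebra ℂ 𝔑] [Module.Finite ℂ 𝔑] [HModuleAlgebra H 𝔑]
    {ℳ : Type*} [Category ℳ] [Abelian ℳ] [Linear ℂ ℳ] [FiniteSemisimple ℳ]
    [MonoidalLeftAction (FdMod H) ℳ] [BilinearAction (FdMod H) ℳ]
    {𝒩 : Type*} [Category 𝒩] [Abelian 𝒩] [Linear ℂ 𝒩] [FiniteSemisimple 𝒩]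
    [MonoidalLeftAction (FdMod H) 𝒩] [BilinearAction (FdMod H) 𝒩]
    (M : ℳ) [ModObj (HModuleAlgebra.mon H 𝔐).X M] (hM : IsGenerator (FdMod H) M)
    (h𝔐 : IsInternalEnd (HModuleAlgebra.mon H 𝔐) M)
    (N : 𝒩) [ModObj (HModuleAlgebra.mon H 𝔑).X N] (hN : IsGenerator (FdMod H) N)
    (h𝔑 : IsInternalEnd (HModuleAlgebra.mon H 𝔑) N) :
    (∃ E : ModFun (FdMod H) (RMod (HModuleAlgebra.mon H 𝔐)) (FdMod (Smash H 𝔐)),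
      E.F.IsEquivalence ∧ IsSmashAction E) ∧
    ∃ (P : ModFun (FdMod H) (RMod (HModuleAlgebra.mon H 𝔐)) ℳ)
      (Q : ModFun (FdMod H) (RMod (HModuleAlgebra.mon H 𝔑)) 𝒩),
      (P.F.IsEquivalence ∧ SendsRegularTo P M) ∧
      (Q.F.IsEquivalence ∧ SendsRegularTo Q N) ∧
      (∃ Φ : ModFun (FdMod H) ℳ ℳ ≌ Bimod (HModuleAlgebra.mon H 𝔐) (HModuleAlgebra.mon H 𝔐),
        Φ.functor.Additive ∧ Φ.functor.Linear ℂ ∧ IsEvaluation M P Φ.functor) ∧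
      ∃ (Φ : ModFun (FdMod H) ℳ 𝒩 ≌ Bimod (HModuleAlgebra.mon H 𝔐) (HModuleAlgebra.mon H 𝔑))
        (Φ' : ModFun (FdMod H) 𝒩 ℳ ≌ Bimod (HModuleAlgebra.mon H 𝔑) (HModuleAlgebra.mon H 𝔐))
        (Ψ : (ModFun (FdMod H) ℳ 𝒩)ᵒᵖ ≌
          Bimod (HModuleAlgebra.mon H 𝔑) (HModuleAlgebra.mon H 𝔐)),
        (Φ.functor.Additive ∧ Φ.functor.Linear ℂ ∧ IsEvaluation M Q Φ.functor) ∧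
        (Φ'.functor.Additive ∧ Φ'.functor.Linear ℂ ∧ IsEvaluation N P Φ'.functor) ∧
        ∀ F : ModFun (FdMod H) ℳ 𝒩, ∃ G : ModFun (FdMod H) 𝒩 ℳ,
          F.IsRightAdjoint G ∧ Nonempty (Ψ.functor.obj (Opposite.op F) ≅ Φ'.functor.obj G) := by
  have : Module.Finite ℂ H := CStarHopfAlgebra.finite
  have : IsSemisimpleRing H := isSemisimpleRing_of_cstar
  -- Semisimplicity of `H` and finite-dimensional Hom spaces supply the internal homs on which the
  -- general theory depends.
  have : ClosedAction (FdMod H) ℳ := closedAction_of_finite FiniteSemisimple.hom_finite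
  have : ClosedAction (FdMod H) 𝒩 := closedAction_of_finite FiniteSemisimple.hom_finite
  obtain ⟨Φ', hΦ'⟩ := exists_evaluation_equivalence N hN h𝔑 M hM h𝔐
  obtain ⟨Φ, hΦ⟩ := exists_evaluation_equivalence M hM h𝔐 N hN h𝔑
  obtain ⟨Ψ, hΨ⟩ := exists_opposite_equivalence FdMod.isAdditiveGenerator_regular M hM h𝔐 N hN h𝔑 Φ'
  exact ⟨Smash.exists_smashAction H 𝔐,
    RelTensor.modFun (HModuleAlgebra.mon H 𝔐) M, RelTensor.modFun (HModuleAlgebra.mon H 𝔑) N,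
    ⟨RelTensor.isEquivalence_functor M hM h𝔐, RelTensor.modFun_sendsRegularTo _ M⟩,
    ⟨RelTensor.isEquivalence_functor N hN h𝔑, RelTensor.modFun_sendsRegularTo _ N⟩,
    exists_evaluation_equivalence M hM h𝔐 M hM h𝔐, Φ, Φ', Ψ, hΦ, hΦ', hΨ⟩
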